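/- Let $\sigma_0=I,\sigma_1,\sigma_2,\sigma_3$ be the Pauli operators, let $X=(X_0,X_1)$, $Y=(Y_0,Y_1)$, $Z=(Z_0,Z_1)$, $W=(W_0,W_1)$ be the single-qubit projective measurements $\big(\tfrac{I+A}{2},\tfrac{I-A}{2}\big)$ for $A=\sigma_1,\ \sigma_2,\ \sigma_3,\ (\sigma_1+\sigma_2)/\sqrt2$ respectively, and for such a measurement $M=(M_0,M_1)$ put $\overline{M}=(M_1,M_0)$. For single-qubit measurements $M^{(1)},\dots,M^{(k)}$ let $\oplus[M^{(1)},\dots,M^{(k)}]$ be the $k$-qubit measurement $(P_0,P_1)$ with $P_i=\sum_{j_1\oplus\cdots\oplus j_k=i}M^{(1)}_{j_1}\otimes\cdots\otimes M^{(k)}_{j_k}$. Let $S$ be the set consisting of $$\oplus[X,X],\ \oplus[Z,Z],\ \oplus[X,\overline X],\ \oplus[Z,\overline Z],\ \oplus[X,Z],\ \oplus[Z,X],\ \oplus[X,W],\ \oplus[X,Y],\ \oplus[X,\overline Y],\ \oplus[X,X,X],\ \oplus[Z,Z,Z].$$ Let $H$ be the Hadamard gate, $T=e^{-i\pi\sigma_3/8}$,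 and C-NOT $|a,b\rangle\mapsto|a,a\oplus b\rangle$. For a unitary $U$ on $n$ qubits and $j\in\{0,1,2,3\}^n$ write $\sigma_j=\sigma_{j_1}\otimes\cdots\otimes\sigma_{j_n}$ and let $|U_j\rangle=(I\otimes U\sigma_j)|\mathrm{EPR}\rangle^{\otimes n}$ be the state of $2n$ qubits in which qubit $i$ is paired with qubit $n+i$ and $U\sigma_j$ acts on the last $n$ qubits; Nielsen's scheme simulates $U$ by trials that use the measurement in the basis $\{|U_j\rangle\}$ and Bell measurements, and if a trial leaves $U\sigma_e|\psi\rangle$ (up to phase) then the next trial simulates $U\sigma_eU^\dagger$. For errors $e_1,\dots,e_r\in\{0,1,2,3\}^n$ let $U^{(0)}=U$, $U^{(s)}=U^{(s-1)}\sigma_{e_s}(U^{(s-1)})^\dagger$; thus $U^{(r)}$ is the gate to be simulated in trial $r+1$. A *measurement protocol over $S$* acts on a register of qubits (initially the $n$ input qubits), performs a bounded number of operations, each of which prepares a new qubit in the state $|0\rangle$ or makes a measurement of $S$ on some qubits of the register, where each operation may depend on the earlier outcomes, and ends by naming $n$ output qubits or by reporting failure. It *simulates* a unitary $V$ on $n$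 qubits with failure probability at most $\delta$ if for every input state $|\psi\rangle$ it reports failure with probability at most $\delta$, and whenever it does not report failure the output qubits are in the state $V|\psi\rangle$ up to phase, in a product with the other qubits. Then: 1. $S$ is finite; each measurement in $S$ is a binary projective measurement (two orthogonal projections of equal rank) and is $\oplus$-separate, with single-qubit measurements from $\{X,Y,Z,W\}$ up to exchange of the two outcomes; all measurements in $S$ act on two qubits except exactly two, which act on three qubits. 2. The measurement in the Bell basis $\{|I_j\rangle\}$ of two qubits is equivalent to the two commuting measurements $\oplus[X,X]$, $\oplus[Z,Z]$ in sequence. For each $U\in\{H,T,\text{C-NOT}\}$ (with $n=1,1,2$ qubits) and all errors $e_1,\dots,e_r$, $r\ge0$, the measurement in the basis $\{|U^{(r)}_j\rangle\}$ is equivalent to a sequence of $2n$ pairwise commuting measurements of $S$ on some of the $2n$ qubits. If $r\ge1$ for $U=H$ or C-NOT, or $r\ge2$ for $U=T$, then $U^{(r)}$ is a tensor product of Pauli operators up to phase, and the sequence can be chosen to consist only of Bell measurements $\oplus[X,X]$, $\oplus[Z,Z]$ on pairs of qubits $i$, $n+i$. 3. For every circuit on $n$ qubits with gates $g_1,\dots,g_m$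 from $\{H,T,\text{C-NOT}\}$, where $g_k$ acts on $a_k\in\{1,2\}$ qubits, and every $t\ge0$, there is a measurement protocol over $S$ with at most $\sum_k 6a_kt$ operations that simulates the unitary operator of the circuit with failure probability at most $\sum_k(1-4^{-a_k})^t$. 4. $S$ is universal for quantum computation: for every $n$, every unitary $U$ on $n$ qubits and every $\varepsilon>0$ there are a unitary $V$ with $\|V-U\|\le\varepsilon$ in operator norm and a measurement protocol over $S$ that simulates $V$ with failure probability at most $\varepsilon$. In particular, measurements on at most three qubits, together with quantum memory and preparation of $|0\rangle$, suffice for universal quantum computation. -/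

import Mathlib

noncomputable section

namespace MeasQC

open Matrix

/-! ### Qubit registers -/

/-- Labels of the computational basis of `n` qubits. -/
abbrev Bits (n : ℕ) : Type := Fin n → Fin 2

/-- Operators on `n` qubits, as matrices in the computational basis. -/
abbrev QOp (n : ℕ) : Type := Matrix (Bits n) (Bits n) ℂ

/-- State vectors of `n` qubits (not necessarily normalized). -/
abbrev QState (n : ℕ) : Type := Bits n → ℂ

/-- The squared norm of a state vector. -/
def normSq {n : ℕ} (ψ : QState n) : ℝ := ∑ x, ‖ψ x‖ ^ 2

/-- The tensor product `A 0 ⊗ A 1 ⊗ ⋯ ⊗ A (n-1)` of single-qubit operators. -/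
def tensor {n : ℕ} (A : Fin n → Matrix (Fin 2) (Fin 2) ℂ) : QOp n :=
  Matrix.of fun x y => ∏ k, A k (x k) (y k)

/-- The operator on `N` qubits that acts as `A` on the qubits `e 0, …, e (n-1)` (in this order)
and as the identity on all the other qubits. -/
def embed {n N : ℕ} (e : Fin n ↪ Fin N) (A : QOp n) : QOp N :=
  Matrix.of fun x y =>
    open Classical in
    if ∀ k, k ∉ Set.range e → x k = y k then A (fun i => x (e i)) (fun i => y (e i)) else 0

/-- The state `φ ⊗ |0⟩` on `N + 1` qubits. -/
def adjoinZero {N : ℕ} (φ : QState N) : QState (N + 1) :=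
  fun x => if x (Fin.last N) = 0 then φ (fun i => x i.castSucc) else 0

/-! ### Projective measurements -/

/-- A projective measurement with outcomes in `κ`: mutually annihilating orthogonal projections
that add up to the identity. -/
def IsProjMeas {κ ι : Type} [Fintype κ] [DecidableEq κ] [Fintype ι] [DecidableEq ι]
    (P : κ → Matrix ι ι ℂ) : Prop :=
  (∀ i, (P i).IsHermitian) ∧ (∀ i j, P i * P j = if i = j then P i else 0) ∧ ∑ i, P i = 1

/-- A binary projective measurement: two outcomes with the same degeneracy, i.e. each of the two
projections has half of the full dimension as its trace. -/
def IsBinary {ι : Type} [Fintype ι] [DecidableEq ι] (P : Fin 2 → Matrix ι ι ℂ) : Prop :=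
  IsProjMeas P ∧ ∀ i, 2 * (P i).trace = (Fintype.card ι : ℂ)

/-- Exchange the names of the two outcomes. -/
def swapOutcomes {ι : Type} (P : Fin 2 → Matrix ι ι ℂ) : Fin 2 → Matrix ι ι ℂ := ![P 1, P 0]

/-- A Boolean function is balanced if it takes both values on half of its domain. -/
def IsBalanced {n : ℕ} (f : Bits n → Fin 2) : Prop :=
  ∀ i, 2 * (Finset.univ.filter fun j => f j = i).card = 2 ^ n

/-- `f[m 0, …, m (n-1)]`: the two-valued measurement whose outcome is the Boolean function `f` of
the outcomes of the single-qubit measurements `m k`. -/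
def combine {n : ℕ} (f : Bits n → Fin 2) (m : Fin n → Fin 2 → Matrix (Fin 2) (Fin 2) ℂ) :
    Fin 2 → QOp n :=
  fun i => ∑ j ∈ Finset.univ.filter (fun j : Bits n => f j = i), tensor fun k => m k (j k)

/-- `P` is an `f`-separate binary measurement, and the single-qubit binary measurements in its
`f`-separate form can be taken from `𝒜`. -/
def IsSeparateOver (𝒜 : Set (Fin 2 → Matrix (Fin 2) (Fin 2) ℂ)) {n : ℕ} (f : Bits n → Fin 2)
    (P : Fin 2 → QOp n) : Prop :=
  IsBalanced f ∧ IsBinary P ∧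
    ∃ m : Fin n → Fin 2 → Matrix (Fin 2) (Fin 2) ℂ,
      (∀ k, IsBinary (m k) ∧ m k ∈ 𝒜) ∧ P = combine f m

/-- The parity function (exclusive OR); the addition of `Fin 2` is modulo two. -/
def parity {n : ℕ} (j : Bits n) : Fin 2 := ∑ k, j k

/-- A two-valued measurement together with the number of qubits that it acts on. -/
abbrev QMeas : Type := Σ n : ℕ, (Fin 2 → QOp n)

/-! ### Pauli operators and the measurements of the universal set -/

/-- The Pauli operators `σ₀ = I`, `σ₁`, `σ₂`, `σ₃`. -/
def pauli : Fin 4 → Matrix (Fin 2) (Fin 2) ℂ :=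
  ![1, !![0, 1; 1, 0], !![0, -Complex.I; Complex.I, 0], !![1, 0; 0, -1]]

/-- The tensor product of the Pauli operators `σ_{j 0}, …, σ_{j (n-1)}`. -/
def pauliString {n : ℕ} (j : Fin n → Fin 4) : QOp n := tensor fun k => pauli (j k)

/-- The measurement `((I + A)/2, (I - A)/2)`. -/
def spectralMeas (A : Matrix (Fin 2) (Fin 2) ℂ) : Fin 2 → Matrix (Fin 2) (Fin 2) ℂ :=
  ![(1 / 2 : ℂ) • (1 + A), (1 / 2 : ℂ) • (1 - A)]

/-- The single-qubit measurement `(X₀, X₁)`. -/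
def measX : Fin 2 → Matrix (Fin 2) (Fin 2) ℂ := spectralMeas (pauli 1)

/-- The single-qubit measurement `(Y₀, Y₁)`. -/
def measY : Fin 2 → Matrix (Fin 2) (Fin 2) ℂ := spectralMeas (pauli 2)

/-- The single-qubit measurement `(Z₀, Z₁)`. -/
def measZ : Fin 2 → Matrix (Fin 2) (Fin 2) ℂ := spectralMeas (pauli 3)

/-- The single-qubit measurement `(W₀, W₁)`, with `W₀ = (I + (σ₁ + σ₂)/√2)/2`. -/
def measW : Fin 2 → Matrix (Fin 2) (Fin 2) ℂ :=
  spectralMeas (((1 / √2 : ℝ) : ℂ) • (pauli 1 + pauli 2))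

/-- The four single-qubit measurements `X, Y, Z, W`, each with its outcomes named in either of the
two possible ways. -/
def singleQubitMeas : Set (Fin 2 → Matrix (Fin 2) (Fin 2) ℂ) :=
  {A | A ∈ ({measX, measY, measZ, measW} : Set _) ∨
    swapOutcomes A ∈ ({measX, measY, measZ, measW} : Set _)}

/-- `⊕[A, B]`. -/
abbrev xor2 (A B : Fin 2 → Matrix (Fin 2) (Fin 2) ℂ) : QMeas := ⟨2, combine parity ![A, B]⟩

/-- `⊕[A, B, C]`. -/
abbrev xor3 (A B C : Fin 2 → Matrix (Fin 2) (Fin 2) ℂ) : QMeas :=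
  ⟨3, combine parity ![A, B, C]⟩

/-- The universal set of measurements. -/
def universalSet : Set QMeas :=
  { xor2 measX measX, xor2 measZ measZ,
    xor2 measX (swapOutcomes measX), xor2 measZ (swapOutcomes measZ),
    xor2 measX measZ, xor2 measZ measX,
    xor2 measX measW,
    xor2 measX measY, xor2 measX (swapOutcomes measY),
    xor3 measX measX measX, xor3 measZ measZ measZ }

/-! ### Gates and circuits -/

/-- The names of the three gates: Hadamard, `π/8`, and controlled NOT. -/
inductive Gate : Type
  | H
  | T
  | CNOT

/-- The number of qubits that a gate acts on. -/
def Gate.arity : Gate → ℕ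
  | .H => 1
  | .T => 1
  | .CNOT => 2

/-- The unitary operators of the gates: `H`, `T = exp(-iπσ₃/8)`, and
`|a, b⟩ ↦ |a, a ⊕ b⟩`. -/
def Gate.op : (g : Gate) → QOp g.arity
  | .H => tensor fun _ : Fin 1 => ((1 / √2 : ℝ) : ℂ) • !![1, 1; 1, -1]
  | .T => tensor fun _ : Fin 1 =>
      !![Complex.exp (-(Complex.I * Real.pi / 8)), 0; 0, Complex.exp (Complex.I * Real.pi / 8)]
  | .CNOT => Matrix.of fun x y : Bits 2 => if x 0 = y 0 ∧ x 1 = y 0 + y 1 then 1 else 0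

/-- A gate with the qubits of an `n`-qubit register that it is applied to. -/
abbrev PlacedGate (n : ℕ) : Type := Σ g : Gate, (Fin g.arity ↪ Fin n)

/-- The unitary operator of a circuit; the head of the list is applied first. -/
def circuitOp {n : ℕ} : List (PlacedGate n) → QOp n
  | [] => 1
  | g :: c => circuitOp c * embed g.2 g.1.op

/-! ### The measurements called for by Nielsen's scheme -/

/-- `n` EPR pairs: the `i`-th of the first `n` qubits is paired with the `i`-th of the last `n`. -/
def eprState (n : ℕ) : QState (n + n) := fun x =>
  if (fun i => x (Fin.castAdd n i)) = (fun i => x (Fin.natAdd n i)) then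
    ((1 / √(2 ^ n) : ℝ) : ℂ) else 0

/-- `|U_j⟩ = (I ⊗ U σ_j)|EPR⟩^{⊗ n}`, with `U σ_j` acting on the last `n` qubits. For `U = I` these
are (products of) Bell states. -/
def basisState {n : ℕ} (U : QOp n) (j : Fin n → Fin 4) : QState (n + n) :=
  embed (Fin.natAddEmb n) (U * pauliString j) *ᵥ eprState n

/-- A measurement with the qubits of an `N`-qubit register that it is applied to. -/
abbrev PlacedMeas (N : ℕ) : Type := Σ M : QMeas, (Fin M.1 ↪ Fin N)

/-- The projection of a placed measurement that belongs to the outcome `b`. -/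
def PlacedMeas.proj {N : ℕ} (p : PlacedMeas N) (b : Fin 2) : QOp N := embed p.2 (p.1.2 b)

/-- The nondegenerate measurement in the basis `{|U_j⟩}` is equivalent to a sequence of `2n`
pairwise commuting two-valued measurements taken from `𝒯`: each `|U_j⟩⟨U_j|` is the product of the
projections of one string of outcomes, and distinct `j` correspond to distinct strings. -/
def BasisMeasuredBy {n : ℕ} (𝒯 : Set (PlacedMeas (n + n))) (U : QOp n) : Prop :=
  ∃ L : Fin (n + n) → PlacedMeas (n + n),
    (∀ k, L k ∈ 𝒯) ∧
    (∀ k l a b, Commute ((L k).proj a) ((L l).proj b)) ∧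
    ∃ r : Bits (n + n) ≃ (Fin n → Fin 4), ∀ b : Bits (n + n),
      (List.ofFn fun k => (L k).proj (b k)).prod =
        Matrix.vecMulVec (basisState U (r b)) (star (basisState U (r b)))

/-- The placement on the `i`-th of the first `n` qubits and the `i`-th of the last `n`. -/
def pairPlacement (n : ℕ) (i : Fin n) : Fin 2 ↪ Fin (n + n) where
  toFun := ![Fin.castAdd n i, Fin.natAdd n i]
  inj' := by
    intro a b h
    have hn := i.pos
    fin_cases a <;> fin_cases b <;> simp [Fin.ext_iff] at h ⊢ <;> omega

/-- The Bell measurements `⊕[X, X]` and `⊕[Z, Z]` on corresponding qubits of the two halves. -/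
def bellMeas (n : ℕ) : Set (PlacedMeas (n + n)) :=
  {p | ∃ i : Fin n, p = ⟨xor2 measX measX, pairPlacement n i⟩ ∨
    p = ⟨xor2 measZ measZ, pairPlacement n i⟩}

/-- The gate to be simulated after failed trials with Pauli errors `e₁, e₂, …`: a trial for `V` that
leaves `V σ_e |ψ⟩` (up to a phase) instead of `V|ψ⟩` is followed by a trial for `V σ_e V†`. -/
def trialGate {n : ℕ} (U : QOp n) (errors : List (Fin n → Fin 4)) : QOp n :=
  errors.foldl (fun V e => V * pauliString e * Vᴴ) U

/-- The number of failed trials after which only Bell measurements are needed. -/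
def Gate.nonBellTrials : Gate → ℕ
  | .H => 1
  | .T => 2
  | .CNOT => 1

/-! ### Computing with measurements only -/

/-- Adaptive protocols on a register that holds `N` qubits now and yields `n` output qubits. The
only quantum operations are the preparation of a new qubit in the state `|0⟩` and the measurements
of `S` on any qubits of the register; which operation comes next may depend on all earlier
outcomes. A run ends by naming the output qubits or by reporting failure. -/
inductive Protocol (S : Set QMeas) (n : ℕ) : ℕ → Type
  | output {N : ℕ} (out : Fin n ↪ Fin N) : Protocol S n N
  | failure {N : ℕ} : Protocol S n N
  | prepare {N : ℕ} (next : Protocol S n (N + 1)) : Protocol S n N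
  | measure {N : ℕ} (M : QMeas) (hM : M ∈ S) (e : Fin M.1 ↪ Fin N)
      (next : Fin 2 → Protocol S n N) : Protocol S n N

variable {S : Set QMeas} {n : ℕ}

/-- The largest possible number of operations (preparations and measurements) in a run. -/
def Protocol.steps : {N : ℕ} → Protocol S n N → ℕ
  | _, .output _ => 0
  | _, .failure => 0
  | _, .prepare next => next.steps + 1
  | _, .measure _ _ _ next => max (next 0).steps (next 1).steps + 1

/-- The probability that the protocol reports failure when it is started in the state `φ`. The state
is projected and not renormalized at a measurement, so the squared norm of the current vector is
the probability of the present branch. -/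
def Protocol.failureProb : {N : ℕ} → Protocol S n N → QState N → ℝ
  | _, .output _, _ => 0
  | _, .failure, φ => normSq φ
  | _, .prepare next, φ => next.failureProb (adjoinZero φ)
  | _, .measure M _ e next, φ => ∑ b, (next b).failureProb (embed e (M.2 b) *ᵥ φ)

/-- Whenever the protocol, started in `φ`, ends with output, the output qubits are in the pure
state `θ` (up to a scalar factor), in a product with some state `χ` of the other qubits. -/
def Protocol.Outputs (θ : QState n) : {N : ℕ} → Protocol S n N → QState N → Prop
  | N, .output out, φ =>
      ∃ χ : ({k : Fin N // k ∉ Set.range out} → Fin 2) → ℂ,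
        ∀ x, φ x = θ (fun i => x (out i)) * χ (fun k => x k)
  | _, .failure, _ => True
  | _, .prepare next, φ => next.Outputs θ (adjoinZero φ)
  | _, .measure M _ e next, φ => ∀ b, (next b).Outputs θ (embed e (M.2 b) *ᵥ φ)

/-- The protocol simulates the `n`-qubit operator `V` with failure probability at most `δ`: on every
input state `ψ` it reports failure with probability at most `δ`, and otherwise it outputs `V ψ`. -/
def Protocol.Simulates (p : Protocol S n n) (V : QOp n) (δ : ℝ) : Prop :=
  ∀ ψ : QState n, normSq ψ = 1 → p.Outputs (V *ᵥ ψ) ψ ∧ p.failureProb ψ ≤ δ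

/-- `S` is universal for quantum computation by measurements: every unitary operator on any number
of qubits is approximated to any accuracy by a unitary operator that some protocol with
measurements from `S` simulates with arbitrarily small failure probability. -/
def IsUniversal (S : Set QMeas) : Prop :=
  ∀ (n : ℕ), ∀ U ∈ Matrix.unitaryGroup (Bits n) ℂ, ∀ ε : ℝ, 0 < ε →
    ∃ V ∈ Matrix.unitaryGroup (Bits n) ℂ,
      ‖Matrix.toEuclideanCLM (𝕜 := ℂ) (V - U)‖ ≤ ε ∧
        ∃ p : Protocol S n n, p.Simulates V ε

end MeasQC

end

/-!
The state `|U_j⟩` is the common eigenvector of the `2n` commuting operators `σ₁ ⊗ U σ₁ Uᴴ` and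
`σ₃ ⊗ U σ₃ Uᴴ` on the pairs of qubits `i`, `n + i`, with eigenvalues given by the commutation signs
of `σ_j`. A basis `{|U_j⟩}` is therefore measured by measurements of `S` as soon as the images
`U σ Uᴴ` of the generating Pauli operators are such that these products are, up to signs, parities
in `S`. A failed trial replaces `U` by `U σ_e Uᴴ`, one level lower in the Clifford hierarchy: `H`
and C-NOT have level one and `T` has level two, so that after one or two failures `U` is a Pauli
operator.

A trial consists of `6a` operations: preparing `2a` qubits, measuring them in the basis `{|U_j⟩}`,
and a Bell measurement that teleports the input. It succeeds with probability `4⁻ᵃ` independently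
of the input, and a failure hands the next trial a gate that has the same properties.

For universality, the Hermitian operators `A` for which every `exp (i t A)` is a limit of circuits,
up to phases, form a real vector space by the Trotter formula, invariant under conjugation by
circuits. `T H T H` is a rotation by an irrational multiple of `2π`, which puts a Hermitian operator
on one qubit into this space. Conjugating it with the gates produces all Pauli strings, hence all
Hermitian operators, and every unitary operator is the exponential of one.
-/

noncomputable section

namespace MeasQC

open Matrix

/-! ### Tensor products of single-qubit operators -/

section Tensor

variable {n : ℕ}

/-- Operators on a single qubit. They are kept apart from `QOp 1`, whose index type consists of
functions on `Fin 1`; `singleQubitHom` translates between the two. -/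
abbrev QubitOp : Type := Matrix (Fin 2) (Fin 2) ℂ

theorem tensor_apply (A : Fin n → QubitOp) (x y : Bits n) :
    tensor A x y = ∏ k, A k (x k) (y k) := rfl

theorem tensor_mul (A B : Fin n → QubitOp) :
    tensor A * tensor B = tensor fun k => A k * B k := by
  ext x y
  simp only [Matrix.mul_apply, tensor_apply, ← Finset.prod_mul_distrib, Fintype.prod_sum]

theorem tensor_one : tensor (fun _ : Fin n => 1) = 1 := by
  ext x y
  simp only [tensor_apply, Matrix.one_apply, Fintype.prod_ite_zero, Finset.prod_const_one,
    funext_iff]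

theorem sum_tensor {κ : Type*} [Fintype κ] (f : Fin n → κ → QubitOp) :
    ∑ j : Fin n → κ, tensor (fun k => f k (j k)) = tensor fun k => ∑ c, f k c := by
  ext x y
  simp only [Matrix.sum_apply, tensor_apply, Fintype.prod_sum]

theorem tensor_smul (c : Fin n → ℂ) (A : Fin n → QubitOp) :
    tensor (fun k => c k • A k) = (∏ k, c k) • tensor A := by
  ext x y
  simp only [tensor_apply, Matrix.smul_apply, smul_eq_mul, Finset.prod_mul_distrib]

theorem tensor_conjTranspose (A : Fin n → QubitOp) :
    (tensor A)ᴴ = tensor fun k => (A k)ᴴ := by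
  ext x y
  simp only [tensor_apply, Matrix.conjTranspose_apply, star_prod]

theorem tensor_transpose (A : Fin n → QubitOp) : (tensor A)ᵀ = tensor fun k => (A k)ᵀ := rfl

theorem trace_tensor (A : Fin n → QubitOp) : (tensor A).trace = ∏ k, (A k).trace := by
  simp only [Matrix.trace, Matrix.diag_apply, tensor_apply, Fintype.prod_sum]

end Tensor

/-! ### Operators acting on some of the qubits -/

section Extend

variable {α β γ : Type*}

theorem extend_extend {f : α → β} (hf : f.Injective) (s t : α → γ) (x : β → γ) :
    Function.extend f s (Function.extend f t x) = Function.extend f s x := by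
  funext k
  by_cases hk : ∃ i, f i = k
  · obtain ⟨i, rfl⟩ := hk
    simp only [hf.extend_apply]
  · simp only [Function.extend_apply' _ _ _ hk]

theorem extend_comp_self {f : α → β} (hf : f.Injective) (x : β → γ) :
    Function.extend f (x ∘ f) x = x := by
  funext k
  by_cases hk : ∃ i, f i = k
  · obtain ⟨i, rfl⟩ := hk
    exact hf.extend_apply _ _ i
  · exact Function.extend_apply' _ _ _ hk

theorem extend_eq_of_comp_eq {f : α → β} (hf : f.Injective) {s : α → γ} {x y : β → γ}
    (hs : ∀ i, y (f i) = s i) (hx : ∀ k, (∀ i, f i ≠ k) → y k = x k) :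
    Function.extend f s x = y := by
  funext k
  by_cases hk : ∃ i, f i = k
  · obtain ⟨i, rfl⟩ := hk
    rw [hf.extend_apply, hs]
  · rw [Function.extend_apply' _ _ _ hk, hx k (not_exists.mp hk)]

end Extend

section Embed

variable {m n N : ℕ}

theorem embed_mulVec (e : Fin n ↪ Fin N) (A : QOp n) (φ : QState N) (x : Bits N) :
    (embed e A *ᵥ φ) x = ∑ s, A (x ∘ e) s * φ (Function.extend e s x) := by
  classical
  simp only [Matrix.mulVec, dotProduct, embed, Matrix.of_apply, ite_mul, zero_mul]
  rw [← Finset.sum_filter]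
  symm
  refine Finset.sum_bij' (fun s _ => Function.extend e s x) (fun y _ => y ∘ e) ?_ ?_ ?_ ?_ ?_
  · intro s _
    refine Finset.mem_filter.2 ⟨Finset.mem_univ _, fun k hk => ?_⟩
    rw [Function.extend_apply' _ _ _ hk]
  · exact fun y _ => Finset.mem_univ _
  · exact fun s _ => Function.extend_comp e.injective _ _
  · intro y hy
    exact extend_eq_of_comp_eq e.injective (fun _ => rfl) fun k hk =>
      ((Finset.mem_filter.1 hy).2 k (not_exists.mpr hk)).symm
  · intro s _
    simp only [e.injective.extend_apply, Function.comp_def]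

theorem mulVec_ext {ι : Type*} [Fintype ι] {A B : Matrix ι ι ℂ}
    (h : ∀ v x, (A *ᵥ v) x = (B *ᵥ v) x) : A = B :=
  Matrix.mulVec_injective (funext fun v => funext (h v))

theorem embed_mul (e : Fin n ↪ Fin N) (A B : QOp n) :
    embed e (A * B) = embed e A * embed e B := by
  refine mulVec_ext fun φ x => ?_
  rw [← Matrix.mulVec_mulVec]
  simp only [embed_mulVec, Function.extend_comp e.injective, extend_extend e.injective,
    Matrix.mul_apply, Finset.sum_mul, Finset.mul_sum, mul_assoc]
  exact Finset.sum_comm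

theorem embed_one (e : Fin n ↪ Fin N) : embed e (1 : QOp n) = 1 := by
  refine mulVec_ext fun φ x => ?_
  simp only [embed_mulVec, Matrix.one_apply, ite_mul, one_mul, zero_mul, Finset.sum_ite_eq,
    Finset.mem_univ, if_true, extend_comp_self e.injective, Matrix.one_mulVec]

/-- `embed e` as a homomorphism of star algebras. -/
def embedHom (e : Fin n ↪ Fin N) : QOp n →⋆ₐ[ℂ] QOp N where
  __ := AlgHom.ofLinearMap
    { toFun := embed e
      map_add' := fun A B => by
        ext x y
        simp only [embed, Matrix.of_apply, Matrix.add_apply]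
        split_ifs <;> simp only [add_zero]
      map_smul' := fun c A => by
        ext x y
        simp only [embed, Matrix.of_apply, Matrix.smul_apply, RingHom.id_apply]
        split_ifs <;> simp only [smul_zero] }
    (embed_one e) (embed_mul e)
  map_star' A := by
    ext x y
    change embed e Aᴴ x y = star (embed e A y x)
    simp only [embed, Matrix.of_apply, Matrix.conjTranspose_apply, eq_comm (a := y _)]
    split_ifs <;> simp only [star_zero]

@[simp] theorem embedHom_apply (e : Fin n ↪ Fin N) (A : QOp n) : embedHom e A = embed e A := rfl

theorem embed_smul (e : Fin n ↪ Fin N) (c : ℂ) (A : QOp n) :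
    embed e (c • A) = c • embed e A := map_smul (embedHom e) c A

theorem embed_conjTranspose (e : Fin n ↪ Fin N) (A : QOp n) :
    embed e Aᴴ = (embed e A)ᴴ := map_star (embedHom e) A

theorem embed_mem_unitaryGroup (e : Fin n ↪ Fin N) {U : QOp n}
    (hU : U ∈ unitaryGroup (Bits n) ℂ) : embed e U ∈ unitaryGroup (Bits N) ℂ :=
  Unitary.map_mem (embedHom e) hU

theorem embed_trans (f : Fin m ↪ Fin n) (e : Fin n ↪ Fin N) (A : QOp m) :
    embed (f.trans e) A = embed e (embed f A) := by
  refine mulVec_ext fun φ x => ?_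
  have h : (embed e (embed f A) *ᵥ φ) x =
      (embed f A *ᵥ fun s => φ (Function.extend e s x)) (x ∘ e) := embed_mulVec e _ φ x
  simp only [h, embed_mulVec, Function.Embedding.coe_trans,
    f.injective.extend_comp e.injective, Function.comp_assoc]

theorem embed_tensor (e : Fin n ↪ Fin N) (A : Fin n → QubitOp) :
    embed e (tensor A) = tensor (Function.extend e A 1) := by
  classical
  ext x y
  have compl : ∏ k ∈ (Finset.univ.map e)ᶜ, (Function.extend e A 1 k : QubitOp) (x k) (y k) =
      ∏ k ∈ (Finset.univ.map e)ᶜ, if x k = y k then 1 else 0 := by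
    refine Finset.prod_congr rfl fun k hk => ?_
    rw [Function.extend_apply' _ _ _ (by simpa using hk), Pi.one_apply, Matrix.one_apply]
  simp only [embed, tensor_apply, Matrix.of_apply]
  rw [← Finset.prod_mul_prod_compl (Finset.univ.map e), Finset.prod_map, compl,
    Finset.prod_ite_zero, Finset.prod_const_one]
  simp [e.injective.extend_apply]

/-- A one-qubit operator, on a register that consists of that qubit. -/
def singleQubitHom : QubitOp →⋆ₐ[ℂ] QOp 1 where
  __ := AlgHom.ofLinearMap
    { toFun := fun u => tensor fun _ => u
      map_add' := fun u v => by ext x y; simp [tensor_apply]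
      map_smul' := fun c u => by ext x y; simp [tensor_apply] }
    tensor_one fun u v => (tensor_mul (fun _ => u) fun _ => v).symm
  map_star' u := (tensor_conjTranspose fun _ => u).symm

theorem singleQubitHom_apply (u : QubitOp) : singleQubitHom u = tensor fun _ => u := rfl

/-- The operator that acts as `u` on the qubit `k` of a register and trivially on the others. -/
def onQubit (k : Fin n) : QubitOp →⋆ₐ[ℂ] QOp n :=
  (embedHom ⟨fun _ : Fin 1 => k, fun _ _ _ => Subsingleton.elim _ _⟩).comp singleQubitHom

theorem onQubit_eq_tensor (k : Fin n) (u : QubitOp) :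
    onQubit k u = tensor (Pi.mulSingle k u) := by
  rw [onQubit, StarAlgHom.comp_apply, embedHom_apply, singleQubitHom_apply, embed_tensor]
  refine congrArg tensor (extend_eq_of_comp_eq ?_ ?_ ?_)
  · exact fun _ _ _ => Subsingleton.elim _ _
  · exact fun _ => Pi.mulSingle_eq_same (M := fun _ => QubitOp) k u
  · exact fun l hl => Pi.mulSingle_eq_of_ne (M := fun _ => QubitOp) (Ne.symm (hl 0)) u

end Embed

section NormSq

variable {n : ℕ}

theorem normSq_eq_dotProduct (ψ : QState n) : (normSq ψ : ℂ) = star ψ ⬝ᵥ ψ := by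
  simp only [normSq, dotProduct, Pi.star_apply, RCLike.star_def, Complex.conj_mul',
    Complex.ofReal_sum, Complex.ofReal_pow]

theorem normSq_mulVec {U : QOp n} (hU : U ∈ unitaryGroup (Bits n) ℂ) (ψ : QState n) :
    normSq (U *ᵥ ψ) = normSq ψ := by
  have h : (normSq (U *ᵥ ψ) : ℂ) = normSq ψ := by
    rw [normSq_eq_dotProduct, normSq_eq_dotProduct, Matrix.star_mulVec, Matrix.dotProduct_mulVec,
      Matrix.vecMul_vecMul, ← star_eq_conjTranspose, mem_unitaryGroup_iff'.1 hU, Matrix.vecMul_one]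
  exact_mod_cast h

theorem normSq_nonneg (ψ : QState n) : 0 ≤ normSq ψ :=
  Finset.sum_nonneg fun _ _ => by positivity

end NormSq

/-! ### Parities of single-qubit measurements -/

section Reflections

/-- The eigenvalue `±1` that belongs to an outcome of a two-valued measurement. Being a character,
it turns the parity of outcomes into the product of eigenvalues. -/
def outcomeSign : AddChar (Fin 2) ℂ where
  toFun := ![1, -1]
  map_zero_eq_one' := rfl
  map_add_eq_mul' a b := by fin_cases a <;> fin_cases b <;> simp

@[simp] theorem outcomeSign_zero : outcomeSign 0 = 1 := rfl
@[simp] theorem outcomeSign_one : outcomeSign 1 = -1 := rfl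

theorem star_outcomeSign (a : Fin 2) : star (outcomeSign a) = outcomeSign a := by
  fin_cases a <;> simp

theorem half_one_add_outcomeSign_mul (a b : Fin 2) :
    (1 / 2 : ℂ) * (1 + outcomeSign a * outcomeSign b) = if b = a then 1 else 0 := by
  fin_cases a <;> fin_cases b <;> norm_num

theorem outcomeSign_parity {n : ℕ} (j : Bits n) :
    outcomeSign (parity j) = ∏ k, outcomeSign (j k) :=
  map_prod outcomeSign.toMonoidHom (fun k => Multiplicative.ofAdd (j k)) Finset.univ

/-- The projections `(1 ± B)/2` onto the eigenspaces of an involution `B`. -/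
def eigenProj {ι : Type*} [DecidableEq ι] (B : Matrix ι ι ℂ) (i : Fin 2) : Matrix ι ι ℂ :=
  (1 / 2 : ℂ) • (1 + outcomeSign i • B)

theorem spectralMeas_eq_eigenProj (A : QubitOp) : spectralMeas A = eigenProj A := by
  funext i
  fin_cases i <;> simp [spectralMeas, eigenProj, sub_eq_add_neg]

theorem swapOutcomes_spectralMeas (A : QubitOp) :
    swapOutcomes (spectralMeas A) = spectralMeas (-A) := by
  funext i
  fin_cases i <;> simp [spectralMeas, swapOutcomes, sub_eq_add_neg]

theorem sum_eigenProj {ι : Type*} [DecidableEq ι] (B : Matrix ι ι ℂ) : ∑ i, eigenProj B i = 1 := by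
  simp only [eigenProj, Fin.sum_univ_two, outcomeSign_zero, outcomeSign_one]
  module

theorem sum_outcomeSign_smul_eigenProj {ι : Type*} [DecidableEq ι] (B : Matrix ι ι ℂ) :
    ∑ i, outcomeSign i • eigenProj B i = B := by
  simp only [eigenProj, Fin.sum_univ_two, outcomeSign_zero, outcomeSign_one]
  module

theorem combine_parity_spectralMeas {n : ℕ} (A : Fin n → QubitOp) :
    combine parity (fun k => spectralMeas (A k)) = eigenProj (tensor A) := by
  funext i
  have sum_one : ∑ j : Bits n, tensor (fun k => eigenProj (A k) (j k)) = 1 := by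
    simp only [sum_tensor fun k c => eigenProj (A k) c, sum_eigenProj, tensor_one]
  have sum_sign : ∑ j : Bits n, outcomeSign (parity j) • tensor (fun k => eigenProj (A k) (j k)) =
      tensor A := by
    simp only [outcomeSign_parity, ← tensor_smul,
      sum_tensor fun k c => outcomeSign c • eigenProj (A k) c, sum_outcomeSign_smul_eigenProj]
  simp only [combine, spectralMeas_eq_eigenProj]
  rw [eigenProj, ← sum_sign, ← sum_one, Finset.smul_sum, ← Finset.sum_add_distrib,
    Finset.smul_sum, Finset.sum_filter]
  refine Finset.sum_congr rfl fun j _ => ?_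
  have coefficient := congrArg (· • tensor fun k => eigenProj (A k) (j k))
    (half_one_add_outcomeSign_mul i (parity j))
  rw [ite_smul, one_smul, zero_smul] at coefficient
  rw [← coefficient]
  module

/-- The hermitian involutions `B` with as many eigenvalues `1` as `-1`, i.e. those for which
`eigenProj B` is a binary measurement. -/
structure IsBalancedReflection {ι : Type*} [Fintype ι] [DecidableEq ι] (B : Matrix ι ι ℂ) :
    Prop where
  isHermitian : B.IsHermitian
  mul_self : B * B = 1
  trace_eq_zero : B.trace = 0

theorem IsBalancedReflection.isBinary {ι : Type} [Fintype ι] [DecidableEq ι] {B : Matrix ι ι ℂ}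
    (h : IsBalancedReflection B) : IsBinary (eigenProj B) := by
  refine ⟨⟨fun i => ?_, fun i j => ?_, sum_eigenProj B⟩, fun i => ?_⟩
  · simp [eigenProj, Matrix.IsHermitian, star_outcomeSign, h.isHermitian.eq]
  · have expand : eigenProj B i * eigenProj B j = (1 / 4 : ℂ) •
        ((1 + outcomeSign i * outcomeSign j) • 1 + (outcomeSign i + outcomeSign j) • B) := by
      simp only [eigenProj, Matrix.smul_mul, Matrix.mul_smul, mul_add, add_mul, one_mul, mul_one,
        h.mul_self]
      module
    rw [expand]
    fin_cases i <;> fin_cases j <;> simp [eigenProj] <;> norm_num <;> module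
  · simp only [eigenProj, Matrix.trace_smul, Matrix.trace_add, Matrix.trace_one, h.trace_eq_zero,
      smul_eq_mul]
    ring

theorem IsBalancedReflection.tensor {n : ℕ} [NeZero n] {A : Fin n → QubitOp}
    (h : ∀ k, IsBalancedReflection (A k)) : IsBalancedReflection (tensor A) where
  isHermitian := by
    simp only [Matrix.IsHermitian, tensor_conjTranspose, (h _).isHermitian.eq]
  mul_self := by
    simp only [tensor_mul, (h _).mul_self, tensor_one]
  trace_eq_zero := by
    rw [trace_tensor]
    exact Finset.prod_eq_zero (Finset.mem_univ 0) (h 0).trace_eq_zero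

theorem IsBalancedReflection.neg {ι : Type*} [Fintype ι] [DecidableEq ι] {B : Matrix ι ι ℂ}
    (h : IsBalancedReflection B) : IsBalancedReflection (-B) :=
  ⟨h.isHermitian.neg, by rw [neg_mul_neg, h.mul_self],
    by rw [Matrix.trace_neg, h.trace_eq_zero, neg_zero]⟩

theorem isBalancedReflection_pauli {j : Fin 4} (hj : j ≠ 0) : IsBalancedReflection (pauli j) := by
  fin_cases j
  · exact absurd rfl hj
  all_goals
    constructor
    · ext a b
      fin_cases a <;> fin_cases b <;> simp [pauli]
    · ext a b
      fin_cases a <;> fin_cases b <;> simp [pauli]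
    · simp [pauli, Matrix.trace]

theorem inv_sqrt_two_mul_self : ((1 / √2 : ℝ) : ℂ) * ((1 / √2 : ℝ) : ℂ) = 1 / 2 := by
  rw [← Complex.ofReal_mul, div_mul_div_comm, Real.mul_self_sqrt zero_le_two]
  norm_num

/-- The reflection `(A + B)/√2` that exchanges two anticommuting reflections `A` and `B`. -/
def bisector {ι : Type*} (A B : Matrix ι ι ℂ) : Matrix ι ι ℂ := ((1 / √2 : ℝ) : ℂ) • (A + B)

theorem bisector_mul {ι : Type*} [Fintype ι] [DecidableEq ι] {A B : Matrix ι ι ℂ}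
    (hA : A * A = 1) (hB : B * B = 1) : bisector A B * A = B * bisector A B := by
  simp only [bisector, Matrix.smul_mul, Matrix.mul_smul, add_mul, mul_add, hA, hB, add_comm]

theorem bisector_comm {ι : Type*} (A B : Matrix ι ι ℂ) : bisector A B = bisector B A := by
  rw [bisector, add_comm, bisector]

theorem IsBalancedReflection.bisector {ι : Type*} [Fintype ι] [DecidableEq ι] {A B : Matrix ι ι ℂ}
    (hA : IsBalancedReflection A) (hB : IsBalancedReflection B) (h : A * B = -(B * A)) :
    IsBalancedReflection (bisector A B) where
  isHermitian := by
    rw [Matrix.IsHermitian, MeasQC.bisector, Matrix.conjTranspose_smul, Matrix.conjTranspose_add,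
      hA.isHermitian.eq, hB.isHermitian.eq, RCLike.star_def, Complex.conj_ofReal]
  mul_self := by
    rw [MeasQC.bisector, Matrix.smul_mul, Matrix.mul_smul, smul_smul, inv_sqrt_two_mul_self]
    simp only [add_mul, mul_add, hA.mul_self, hB.mul_self, h]
    module
  trace_eq_zero := by
    rw [MeasQC.bisector, Matrix.trace_smul, Matrix.trace_add, hA.trace_eq_zero, hB.trace_eq_zero,
      add_zero, smul_zero]

/-- The operator `(σ₁ + σ₂)/√2` that is measured by `measW`. -/
def diagonalPauli : QubitOp := bisector (pauli 1) (pauli 2)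

theorem pauli_anticommute {a b : Fin 4} (ha : a ≠ 0) (hb : b ≠ 0) (hab : a ≠ b) :
    pauli a * pauli b = -(pauli b * pauli a) := by
  ext r s
  fin_cases a <;> fin_cases b <;> fin_cases r <;> fin_cases s <;>
    simp [pauli, Matrix.mul_apply] at ha hb hab ⊢

theorem isBalancedReflection_diagonalPauli : IsBalancedReflection diagonalPauli :=
  (isBalancedReflection_pauli (by decide)).bisector (isBalancedReflection_pauli (by decide))
    (pauli_anticommute (by decide) (by decide) (by decide))

end Reflections

section UniversalSet

theorem xor2_spectralMeas (A B : QubitOp) :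
    (xor2 (spectralMeas A) (spectralMeas B)).2 = eigenProj (tensor ![A, B]) := by
  have pair : ![spectralMeas A, spectralMeas B] = fun k => spectralMeas (![A, B] k) := by
    funext k
    fin_cases k <;> rfl
  exact (congrArg (combine parity) pair).trans (combine_parity_spectralMeas _)

theorem xor3_spectralMeas (A B C : QubitOp) :
    (xor3 (spectralMeas A) (spectralMeas B) (spectralMeas C)).2 =
      eigenProj (tensor ![A, B, C]) := by
  have triple : ![spectralMeas A, spectralMeas B, spectralMeas C] =
      fun k => spectralMeas (![A, B, C] k) := by
    funext k
    fin_cases k <;> rfl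
  exact (congrArg (combine parity) triple).trans (combine_parity_spectralMeas _)

theorem isBalanced_parity {n : ℕ} [NeZero n] : IsBalanced (parity : Bits n → Fin 2) := by
  let flip : Bits n ≃ Bits n := Equiv.addRight (Pi.single 0 1)
  have parity_flip (j : Bits n) : parity (flip j) = parity j + 1 := by
    simp [parity, flip, Finset.sum_add_distrib]
  have card_eq : (Finset.univ.filter fun j : Bits n => parity j = 0).card =
      (Finset.univ.filter fun j : Bits n => parity j = 1).card :=
    Finset.card_equiv flip fun j => by simp [parity_flip]
  have card_add : (Finset.univ.filter fun j : Bits n => parity j = 0).card +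
      (Finset.univ.filter fun j : Bits n => parity j = 1).card = 2 ^ n := by
    have h := Finset.card_eq_sum_card_fiberwise (f := (parity : Bits n → Fin 2))
      (s := Finset.univ) (t := Finset.univ) fun _ _ => Finset.mem_coe.2 (Finset.mem_univ _)
    simpa using h.symm
  intro i
  fin_cases i <;> simp only [Fin.zero_eta, Fin.mk_one] <;> lia

theorem exists_spectralMeas_of_mem_singleQubitMeas {m : Fin 2 → QubitOp}
    (hm : m ∈ singleQubitMeas) : ∃ A, m = spectralMeas A ∧ IsBalancedReflection A := by
  have named : ∀ m' ∈ ({measX, measY, measZ, measW} : Set (Fin 2 → QubitOp)),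
      ∃ A, m' = spectralMeas A ∧ IsBalancedReflection A := by
    rintro m' (rfl | rfl | rfl | rfl)
    · exact ⟨_, rfl, isBalancedReflection_pauli (by decide)⟩
    · exact ⟨_, rfl, isBalancedReflection_pauli (by decide)⟩
    · exact ⟨_, rfl, isBalancedReflection_pauli (by decide)⟩
    · exact ⟨_, rfl, isBalancedReflection_diagonalPauli⟩
  rcases hm with hm | hm
  · exact named m hm
  · obtain ⟨A, hA, hr⟩ := named _ hm
    refine ⟨-A, ?_, hr.neg⟩
    rw [← swapOutcomes_spectralMeas, ← hA]
    funext i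
    fin_cases i <;> rfl

theorem isSeparateOver_combine_parity {n : ℕ} [NeZero n] {m : Fin n → Fin 2 → QubitOp}
    (hm : ∀ k, m k ∈ singleQubitMeas) :
    IsSeparateOver singleQubitMeas parity (combine parity m) := by
  choose A hA hr using fun k => exists_spectralMeas_of_mem_singleQubitMeas (hm k)
  refine ⟨isBalanced_parity, ?_, m, fun k => ⟨?_, hm k⟩, rfl⟩
  · obtain rfl : m = fun k => spectralMeas (A k) := funext hA
    rw [combine_parity_spectralMeas]
    exact (IsBalancedReflection.tensor hr).isBinary
  · rw [hA, spectralMeas_eq_eigenProj]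
    exact (hr k).isBinary

theorem swapOutcomes_mem_singleQubitMeas {m : Fin 2 → QubitOp}
    (hm : m ∈ ({measX, measY, measZ, measW} : Set (Fin 2 → QubitOp))) :
    swapOutcomes m ∈ singleQubitMeas := by
  have swap_swap : swapOutcomes (swapOutcomes m) = m := by
    funext i
    fin_cases i <;> rfl
  exact Or.inr (by rwa [swap_swap])

theorem isSeparateOver_of_mem_universalSet {M : QMeas} (hM : M ∈ universalSet) :
    IsSeparateOver singleQubitMeas parity M.2 := by
  have hX : measX ∈ singleQubitMeas := Or.inl (by simp)
  have hY : measY ∈ singleQubitMeas := Or.inl (by simp)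
  have hZ : measZ ∈ singleQubitMeas := Or.inl (by simp)
  have hW : measW ∈ singleQubitMeas := Or.inl (by simp)
  have hX' : swapOutcomes measX ∈ singleQubitMeas := swapOutcomes_mem_singleQubitMeas (by simp)
  have hY' : swapOutcomes measY ∈ singleQubitMeas := swapOutcomes_mem_singleQubitMeas (by simp)
  have hZ' : swapOutcomes measZ ∈ singleQubitMeas := swapOutcomes_mem_singleQubitMeas (by simp)
  rcases hM with rfl | rfl | rfl | rfl | rfl | rfl | rfl | rfl | rfl | rfl | rfl
  all_goals
    refine isSeparateOver_combine_parity fun k => ?_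
    fin_cases k <;> assumption

theorem finite_universalSet : universalSet.Finite := by
  unfold universalSet
  exact Set.toFinite _

theorem card_qubits_of_mem_universalSet {M : QMeas} (hM : M ∈ universalSet) :
    M.1 = 2 ∨ M.1 = 3 := by
  rcases hM with rfl | rfl | rfl | rfl | rfl | rfl | rfl | rfl | rfl | rfl | rfl <;> simp

theorem xor3_measX_ne_xor3_measZ : xor3 measX measX measX ≠ xor3 measZ measZ measZ := by
  intro h
  have proj_eq : (xor3 measX measX measX).2 = (xor3 measZ measZ measZ).2 :=
    eq_of_heq (Sigma.mk.inj h).2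
  have corner_X : tensor ![pauli 1, pauli 1, pauli 1] 0 0 = 0 := by
    simp [tensor_apply, Fin.prod_univ_three, pauli]
  have corner_Z : tensor ![pauli 3, pauli 3, pauli 3] 0 0 = 1 := by
    simp [tensor_apply, Fin.prod_univ_three, pauli]
  rw [measX, measZ, xor3_spectralMeas, xor3_spectralMeas] at proj_eq
  have corner_eq := congrFun (congrFun (congrFun proj_eq 0) 0) 0
  simp only [eigenProj, Matrix.smul_apply, Matrix.add_apply, corner_X, corner_Z] at corner_eq
  norm_num at corner_eq

theorem ncard_three_qubits_universalSet : {M ∈ universalSet | M.1 = 3}.ncard = 2 := by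
  have h : {M ∈ universalSet | M.1 = 3} =
      {xor3 measX measX measX, xor3 measZ measZ measZ} := by
    ext M
    constructor
    · rintro ⟨hM, h3⟩
      rcases hM with rfl | rfl | rfl | rfl | rfl | rfl | rfl | rfl | rfl | rfl | rfl
      all_goals first
        | exact absurd h3 (by decide)
        | simp
    · rintro (rfl | rfl) <;> simp [universalSet]
  rw [h, Set.ncard_pair xor3_measX_ne_xor3_measZ]

end UniversalSet

/-! ### The basis `|U_j⟩` -/

section ChoiState

variable {m n : ℕ}

/-- The Choi state `(I ⊗ M)|EPR⟩` of an operator `M`. -/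
def choiState (M : QOp n) : QState (n + n) := embed (Fin.natAddEmb n) M *ᵥ eprState n

theorem basisState_eq_choiState (U : QOp n) (j : Fin n → Fin 4) :
    basisState U j = choiState (U * pauliString j) := rfl

theorem extend_natAdd {γ : Type*} (s : Fin n → γ) (x : Fin (m + n) → γ) :
    Function.extend (Fin.natAddEmb m) s x = Fin.append (fun i => x (Fin.castAdd n i)) s := by
  refine extend_eq_of_comp_eq (Fin.natAddEmb m).injective (Fin.append_right _ s) fun k => ?_
  refine Fin.addCases (fun i _ => Fin.append_left _ s i) (fun i hi => ?_) k
  exact absurd rfl (hi i)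

theorem extend_castAdd {γ : Type*} (s : Fin m → γ) (x : Fin (m + n) → γ) :
    Function.extend (Fin.castAddEmb n) s x = Fin.append s (fun i => x (Fin.natAdd m i)) := by
  refine extend_eq_of_comp_eq (Fin.castAddEmb n).injective (Fin.append_left s _) fun k => ?_
  refine Fin.addCases (fun i hi => ?_) (fun i _ => Fin.append_right s _ i) k
  exact absurd rfl (hi i)

theorem choiState_apply (M : QOp n) (x : Bits (n + n)) :
    choiState M x = M (fun i => x (Fin.natAdd n i)) (fun i => x (Fin.castAdd n i)) *
      ((1 / √(2 ^ n) : ℝ) : ℂ) := by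
  rw [choiState, embed_mulVec, Finset.sum_eq_single fun i => x (Fin.castAdd n i)]
  · simp only [extend_natAdd, eprState, Fin.append_left, Fin.append_right, if_true]
    rfl
  · intro s _ hs
    simp only [extend_natAdd, eprState, Fin.append_left, Fin.append_right]
    rw [if_neg (Ne.symm hs), mul_zero]
  · exact fun h => absurd (Finset.mem_univ _) h

theorem choiState_smul (c : ℂ) (M : QOp n) : choiState (c • M) = c • choiState M := by
  rw [choiState, embed_smul, Matrix.smul_mulVec, choiState]

theorem embed_natAdd_mulVec_choiState (B M : QOp n) :
    embed (Fin.natAddEmb n) B *ᵥ choiState M = choiState (B * M) := by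
  rw [choiState, Matrix.mulVec_mulVec, ← embed_mul, choiState]

theorem embed_castAdd_mulVec_choiState (A M : QOp n) :
    embed (Fin.castAddEmb n) A *ᵥ choiState M = choiState (M * Aᵀ) := by
  funext x
  rw [embed_mulVec, choiState_apply, Matrix.mul_apply, Finset.sum_mul]
  refine Finset.sum_congr rfl fun s _ => ?_
  simp only [choiState_apply, extend_castAdd, Fin.append_left, Fin.append_right,
    Matrix.transpose_apply, Function.comp_def, Fin.castAddEmb_apply]
  ring

theorem sum_pauli_mul_star (a b c d : Fin 2) :
    ∑ v, pauli v a b * star (pauli v c d) = if a = c ∧ b = d then 2 else 0 := by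
  rw [Fin.sum_univ_four]
  fin_cases a <;> fin_cases b <;> fin_cases c <;> fin_cases d <;>
    simp [pauli] <;> norm_num

theorem sum_pauliString_mul_star (a b c d : Bits n) :
    ∑ j : Fin n → Fin 4, pauliString j a b * star (pauliString j c d) =
      if a = c ∧ b = d then 2 ^ n else 0 := by
  simp only [pauliString, tensor_apply, star_prod, ← Finset.prod_mul_distrib,
    ← Fintype.prod_sum fun k v => pauli v (a k) (b k) * star (pauli v (c k) (d k)),
    sum_pauli_mul_star, Fintype.prod_ite_zero, Finset.prod_const, Finset.card_univ,
    Fintype.card_fin, forall_and, funext_iff]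

theorem inv_sqrt_two_pow_mul_self (n : ℕ) :
    ((1 / √(2 ^ n) : ℝ) : ℂ) * ((1 / √(2 ^ n) : ℝ) : ℂ) = (2 ^ n)⁻¹ := by
  rw [← Complex.ofReal_mul, div_mul_div_comm, Real.mul_self_sqrt (by positivity)]
  push_cast
  rw [one_mul, one_div]

theorem eq_iff_natAdd_castAdd {γ : Type*} {x y : Fin (m + n) → γ} :
    x = y ↔ (fun i => x (Fin.natAdd m i)) = (fun i => y (Fin.natAdd m i)) ∧
      (fun i => x (Fin.castAdd n i)) = fun i => y (Fin.castAdd n i) := by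
  refine ⟨fun h => by simp only [h, and_self], fun ⟨h₁, h₂⟩ => funext fun k => ?_⟩
  exact Fin.addCases (congrFun h₂) (congrFun h₁) k

theorem sum_vecMulVec_choiState_pauliString :
    ∑ j : Fin n → Fin 4, vecMulVec (choiState (pauliString j)) (star (choiState (pauliString j))) =
      1 := by
  ext x y
  simp only [Matrix.sum_apply, Matrix.vecMulVec_apply, choiState_apply, Pi.star_apply, star_mul',
    mul_mul_mul_comm _ ((1 / √(2 ^ n) : ℝ) : ℂ)]
  rw [← Finset.sum_mul, sum_pauliString_mul_star, RCLike.star_def, Complex.conj_ofReal,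
    inv_sqrt_two_pow_mul_self, Matrix.one_apply]
  simp only [← eq_iff_natAdd_castAdd]
  split_ifs
  · exact mul_inv_cancel₀ (pow_ne_zero n two_ne_zero)
  · exact zero_mul _

theorem sum_vecMulVec_basisState {U : QOp n} (hU : U ∈ unitaryGroup (Bits n) ℂ) :
    ∑ j, vecMulVec (basisState U j) (star (basisState U j)) = 1 := by
  have conj_pauliString (j : Fin n → Fin 4) :
      vecMulVec (basisState U j) (star (basisState U j)) =
        embed (Fin.natAddEmb n) U *
          vecMulVec (choiState (pauliString j)) (star (choiState (pauliString j))) *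
          (embed (Fin.natAddEmb n) U)ᴴ := by
    rw [basisState_eq_choiState, ← embed_natAdd_mulVec_choiState, Matrix.star_mulVec,
      Matrix.mul_vecMulVec, Matrix.vecMulVec_mul]
  simp only [conj_pauliString]
  rw [← Finset.sum_mul, ← Finset.mul_sum, sum_vecMulVec_choiState_pauliString, mul_one,
    ← embed_conjTranspose, ← embed_mul, ← star_eq_conjTranspose, mem_unitaryGroup_iff.1 hU,
    embed_one]

end ChoiState

/-! ### Sequences of commuting measurements -/

section CommutingMeasurements

variable {n N : ℕ}

theorem prod_ofFn_mulVec {ι R : Type*} [Fintype ι] [DecidableEq ι] [CommSemiring R] {m : ℕ}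
    {A : Fin m → Matrix ι ι R} {c : Fin m → R} {v : ι → R} (h : ∀ k, A k *ᵥ v = c k • v) :
    (List.ofFn A).prod *ᵥ v = (∏ k, c k) • v := by
  induction m with
  | zero => simp
  | succ m ih =>
    rw [List.ofFn_succ, List.prod_cons, ← Matrix.mulVec_mulVec, ih fun k => h k.succ,
      Matrix.mulVec_smul, h, smul_smul, Fin.prod_univ_succ, mul_comm]

theorem basisMeasuredBy_of_eigenstates {𝒯 : Set (PlacedMeas (n + n))} {U : QOp n}
    (hU : U ∈ unitaryGroup (Bits n) ℂ) {L : Fin (n + n) → PlacedMeas (n + n)}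
    (hL : ∀ k, L k ∈ 𝒯) (outcomes : (Fin n → Fin 4) ≃ Bits (n + n))
    (h : ∀ k b j, (L k).proj b *ᵥ basisState U j =
      (if b = outcomes j k then 1 else 0 : ℂ) • basisState U j) :
    BasisMeasuredBy 𝒯 U := by
  refine ⟨L, hL, fun k l a b => ?_, outcomes.symm, fun b => ?_⟩
  · rw [Commute, SemiconjBy, ← mul_one (_ * _), ← mul_one ((L l).proj b * _),
      ← sum_vecMulVec_basisState hU, Finset.mul_sum, Finset.mul_sum]
    refine Finset.sum_congr rfl fun j _ => ?_
    simp only [Matrix.mul_vecMulVec, ← Matrix.mulVec_mulVec, h, Matrix.mulVec_smul, smul_smul,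
      mul_comm]
  · have prod_mulVec (j : Fin n → Fin 4) :
        (List.ofFn fun k => (L k).proj (b k)).prod *ᵥ basisState U j =
          (if j = outcomes.symm b then 1 else 0 : ℂ) • basisState U j := by
      rw [prod_ofFn_mulVec fun k => h k (b k) j, Fintype.prod_ite_zero, Finset.prod_const_one]
      simp only [← funext_iff, Equiv.eq_symm_apply, eq_comm]
    rw [← mul_one (List.prod _), ← sum_vecMulVec_basisState hU, Finset.mul_sum]
    simp only [Matrix.mul_vecMulVec, prod_mulVec, ite_smul, one_smul, zero_smul]
    rw [Finset.sum_eq_single (outcomes.symm b) (fun j _ hj => by simp [hj]) (by simp)]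
    simp

theorem eigenProj_mulVec {ι : Type*} [Fintype ι] [DecidableEq ι] {B : Matrix ι ι ℂ} {v : ι → ℂ}
    {s : Fin 2} (h : B *ᵥ v = outcomeSign s • v) (b : Fin 2) :
    eigenProj B b *ᵥ v = (if b = s then 1 else 0 : ℂ) • v := by
  rw [eigenProj, Matrix.smul_mulVec, Matrix.add_mulVec, Matrix.one_mulVec, Matrix.smul_mulVec, h,
    ← half_one_add_outcomeSign_mul]
  module

theorem embed_eigenProj (e : Fin n ↪ Fin N) (B : QOp n) (b : Fin 2) :
    embed e (eigenProj B b) = eigenProj (embed e B) b := by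
  simp only [eigenProj, ← embedHom_apply, map_smul, map_add, map_one]

theorem embed_onQubit (e : Fin n ↪ Fin N) (k : Fin n) (u : QubitOp) :
    embed e (onQubit k u) = onQubit (e k) u :=
  (embed_trans _ e _).symm

theorem tensor_pair (A B : QubitOp) : tensor ![A, B] = onQubit 0 A * onQubit 1 B := by
  rw [onQubit_eq_tensor, onQubit_eq_tensor, tensor_mul]
  congr 1
  funext k
  fin_cases k <;> simp

theorem tensor_triple (A B C : QubitOp) :
    tensor ![A, B, C] = onQubit 0 A * onQubit 1 B * onQubit 2 C := by
  rw [onQubit_eq_tensor, onQubit_eq_tensor, onQubit_eq_tensor, tensor_mul, tensor_mul]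
  congr 1
  funext k
  fin_cases k <;> simp

theorem proj_xor2 (A B : QubitOp) (e : Fin 2 ↪ Fin N) :
    PlacedMeas.proj ⟨xor2 (spectralMeas A) (spectralMeas B), e⟩ =
      eigenProj (onQubit (e 0) A * onQubit (e 1) B) := by
  funext b
  rw [PlacedMeas.proj, xor2_spectralMeas, embed_eigenProj, tensor_pair, embed_mul, embed_onQubit,
    embed_onQubit]

theorem proj_xor3 (A B C : QubitOp) (e : Fin 3 ↪ Fin N) :
    PlacedMeas.proj ⟨xor3 (spectralMeas A) (spectralMeas B) (spectralMeas C), e⟩ =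
      eigenProj (onQubit (e 0) A * onQubit (e 1) B * onQubit (e 2) C) := by
  funext b
  rw [PlacedMeas.proj, xor3_spectralMeas, embed_eigenProj, tensor_triple, embed_mul, embed_mul,
    embed_onQubit, embed_onQubit, embed_onQubit]

end CommutingMeasurements

section PauliGenerators

variable {n : ℕ}

/-- The generators `X_i` and `Z_i` of the group of Pauli strings: first all the `X_i`, then all the
`Z_i`. -/
def pauliGen : Fin (n + n) → QOp n :=
  Fin.append (fun i => onQubit i (pauli 1)) fun i => onQubit i (pauli 3)

/-- The parity with which `σ₁` commutes with a Pauli operator. -/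
def syndromeX : Fin 4 → Fin 2 := ![0, 0, 1, 1]

/-- The parity with which `σ₃` commutes with a Pauli operator. -/
def syndromeZ : Fin 4 → Fin 2 := ![0, 1, 1, 0]

/-- The parities with which the generators `pauliGen k` commute with a Pauli string. -/
def syndrome (j : Fin n → Fin 4) : Bits (n + n) :=
  Fin.append (fun i => syndromeX (j i)) fun i => syndromeZ (j i)

theorem syndrome_injective : Function.Injective (syndrome (n := n)) := by
  intro j l h
  funext i
  have hX : syndromeX (j i) = syndromeX (l i) := by
    simpa only [syndrome, Fin.append_left] using congrFun h (Fin.castAdd n i)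
  have hZ : syndromeZ (j i) = syndromeZ (l i) := by
    simpa only [syndrome, Fin.append_right] using congrFun h (Fin.natAdd n i)
  have determined : ∀ a b, syndromeX a = syndromeX b → syndromeZ a = syndromeZ b → a = b := by
    decide
  exact determined _ _ hX hZ

/-- The Pauli strings correspond to the strings of outcomes of `2n` two-valued measurements. -/
def syndromeEquiv : (Fin n → Fin 4) ≃ Bits (n + n) :=
  Equiv.ofBijective syndrome <| by
    rw [Fintype.bijective_iff_injective_and_card]
    refine ⟨syndrome_injective, ?_⟩
    simp only [Fintype.card_fun, Fintype.card_fin, pow_add, ← mul_pow, Nat.reduceMul]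

theorem pauli_zero : pauli 0 = 1 := rfl

theorem pauli_one_mul (a : Fin 4) :
    pauli 1 * pauli a = outcomeSign (syndromeX a) • (pauli a * pauli 1) := by
  ext r s
  fin_cases a <;> fin_cases r <;> fin_cases s <;> simp [pauli, syndromeX, Matrix.mul_apply]

theorem pauli_three_mul (a : Fin 4) :
    pauli 3 * pauli a = outcomeSign (syndromeZ a) • (pauli a * pauli 3) := by
  ext r s
  fin_cases a <;> fin_cases r <;> fin_cases s <;> simp [pauli, syndromeZ, Matrix.mul_apply]

theorem onQubit_mul_tensor {u v B : QubitOp} {A : Fin n → QubitOp} {i : Fin n} {c : ℂ}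
    (h : u * A i = c • (B * v)) :
    onQubit i u * tensor A = c • (tensor (Function.update A i B) * onQubit i v) := by
  have hc : c = ∏ k, if k = i then c else 1 := by simp
  rw [onQubit_eq_tensor, onQubit_eq_tensor, tensor_mul, tensor_mul, hc, ← tensor_smul]
  congr 1
  funext k
  by_cases hk : k = i
  · subst hk
    simp [h]
  · simp [hk]

theorem onQubit_mul_tensor_of_mul_eq {u v : QubitOp} {A : Fin n → QubitOp} {i : Fin n} {c : ℂ}
    (h : u * A i = c • (A i * v)) : onQubit i u * tensor A = c • (tensor A * onQubit i v) := by
  rw [onQubit_mul_tensor h, Function.update_eq_self]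

theorem pauliGen_mul_pauliString (k : Fin (n + n)) (j : Fin n → Fin 4) :
    pauliGen k * pauliString j =
      outcomeSign (syndrome j k) • (pauliString j * pauliGen k) := by
  refine Fin.addCases (fun i => ?_) (fun i => ?_) k
  · simp only [pauliGen, syndrome, Fin.append_left]
    exact onQubit_mul_tensor_of_mul_eq (pauli_one_mul _)
  · simp only [pauliGen, syndrome, Fin.append_right]
    exact onQubit_mul_tensor_of_mul_eq (pauli_three_mul _)

theorem pauli_mul_self (a : Fin 4) : pauli a * pauli a = 1 := by
  rcases eq_or_ne a 0 with rfl | ha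
  · exact one_mul 1
  · exact (isBalancedReflection_pauli ha).mul_self

theorem pauli_conjTranspose (a : Fin 4) : (pauli a)ᴴ = pauli a := by
  rcases eq_or_ne a 0 with rfl | ha
  · exact Matrix.conjTranspose_one
  · exact (isBalancedReflection_pauli ha).isHermitian

theorem pauliGen_mul_self (k : Fin (n + n)) : (pauliGen k : QOp n) * pauliGen k = 1 := by
  refine Fin.addCases (fun i => ?_) (fun i => ?_) k
  · rw [pauliGen, Fin.append_left, ← map_mul, pauli_mul_self, map_one]
  · rw [pauliGen, Fin.append_right, ← map_mul, pauli_mul_self, map_one]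

theorem pauliString_mul_self (j : Fin n → Fin 4) : pauliString j * pauliString j = 1 := by
  simp only [pauliString, tensor_mul, pauli_mul_self, tensor_one]

theorem pauliString_conjTranspose (j : Fin n → Fin 4) : (pauliString j)ᴴ = pauliString j := by
  simp only [pauliString, tensor_conjTranspose, pauli_conjTranspose]

theorem onQubit_transpose (k : Fin n) (u : QubitOp) : (onQubit k u)ᵀ = onQubit k uᵀ := by
  rw [onQubit_eq_tensor, onQubit_eq_tensor, tensor_transpose]
  congr 1
  funext l
  exact Pi.apply_mulSingle (fun _ v => vᵀ) (fun _ => Matrix.transpose_one) k u l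

theorem pauliGen_transpose (k : Fin (n + n)) : (pauliGen k : QOp n)ᵀ = pauliGen k := by
  have pauli_transpose : ∀ a : Fin 4, a ≠ 2 → (pauli a)ᵀ = pauli a := by
    intro a ha
    ext r s
    fin_cases a <;> fin_cases r <;> fin_cases s <;> simp [pauli] at ha ⊢
  refine Fin.addCases (fun i => ?_) (fun i => ?_) k
  · rw [pauliGen, Fin.append_left, onQubit_transpose, pauli_transpose 1 (by decide)]
  · rw [pauliGen, Fin.append_right, onQubit_transpose, pauli_transpose 3 (by decide)]

/-- `|U_j⟩` is an eigenvector of `σ ⊗ UσU†` for every generator `σ`, and the eigenvalues determine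
`j`. -/
theorem basisMeasuredBy_of_generators {𝒯 : Set (PlacedMeas (n + n))} {U : QOp n}
    (hU : U ∈ unitaryGroup (Bits n) ℂ) {L : Fin (n + n) → PlacedMeas (n + n)}
    (hL : ∀ k, L k ∈ 𝒯) {B : Fin (n + n) → QOp n} (hB : ∀ k, B k * U = U * pauliGen k)
    (hproj : ∀ k, (L k).proj = eigenProj
      (embed (Fin.castAddEmb n) (pauliGen k) * embed (Fin.natAddEmb n) (B k))) :
    BasisMeasuredBy 𝒯 U := by
  refine basisMeasuredBy_of_eigenstates hU hL syndromeEquiv fun k b j => ?_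
  have intertwine : B k * (U * pauliString j) * pauliGen k =
      outcomeSign (syndrome j k) • (U * pauliString j) := by
    rw [← mul_assoc, hB, mul_assoc U, pauliGen_mul_pauliString, Matrix.mul_smul, Matrix.smul_mul,
      ← mul_assoc, mul_assoc _ (pauliGen k), pauliGen_mul_self, mul_one]
  rw [hproj]
  refine eigenProj_mulVec ?_ b
  rw [← Matrix.mulVec_mulVec, basisState_eq_choiState, embed_natAdd_mulVec_choiState,
    embed_castAdd_mulVec_choiState, pauliGen_transpose, intertwine, choiState_smul]
  rfl

end PauliGenerators

/-! ### The Pauli group and the Clifford hierarchy -/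

section PauliGroup

variable {n : ℕ}

theorem exists_pauli_mul_pauli (a b : Fin 4) :
    ∃ c : ℂ, ‖c‖ = 1 ∧ pauli a * pauli b = c • pauli (a ^^^ b) := by
  refine ⟨![![1, 1, 1, 1], ![1, 1, Complex.I, -Complex.I], ![1, -Complex.I, 1, Complex.I],
    ![1, Complex.I, -Complex.I, 1]] a b, ?_, ?_⟩
  · fin_cases a <;> fin_cases b <;> simp
  · ext r s
    fin_cases a <;> fin_cases b <;> fin_cases r <;> fin_cases s <;>
      simp [pauli, Matrix.mul_apply]

theorem exists_pauliString_mul_pauliString (j l : Fin n → Fin 4) :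
    ∃ c : ℂ, ‖c‖ = 1 ∧
      pauliString j * pauliString l = c • pauliString fun k => j k ^^^ l k := by
  choose c hc h using fun k => exists_pauli_mul_pauli (j k) (l k)
  refine ⟨∏ k, c k, by rw [norm_prod, Finset.prod_eq_one fun k _ => hc k], ?_⟩
  simp only [pauliString, tensor_mul, h, tensor_smul]

theorem pauliString_zero : pauliString (0 : Fin n → Fin 4) = 1 := tensor_one

/-- The Pauli strings, with arbitrary phases. -/
def pauliGroup (n : ℕ) : Submonoid (QOp n) where
  carrier := {P | ∃ (j : Fin n → Fin 4) (c : ℂ), ‖c‖ = 1 ∧ P = c • pauliString j}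
  one_mem' := ⟨0, 1, norm_one, by rw [pauliString_zero, one_smul]⟩
  mul_mem' := by
    rintro _ _ ⟨j, c, hc, rfl⟩ ⟨l, d, hd, rfl⟩
    obtain ⟨z, hz, h⟩ := exists_pauliString_mul_pauliString j l
    refine ⟨fun k => j k ^^^ l k, c * d * z,
      by rw [norm_mul, norm_mul, hc, hd, hz, mul_one, mul_one], ?_⟩
    rw [Matrix.smul_mul, Matrix.mul_smul, h, smul_smul, smul_smul, mul_assoc]

theorem pauliString_mem_pauliGroup (j : Fin n → Fin 4) : pauliString j ∈ pauliGroup n :=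
  ⟨j, 1, norm_one, (one_smul ℂ _).symm⟩

theorem smul_mem_pauliGroup {c : ℂ} (hc : ‖c‖ = 1) {P : QOp n} (hP : P ∈ pauliGroup n) :
    c • P ∈ pauliGroup n := by
  obtain ⟨j, d, hd, rfl⟩ := hP
  exact ⟨j, c * d, by rw [norm_mul, hc, hd, mul_one], smul_smul c d _⟩

theorem neg_mem_pauliGroup {P : QOp n} (hP : P ∈ pauliGroup n) : -P ∈ pauliGroup n := by
  rw [← neg_one_smul ℂ]
  exact smul_mem_pauliGroup (by rw [norm_neg, norm_one]) hP

theorem conjTranspose_mem_pauliGroup {P : QOp n} (hP : P ∈ pauliGroup n) :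
    Pᴴ ∈ pauliGroup n := by
  obtain ⟨j, c, hc, rfl⟩ := hP
  rw [Matrix.conjTranspose_smul, pauliString_conjTranspose]
  exact ⟨j, _, by rw [norm_star, hc], rfl⟩

theorem pauliGroup_le_unitaryGroup : pauliGroup n ≤ unitaryGroup (Bits n) ℂ := by
  rintro _ ⟨j, c, hc, rfl⟩
  have hcc : star c * c = 1 := by
    rw [RCLike.star_def, Complex.conj_mul', hc, Complex.ofReal_one, one_pow]
  rw [mem_unitaryGroup_iff', star_smul, star_eq_conjTranspose, pauliString_conjTranspose,
    Matrix.smul_mul, Matrix.mul_smul, pauliString_mul_self, smul_smul, hcc, one_smul]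

theorem onQubit_pauli (k : Fin n) (a : Fin 4) :
    onQubit k (pauli a) = pauliString (Pi.single k a) := by
  rw [onQubit_eq_tensor, pauliString]
  congr 1
  funext l
  rcases eq_or_ne l k with rfl | hl
  · rw [Pi.mulSingle_eq_same, Pi.single_eq_same]
  · rw [Pi.mulSingle_eq_of_ne hl, Pi.single_eq_of_ne hl, pauli_zero]

theorem onQubit_pauli_mem_pauliGroup (k : Fin n) (a : Fin 4) :
    onQubit k (pauli a) ∈ pauliGroup n :=
  onQubit_pauli k a ▸ pauliString_mem_pauliGroup _

theorem tensor_mem {S : Submonoid (QOp n)} {A : Fin n → QubitOp}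
    (h : ∀ k, onQubit k (A k) ∈ S) : tensor A ∈ S := by
  let tensorHom : (Fin n → QubitOp) →* QOp n :=
    { toFun := tensor, map_one' := tensor_one, map_mul' := fun A B => (tensor_mul A B).symm }
  refine Submonoid.pi_mem_of_mulSingle_mem (H := S.comap tensorHom) A fun k => ?_
  change tensor (Pi.mulSingle k (A k)) ∈ S
  rw [← onQubit_eq_tensor]
  exact h k

theorem pauli_two_eq : pauli 2 = Complex.I • (pauli 1 * pauli 3) := by
  ext r s
  fin_cases r <;> fin_cases s <;> simp [pauli]

theorem pauliGroup_le {S : Submonoid (QOp n)} (hphase : ∀ c : ℂ, ‖c‖ = 1 → c • 1 ∈ S)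
    (hgen : ∀ k, pauliGen k ∈ S) : pauliGroup n ≤ S := by
  have smul_mem {c : ℂ} (hc : ‖c‖ = 1) {P : QOp n} (hP : P ∈ S) : c • P ∈ S := by
    simpa only [smul_one_mul] using S.mul_mem (hphase c hc) hP
  rintro _ ⟨j, c, hc, rfl⟩
  refine smul_mem hc (tensor_mem fun k => ?_)
  have hX : onQubit k (pauli 1) ∈ S := by
    simpa only [pauliGen, Fin.append_left] using hgen (Fin.castAdd n k)
  have hZ : onQubit k (pauli 3) ∈ S := by
    simpa only [pauliGen, Fin.append_right] using hgen (Fin.natAdd n k)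
  generalize j k = a
  fin_cases a
  · exact (map_one (onQubit k)).symm ▸ S.one_mem
  · exact hX
  · change onQubit k (pauli 2) ∈ S
    rw [pauli_two_eq, map_smul, map_mul]
    exact smul_mem Complex.norm_I (S.mul_mem hX hZ)
  · exact hZ

theorem conj_eq_of_mul_eq {U P Q : QOp n} (hU : U ∈ unitaryGroup (Bits n) ℂ)
    (h : U * P = Q * U) : U * P * Uᴴ = Q := by
  rw [h, mul_assoc, ← star_eq_conjTranspose, mem_unitaryGroup_iff.1 hU, mul_one]

/-- The set of level `k` of the Clifford hierarchy, i.e. the unitary operators that conjugate Pauli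
operators to operators of level `k - 1`. The levels are counted from `0`, so that level `1` is the
Clifford group. -/
def cliffordHierarchy (n : ℕ) : ℕ → Set (QOp n)
  | 0 => pauliGroup n
  | k + 1 => {U | U ∈ unitaryGroup (Bits n) ℂ ∧
      ∀ P ∈ pauliGroup n, U * P * Uᴴ ∈ cliffordHierarchy n k}

theorem cliffordHierarchy_subset_unitaryGroup (k : ℕ) :
    cliffordHierarchy n k ⊆ unitaryGroup (Bits n) ℂ := by
  cases k with
  | zero => exact pauliGroup_le_unitaryGroup
  | succ k => exact fun _ h => h.1

theorem mul_mem_cliffordHierarchy {k : ℕ} {U P : QOp n} (hU : U ∈ cliffordHierarchy n k)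
    (hP : P ∈ pauliGroup n) : U * P ∈ cliffordHierarchy n k := by
  cases k with
  | zero => exact (pauliGroup n).mul_mem hU hP
  | succ k =>
    refine ⟨Submonoid.mul_mem _ hU.1 (pauliGroup_le_unitaryGroup hP), fun Q hQ => ?_⟩
    have regroup : U * P * Q * (U * P)ᴴ = U * (P * Q * Pᴴ) * Uᴴ := by
      simp only [Matrix.conjTranspose_mul, mul_assoc]
    rw [regroup]
    exact hU.2 _ (Submonoid.mul_mem _ (Submonoid.mul_mem _ hP hQ) (conjTranspose_mem_pauliGroup hP))

theorem pauliGroup_subset_cliffordHierarchy (k : ℕ) :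
    (pauliGroup n : Set (QOp n)) ⊆ cliffordHierarchy n k := by
  induction k with
  | zero => exact subset_rfl
  | succ k ih => exact fun P hP => ⟨pauliGroup_le_unitaryGroup hP, fun Q hQ =>
      ih (Submonoid.mul_mem _ (Submonoid.mul_mem _ hP hQ) (conjTranspose_mem_pauliGroup hP))⟩

theorem mem_cliffordHierarchy_one {U : QOp n} (hU : U ∈ unitaryGroup (Bits n) ℂ)
    {B : Fin (n + n) → QOp n} (hB : ∀ k, B k ∈ pauliGroup n)
    (h : ∀ k, B k * U = U * pauliGen k) : U ∈ cliffordHierarchy n 1 := by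
  let conj : QOp n ≃⋆ₐ[ℂ] QOp n := Unitary.conjStarAlgAut ℂ (QOp n) ⟨U, hU⟩
  have conj_apply (P : QOp n) : conj P = U * P * Uᴴ := Unitary.conjStarAlgAut_apply ..
  have conj_mem : pauliGroup n ≤ (pauliGroup n).comap conj := by
    refine pauliGroup_le (fun c hc => ?_) fun k => ?_
    · rw [Submonoid.mem_comap, map_smul, map_one]
      exact smul_mem_pauliGroup hc (Submonoid.one_mem _)
    · rw [Submonoid.mem_comap, conj_apply, conj_eq_of_mul_eq hU (h k).symm]
      exact hB k
  exact ⟨hU, fun P hP => conj_apply P ▸ conj_mem hP⟩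

theorem trialGate_mem_pauliGroup {k : ℕ} {U : QOp n} (hU : U ∈ cliffordHierarchy n k)
    {errors : List (Fin n → Fin 4)} (hk : k ≤ errors.length) :
    trialGate U errors ∈ pauliGroup n := by
  induction errors generalizing U k with
  | nil =>
    obtain rfl : k = 0 := by simpa using hk
    exact hU
  | cons e errors ih =>
    have hUe : U * pauliString e * Uᴴ ∈ cliffordHierarchy n (k - 1) := by
      cases k with
      | zero => exact (pauliGroup n).mul_mem ((pauliGroup n).mul_mem hU
          (pauliString_mem_pauliGroup e)) (conjTranspose_mem_pauliGroup hU)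
      | succ k => exact hU.2 _ (pauliString_mem_pauliGroup e)
    exact ih hUe (by simpa using hk)

theorem trialGate_mem_unitaryGroup {U : QOp n} (hU : U ∈ unitaryGroup (Bits n) ℂ)
    (errors : List (Fin n → Fin 4)) : trialGate U errors ∈ unitaryGroup (Bits n) ℂ := by
  induction errors generalizing U with
  | nil => exact hU
  | cons e _ ih =>
    exact ih (Submonoid.mul_mem _ (Submonoid.mul_mem _ hU
      (pauliGroup_le_unitaryGroup (pauliString_mem_pauliGroup e))) (Unitary.star_mem hU))

theorem BasisMeasuredBy.mono {𝒯 𝒯' : Set (PlacedMeas (n + n))} {U : QOp n}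
    (h : BasisMeasuredBy 𝒯 U) (hs : 𝒯 ⊆ 𝒯') : BasisMeasuredBy 𝒯' U := by
  obtain ⟨L, hL, hcomm⟩ := h
  exact ⟨L, fun k => hs (hL k), hcomm⟩

theorem vecMulVec_smul_star {ι : Type*} {c : ℂ} (hc : ‖c‖ = 1) (v : ι → ℂ) :
    vecMulVec (c • v) (star (c • v)) = vecMulVec v (star v) := by
  have hcc : c * star c = 1 := by
    rw [RCLike.star_def, Complex.mul_conj', hc, Complex.ofReal_one, one_pow]
  rw [star_smul, Matrix.smul_vecMulVec, Matrix.vecMulVec_smul, smul_smul, hcc, one_smul]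

/-- Multiplication by a Pauli operator permutes the basis `|U_j⟩`, up to phases. -/
theorem BasisMeasuredBy.mul_pauli {𝒯 : Set (PlacedMeas (n + n))} {U P : QOp n}
    (h : BasisMeasuredBy 𝒯 U) (hP : P ∈ pauliGroup n) : BasisMeasuredBy 𝒯 (U * P) := by
  obtain ⟨L, hL, hcomm, r, hr⟩ := h
  obtain ⟨l, c, hc, rfl⟩ := hP
  have involutive : Function.Involutive fun j k => l k ^^^ (j : Fin n → Fin 4) k := by
    have xor_xor : ∀ a b : Fin 4, a ^^^ (a ^^^ b) = b := by decide
    exact fun j => funext fun k => xor_xor _ _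
  have basis_eq (j : Fin n → Fin 4) :
      vecMulVec (basisState (U * c • pauliString l) j)
        (star (basisState (U * c • pauliString l) j)) =
      vecMulVec (basisState U fun k => l k ^^^ j k) (star (basisState U fun k => l k ^^^ j k)) := by
    obtain ⟨z, hz, h⟩ := exists_pauliString_mul_pauliString l j
    have state_eq : basisState (U * c • pauliString l) j =
        (c * z) • basisState U fun k => l k ^^^ j k := by
      simp only [basisState_eq_choiState, mul_assoc, Matrix.smul_mul, Matrix.mul_smul, h,
        choiState_smul, smul_smul]
    rw [state_eq, vecMulVec_smul_star (by rw [norm_mul, hc, hz, mul_one])]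
  refine ⟨L, hL, hcomm, r.trans involutive.toPerm, fun b => ?_⟩
  rw [hr, basis_eq, Equiv.trans_apply, Function.Involutive.coe_toPerm]
  exact congrArg (fun j => vecMulVec (basisState U j) (star (basisState U j)))
    (involutive (r b)).symm

end PauliGroup

/-! ### The gates -/

section SingleQubitGates

variable {n : ℕ}

theorem tensor_mem_unitaryGroup {u : Fin n → QubitOp} (hu : ∀ i, u i ∈ unitaryGroup (Fin 2) ℂ) :
    tensor u ∈ unitaryGroup (Bits n) ℂ := by
  simp only [mem_unitaryGroup_iff, star_eq_conjTranspose, tensor_conjTranspose, tensor_mul] at hu ⊢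
  simp only [hu, tensor_one]

theorem IsBalancedReflection.mem_unitaryGroup {ι : Type*} [Fintype ι] [DecidableEq ι]
    {B : Matrix ι ι ℂ} (h : IsBalancedReflection B) : B ∈ unitaryGroup ι ℂ := by
  rw [mem_unitaryGroup_iff, star_eq_conjTranspose, h.isHermitian.eq, h.mul_self]

theorem onQubit_eq_tensor_const (u : QubitOp) : onQubit (0 : Fin 1) u = tensor fun _ => u := by
  rw [onQubit_eq_tensor]
  congr 1
  funext k
  rw [Subsingleton.elim k 0, Pi.mulSingle_eq_same]

theorem append_onQubit_mul_tensor {u A B : Fin n → QubitOp}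
    (hA : ∀ i, A i * u i = u i * pauli 1) (hB : ∀ i, B i * u i = u i * pauli 3) (k : Fin (n + n)) :
    Fin.append (fun i => onQubit i (A i)) (fun i => onQubit i (B i)) k * tensor u =
      tensor u * pauliGen k := by
  refine Fin.addCases (fun i => ?_) (fun i => ?_) k
  all_goals simp only [pauliGen, Fin.append_left, Fin.append_right]
  · rw [onQubit_mul_tensor_of_mul_eq (c := 1) (by rw [hA, one_smul]), one_smul]
  · rw [onQubit_mul_tensor_of_mul_eq (c := 1) (by rw [hB, one_smul]), one_smul]

theorem tensor_mem_cliffordHierarchy_one {u A B : Fin n → QubitOp}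
    (hu : ∀ i, u i ∈ unitaryGroup (Fin 2) ℂ)
    (hA : ∀ i, A i * u i = u i * pauli 1) (hB : ∀ i, B i * u i = u i * pauli 3)
    (hA_mem : ∀ i, onQubit i (A i) ∈ pauliGroup n)
    (hB_mem : ∀ i, onQubit i (B i) ∈ pauliGroup n) : tensor u ∈ cliffordHierarchy n 1 := by
  refine mem_cliffordHierarchy_one (tensor_mem_unitaryGroup hu) (fun k => ?_)
    (append_onQubit_mul_tensor hA hB)
  refine Fin.addCases (fun i => ?_) (fun i => ?_) k
  · rw [Fin.append_left]
    exact hA_mem i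
  · rw [Fin.append_right]
    exact hB_mem i

theorem basisMeasuredBy_tensor {𝒯 : Set (PlacedMeas (n + n))} {u A B : Fin n → QubitOp}
    (hu : ∀ i, u i ∈ unitaryGroup (Fin 2) ℂ)
    (hA : ∀ i, A i * u i = u i * pauli 1) (hB : ∀ i, B i * u i = u i * pauli 3)
    (hA_mem : ∀ i, ⟨xor2 measX (spectralMeas (A i)), pairPlacement n i⟩ ∈ 𝒯)
    (hB_mem : ∀ i, ⟨xor2 measZ (spectralMeas (B i)), pairPlacement n i⟩ ∈ 𝒯) :
    BasisMeasuredBy 𝒯 (tensor u) := by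
  refine basisMeasuredBy_of_generators (tensor_mem_unitaryGroup hu)
    (L := Fin.append (fun i => ⟨xor2 measX (spectralMeas (A i)), pairPlacement n i⟩)
      fun i => ⟨xor2 measZ (spectralMeas (B i)), pairPlacement n i⟩)
    (B := Fin.append (fun i => onQubit i (A i)) fun i => onQubit i (B i)) ?_
    (append_onQubit_mul_tensor hA hB) ?_
  all_goals
    intro k
    refine Fin.addCases (fun i => ?_) (fun i => ?_) k
    all_goals simp only [pauliGen, Fin.append_left, Fin.append_right]
  · exact hA_mem i
  · exact hB_mem i
  all_goals
    rw [embed_onQubit, embed_onQubit]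
    exact proj_xor2 _ _ _

theorem basisMeasuredBy_bellMeas {P : QOp n} (hP : P ∈ pauliGroup n) :
    BasisMeasuredBy (bellMeas n) P := by
  have h : BasisMeasuredBy (bellMeas n) (tensor fun _ => 1) :=
    basisMeasuredBy_tensor (A := fun _ => pauli 1) (B := fun _ => pauli 3)
      (fun _ => Submonoid.one_mem _) (fun _ => by rw [mul_one, one_mul])
      (fun _ => by rw [mul_one, one_mul]) (fun i => ⟨i, Or.inl rfl⟩) fun i => ⟨i, Or.inr rfl⟩
  rw [← one_mul P]
  exact (tensor_one (n := n) ▸ h).mul_pauli hP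

/-- The matrix of the Hadamard gate exchanges `σ₁` and `σ₃`. -/
def hadamard : QubitOp := bisector (pauli 1) (pauli 3)

theorem isBalancedReflection_hadamard : IsBalancedReflection hadamard :=
  (isBalancedReflection_pauli (by decide)).bisector (isBalancedReflection_pauli (by decide))
    (pauli_anticommute (by decide) (by decide) (by decide))

theorem hadamard_mem_unitaryGroup : hadamard ∈ unitaryGroup (Fin 2) ℂ :=
  isBalancedReflection_hadamard.mem_unitaryGroup

theorem pauli_three_mul_hadamard : pauli 3 * hadamard = hadamard * pauli 1 :=
  (bisector_mul (pauli_mul_self 1) (pauli_mul_self 3)).symm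

theorem pauli_one_mul_hadamard : pauli 1 * hadamard = hadamard * pauli 3 := by
  rw [hadamard, bisector_comm]
  exact (bisector_mul (pauli_mul_self 3) (pauli_mul_self 1)).symm

theorem hadamard_eq : hadamard = ((1 / √2 : ℝ) : ℂ) • !![1, 1; 1, -1] := by
  rw [hadamard, bisector]
  congr 1
  ext a b
  fin_cases a <;> fin_cases b <;> simp [pauli]

theorem op_H : Gate.H.op = onQubit (0 : Fin 1) hadamard := by
  rw [hadamard_eq, onQubit_eq_tensor_const]
  rfl

/-- The matrix of the `π/8` gate. -/
def piEighth : QubitOp :=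
  !![Complex.exp (-(Complex.I * Real.pi / 8)), 0; 0, Complex.exp (Complex.I * Real.pi / 8)]

theorem op_T : Gate.T.op = onQubit (0 : Fin 1) piEighth :=
  (onQubit_eq_tensor_const piEighth).symm

theorem diagonalPauli_eq :
    diagonalPauli = !![0, Complex.exp (-(Complex.I * Real.pi / 4));
      Complex.exp (Complex.I * Real.pi / 4), 0] := by
  have hcos : Real.cos (Real.pi / 4) = 1 / √2 := by
    rw [Real.cos_pi_div_four, Real.sqrt_div_self']
  have hsin : Real.sin (Real.pi / 4) = 1 / √2 := by
    rw [Real.sin_pi_div_four, Real.sqrt_div_self']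
  have angle : Complex.I * Real.pi / 4 = ((Real.pi / 4 : ℝ) : ℂ) * Complex.I := by
    push_cast
    ring
  rw [angle, ← neg_mul, Complex.exp_mul_I, Complex.exp_mul_I, Complex.cos_neg, Complex.sin_neg,
    ← Complex.ofReal_cos, ← Complex.ofReal_sin, hcos, hsin]
  ext a b
  fin_cases a <;> fin_cases b <;> simp [diagonalPauli, bisector, pauli] <;> ring

theorem piEighth_mem_unitaryGroup : piEighth ∈ unitaryGroup (Fin 2) ℂ := by
  have conj_angle : star (Complex.exp (Complex.I * Real.pi / 8)) =
      Complex.exp (-(Complex.I * Real.pi / 8)) := by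
    simp [← Complex.exp_conj, neg_div, map_ofNat]
  have piEighth_star :
      star piEighth =
        !![Complex.exp (Complex.I * Real.pi / 8), 0; 0,
          Complex.exp (-(Complex.I * Real.pi / 8))] := by
    rw [piEighth, ← conj_angle]
    ext a b
    fin_cases a <;> fin_cases b <;> simp
  rw [mem_unitaryGroup_iff, piEighth_star]
  ext a b
  fin_cases a <;> fin_cases b <;> simp [piEighth, ← Complex.exp_add]

theorem diagonalPauli_mul_piEighth : diagonalPauli * piEighth = piEighth * pauli 1 := by
  rw [diagonalPauli_eq]
  ext a b
  fin_cases a <;> fin_cases b <;> simp [pauli, piEighth, ← Complex.exp_add] <;> ring_nf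

theorem pauli_three_mul_piEighth : pauli 3 * piEighth = piEighth * pauli 3 := by
  ext a b
  fin_cases a <;> fin_cases b <;> simp [pauli, piEighth]

theorem diagonalPauli_mul_pauli_one : diagonalPauli * pauli 1 = pauli 2 * diagonalPauli :=
  bisector_mul (pauli_mul_self 1) (pauli_mul_self 2)

theorem pauli_three_mul_diagonalPauli : pauli 3 * diagonalPauli = -(diagonalPauli * pauli 3) := by
  rw [diagonalPauli, bisector, Matrix.mul_smul, mul_add,
    pauli_anticommute (a := 3) (b := 1) (by decide) (by decide) (by decide),
    pauli_anticommute (a := 3) (b := 2) (by decide) (by decide) (by decide), Matrix.smul_mul,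
    add_mul, ← neg_add, smul_neg]

/-- The conjugation by the `π/8` gate sends `σ₁` to the operator that is measured by `measW`, and it
fixes `σ₃`. -/
theorem exists_piEighth_mul_pauli (a : Fin 4) :
    ∃ R ∈ ({1, diagonalPauli} : Set QubitOp), ∃ (c : ℂ) (b : Fin 4), ‖c‖ = 1 ∧
      piEighth * pauli a = R * c • pauli b * piEighth := by
  fin_cases a
  · exact ⟨1, by simp, 1, 0, norm_one, by simp [pauli_zero]⟩
  · exact ⟨diagonalPauli, by simp, 1, 0, norm_one, by
      simp [pauli_zero, diagonalPauli_mul_piEighth]⟩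
  · refine ⟨diagonalPauli, by simp, Complex.I, 3, Complex.norm_I, ?_⟩
    change piEighth * pauli 2 = _
    rw [pauli_two_eq, Matrix.mul_smul, ← mul_assoc, ← diagonalPauli_mul_piEighth, mul_assoc,
      ← pauli_three_mul_piEighth, Matrix.mul_smul, Matrix.smul_mul, mul_assoc]
  · exact ⟨1, by simp, 1, 3, norm_one, by simp [pauli_three_mul_piEighth]⟩

theorem pauliString_eq_onQubit (j : Fin 1 → Fin 4) :
    pauliString j = onQubit 0 (pauli (j 0)) := by
  rw [onQubit_eq_tensor_const, pauliString]
  congr 1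
  funext k
  rw [Subsingleton.elim k 0]

theorem onQubit_piEighth_mem_unitaryGroup :
    onQubit (0 : Fin 1) piEighth ∈ unitaryGroup (Bits 1) ℂ := by
  rw [onQubit_eq_tensor_const]
  exact tensor_mem_unitaryGroup fun _ => piEighth_mem_unitaryGroup

theorem exists_conj_piEighth {P : QOp 1} (hP : P ∈ pauliGroup 1) :
    ∃ R ∈ ({1, diagonalPauli} : Set QubitOp), ∃ Q ∈ pauliGroup 1,
      onQubit 0 piEighth * P * (onQubit 0 piEighth)ᴴ = onQubit 0 R * Q := by
  obtain ⟨j, c, hc, rfl⟩ := hP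
  obtain ⟨R, hR, d, b, hd, h⟩ := exists_piEighth_mul_pauli (j 0)
  refine ⟨R, hR, (c * d) • onQubit 0 (pauli b), smul_mem_pauliGroup (by
    rw [norm_mul, hc, hd, mul_one]) (onQubit_pauli_mem_pauliGroup 0 b),
    conj_eq_of_mul_eq onQubit_piEighth_mem_unitaryGroup ?_⟩
  rw [pauliString_eq_onQubit, Matrix.mul_smul, ← map_mul, h, map_mul, map_mul, map_smul,
    Matrix.mul_smul, Matrix.mul_smul, Matrix.smul_mul, Matrix.smul_mul, smul_smul]

theorem onQubit_diagonalPauli_mem_cliffordHierarchy :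
    onQubit (0 : Fin 1) diagonalPauli ∈ cliffordHierarchy 1 1 := by
  rw [onQubit_eq_tensor_const]
  refine tensor_mem_cliffordHierarchy_one (A := fun _ => pauli 2) (B := fun _ => -pauli 3)
    (fun _ => isBalancedReflection_diagonalPauli.mem_unitaryGroup)
    (fun _ => diagonalPauli_mul_pauli_one.symm) (fun _ => ?_)
    (fun i => onQubit_pauli_mem_pauliGroup i 2) fun i => ?_
  · rw [neg_mul, pauli_three_mul_diagonalPauli, neg_neg]
  · rw [map_neg]
    exact neg_mem_pauliGroup (onQubit_pauli_mem_pauliGroup i 3)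

theorem onQubit_hadamard_mem_cliffordHierarchy :
    onQubit (0 : Fin 1) hadamard ∈ cliffordHierarchy 1 1 := by
  rw [onQubit_eq_tensor_const]
  exact tensor_mem_cliffordHierarchy_one (fun _ => hadamard_mem_unitaryGroup)
    (fun _ => pauli_three_mul_hadamard) (fun _ => pauli_one_mul_hadamard)
    (fun i => onQubit_pauli_mem_pauliGroup i 3) fun i => onQubit_pauli_mem_pauliGroup i 1

theorem onQubit_piEighth_mem_cliffordHierarchy :
    onQubit (0 : Fin 1) piEighth ∈ cliffordHierarchy 1 2 := by
  refine ⟨onQubit_piEighth_mem_unitaryGroup, fun P hP => ?_⟩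
  obtain ⟨R, hR, Q, hQ, h⟩ := exists_conj_piEighth hP
  rw [h]
  refine mul_mem_cliffordHierarchy ?_ hQ
  rcases hR with rfl | rfl
  · rw [map_one]
    exact pauliGroup_subset_cliffordHierarchy 1 (Submonoid.one_mem _)
  · exact onQubit_diagonalPauli_mem_cliffordHierarchy

theorem basisMeasuredBy_hadamard :
    BasisMeasuredBy {p | p.1 ∈ universalSet} (onQubit (0 : Fin 1) hadamard) := by
  rw [onQubit_eq_tensor_const]
  exact basisMeasuredBy_tensor (fun _ => hadamard_mem_unitaryGroup)
    (fun _ => pauli_three_mul_hadamard) (fun _ => pauli_one_mul_hadamard)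
    (fun _ => by simp [universalSet, measX, measZ]) fun _ => by simp [universalSet, measX, measZ]

theorem basisMeasuredBy_piEighth :
    BasisMeasuredBy {p | p.1 ∈ universalSet} (onQubit (0 : Fin 1) piEighth) := by
  rw [onQubit_eq_tensor_const]
  exact basisMeasuredBy_tensor (fun _ => piEighth_mem_unitaryGroup)
    (fun _ => diagonalPauli_mul_piEighth) (fun _ => pauli_three_mul_piEighth)
    (fun _ => show xor2 measX measW ∈ universalSet by simp [universalSet])
    fun _ => by simp [universalSet, measX, measZ]

theorem basisMeasuredBy_diagonalPauli :
    BasisMeasuredBy {p | p.1 ∈ universalSet} (onQubit (0 : Fin 1) diagonalPauli) := by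
  have pauli_two_mul : pauli 2 * (diagonalPauli * pauli 1) = diagonalPauli * pauli 1 * pauli 1 := by
    rw [← mul_assoc, ← diagonalPauli_mul_pauli_one]
  have pauli_three_mul : pauli 3 * (diagonalPauli * pauli 1) =
      diagonalPauli * pauli 1 * pauli 3 := by
    rw [← mul_assoc, pauli_three_mul_diagonalPauli, neg_mul, mul_assoc, mul_assoc,
      pauli_anticommute (a := 3) (b := 1) (by decide) (by decide) (by decide), mul_neg, neg_neg]
  have h : BasisMeasuredBy {p | p.1 ∈ universalSet}
      (onQubit (0 : Fin 1) (diagonalPauli * pauli 1)) := by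
    rw [onQubit_eq_tensor_const]
    exact basisMeasuredBy_tensor
      (fun _ => mul_mem isBalancedReflection_diagonalPauli.mem_unitaryGroup
        (isBalancedReflection_pauli (by decide)).mem_unitaryGroup)
      (fun _ => pauli_two_mul) (fun _ => pauli_three_mul)
      (fun _ => by simp [universalSet, measY]) fun _ => by simp [universalSet, measZ]
  have h' := h.mul_pauli (onQubit_pauli_mem_pauliGroup 0 1)
  rwa [← map_mul, mul_assoc, pauli_mul_self, mul_one] at h'

end SingleQubitGates

section ControlledReflection

variable {ι : Type*} [Fintype ι] [DecidableEq ι] {z x p : Matrix ι ι ℂ}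

/-- For commuting reflections `z` and `x`, the operator that acts as the identity on the `+1`
eigenspace of `z` and as `x` on the `-1` eigenspace. It is symmetric in `z` and `x`. -/
def controlledReflection (z x : Matrix ι ι ℂ) : Matrix ι ι ℂ :=
  (1 / 2 : ℂ) • (1 + z + x - z * x)

theorem controlledReflection_comm (hzx : Commute z x) :
    controlledReflection z x = controlledReflection x z := by
  rw [controlledReflection, controlledReflection, hzx.eq, add_right_comm]

theorem controlledReflection_conjTranspose (hz : z.IsHermitian) (hx : x.IsHermitian)
    (hzx : Commute z x) : (controlledReflection z x)ᴴ = controlledReflection z x := by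
  simp only [controlledReflection, conjTranspose_smul, conjTranspose_sub, conjTranspose_add,
    conjTranspose_one, conjTranspose_mul, hz.eq, hx.eq, hzx.eq]
  simp

theorem controlledReflection_mul_self (hz : z * z = 1) (hx : x * x = 1) (hzx : Commute z x) :
    controlledReflection z x * controlledReflection z x = 1 := by
  have hzz : z * (z * x) = x := by rw [← mul_assoc, hz, one_mul]
  have hxx : z * x * x = z := by rw [mul_assoc, hx, mul_one]
  have hzxz : z * x * z = x := by rw [mul_assoc, ← hzx.eq, hzz]
  have hxzx : x * (z * x) = z := by rw [← mul_assoc, ← hzx.eq, hxx]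
  have hzxzx : z * x * (z * x) = 1 := by rw [← mul_assoc, hzxz, hx]
  have four : (1 + z + x - z * x) * (1 + z + x - z * x) = (4 : ℂ) • 1 := by
    simp only [mul_add, mul_sub, add_mul, sub_mul, mul_one, one_mul, hz, hx, hzz, hxx, hzxz, hxzx,
      hzxzx, ← hzx.eq]
    module
  rw [controlledReflection, Matrix.smul_mul, Matrix.mul_smul, smul_smul, four, smul_smul]
  norm_num

theorem controlledReflection_mul_of_anticommute_control (hx : x * x = 1) (hzx : Commute z x)
    (hpz : z * p = -(p * z)) (hpx : Commute x p) :
    controlledReflection z x * p = p * x * controlledReflection z x := by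
  have hzxp : z * x * p = -(p * z * x) := by
    rw [mul_assoc, hpx.eq, ← mul_assoc, hpz, neg_mul]
  have hxx (a : Matrix ι ι ℂ) : a * x * x = a := by rw [mul_assoc, hx, mul_one]
  have hxz (a : Matrix ι ι ℂ) : a * x * z = a * z * x := by
    rw [mul_assoc, ← hzx.eq, mul_assoc]
  rw [controlledReflection, Matrix.smul_mul, Matrix.mul_smul]
  simp only [mul_add, mul_sub, add_mul, sub_mul, mul_one, one_mul, ← mul_assoc, hxx, hxz, hpz,
    hpx.eq, hzxp]
  congr 1
  abel

theorem controlledReflection_mul_of_anticommute_target (hz : z * z = 1) (hzx : Commute z x)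
    (hpx : x * p = -(p * x)) (hpz : Commute z p) :
    controlledReflection z x * p = p * z * controlledReflection z x := by
  rw [controlledReflection_comm hzx]
  exact controlledReflection_mul_of_anticommute_control hz hzx.symm hpx hpz

theorem controlledReflection_commute (hpz : Commute z p) (hpx : Commute x p) :
    Commute (controlledReflection z x) p :=
  (((((Commute.one_left p).add_left hpz).add_left hpx).sub_left (hpz.mul_left hpx))).smul_left _

end ControlledReflection

section ControlledNot

variable {n : ℕ}

theorem onQubit_commute {i j : Fin n} (hij : i ≠ j) (u v : QubitOp) :
    Commute (onQubit i u) (onQubit j v) := by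
  rw [onQubit_eq_tensor, onQubit_eq_tensor, Commute, SemiconjBy, tensor_mul, tensor_mul]
  exact congrArg tensor (funext fun k => congrFun
    (Pi.mulSingle_commute (f := fun _ => QubitOp) hij u v).eq k)

theorem onQubit_anticommute (i : Fin n) {u v : QubitOp} (h : u * v = -(v * u)) :
    onQubit i u * onQubit i v = -(onQubit i v * onQubit i u) := by
  rw [← map_mul, h, map_neg, map_mul]

theorem onQubit_isHermitian (i : Fin n) {u : QubitOp} (h : u.IsHermitian) :
    (onQubit i u).IsHermitian := by
  rw [Matrix.IsHermitian, ← star_eq_conjTranspose, ← map_star, star_eq_conjTranspose, h.eq]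

/-- The controlled NOT with control `i` and target `j`. -/
def controlledNot (i j : Fin n) : QOp n :=
  controlledReflection (onQubit i (pauli 3)) (onQubit j (pauli 1))

theorem op_CNOT : Gate.CNOT.op = controlledNot (0 : Fin 2) 1 := by
  have bits (z : Bits 2) : ∃ a b, z = ![a, b] := ⟨z 0, z 1, by
    funext k
    fin_cases k <;> rfl⟩
  have h : controlledNot (0 : Fin 2) 1 = (1 / 2 : ℂ) •
      (tensor ![1, 1] + tensor ![pauli 3, 1] + tensor ![1, pauli 1]
        - tensor ![pauli 3, pauli 1]) := by
    simp only [tensor_pair, map_one, one_mul, mul_one]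
    rfl
  rw [h]
  ext x y
  obtain ⟨a, b, rfl⟩ := bits x
  obtain ⟨c, d, rfl⟩ := bits y
  change (if ![a, b] 0 = ![c, d] 0 ∧ ![a, b] 1 = ![c, d] 0 + ![c, d] 1 then (1 : ℂ) else 0) = _
  simp only [Matrix.smul_apply, Matrix.sub_apply, Matrix.add_apply, tensor_apply,
    Fin.prod_univ_two]
  fin_cases a <;> fin_cases b <;> fin_cases c <;> fin_cases d <;> simp [pauli] <;>
    norm_num

variable {i j : Fin n}

theorem controlledNot_conjTranspose (hij : i ≠ j) : (controlledNot i j)ᴴ = controlledNot i j :=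
  controlledReflection_conjTranspose (onQubit_isHermitian i (pauli_conjTranspose 3))
    (onQubit_isHermitian j (pauli_conjTranspose 1)) (onQubit_commute hij _ _)

theorem onQubit_pauli_mul_self (i : Fin n) (a : Fin 4) :
    onQubit i (pauli a) * onQubit i (pauli a) = 1 := by
  rw [← map_mul, pauli_mul_self, map_one]

theorem controlledNot_mul_self (hij : i ≠ j) : controlledNot i j * controlledNot i j = 1 :=
  controlledReflection_mul_self (onQubit_pauli_mul_self i 3) (onQubit_pauli_mul_self j 1)
    (onQubit_commute hij _ _)

theorem controlledNot_mem_unitaryGroup (hij : i ≠ j) :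
    controlledNot i j ∈ unitaryGroup (Bits n) ℂ := by
  rw [mem_unitaryGroup_iff, star_eq_conjTranspose, controlledNot_conjTranspose hij,
    controlledNot_mul_self hij]

/-- The conjugates of the generators `X_i`, `Z_i` of the Pauli group by the controlled NOT. -/
def controlledNotGen : Fin (2 + 2) → QOp 2 :=
  Fin.append ![onQubit 0 (pauli 1) * onQubit 1 (pauli 1), onQubit 1 (pauli 1)]
    ![onQubit 0 (pauli 3), onQubit 0 (pauli 3) * onQubit 1 (pauli 3)]

theorem controlledNotGen_mul (k : Fin (2 + 2)) :
    controlledNotGen k * controlledNot 0 1 = controlledNot 0 1 * pauliGen k := by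
  have hX : onQubit (0 : Fin 2) (pauli 3) * onQubit 0 (pauli 1) =
      -(onQubit 0 (pauli 1) * onQubit 0 (pauli 3)) :=
    onQubit_anticommute 0 (pauli_anticommute (by decide) (by decide) (by decide))
  have hZ : onQubit (1 : Fin 2) (pauli 1) * onQubit 1 (pauli 3) =
      -(onQubit 1 (pauli 3) * onQubit 1 (pauli 1)) :=
    onQubit_anticommute 1 (pauli_anticommute (by decide) (by decide) (by decide))
  have h01 (u v : QubitOp) : Commute (onQubit (0 : Fin 2) u) (onQubit 1 v) :=
    onQubit_commute (by decide) u v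
  refine Fin.addCases (fun i => ?_) (fun i => ?_) k <;>
    simp only [pauliGen, controlledNotGen, Fin.append_left, Fin.append_right] <;> fin_cases i
  · exact (controlledReflection_mul_of_anticommute_control (onQubit_pauli_mul_self 1 1) (h01 _ _)
      hX (h01 _ _).symm).symm
  · exact (controlledReflection_commute (h01 _ _) (Commute.refl _)).symm.eq
  · exact (controlledReflection_commute (Commute.refl _) (h01 _ _).symm).symm.eq
  · exact (congrArg (· * controlledNot 0 1) (h01 _ _).eq).trans
      (controlledReflection_mul_of_anticommute_target (onQubit_pauli_mul_self 0 3) (h01 _ _) hZ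
        (h01 _ _)).symm

theorem controlledNot_mem_cliffordHierarchy :
    controlledNot (0 : Fin 2) 1 ∈ cliffordHierarchy 2 1 := by
  refine mem_cliffordHierarchy_one (controlledNot_mem_unitaryGroup (by decide)) (fun k => ?_)
    controlledNotGen_mul
  have h (i : Fin 2) (a : Fin 4) := onQubit_pauli_mem_pauliGroup i a
  refine Fin.addCases (fun i => ?_) (fun i => ?_) k <;>
    simp only [controlledNotGen, Fin.append_left, Fin.append_right] <;> fin_cases i
  · exact mul_mem (h 0 1) (h 1 1)
  · exact h 1 1
  · exact h 0 3
  · exact mul_mem (h 0 3) (h 1 3)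

theorem basisMeasuredBy_controlledNot :
    BasisMeasuredBy {p | p.1 ∈ universalSet} (controlledNot (0 : Fin 2) 1) := by
  refine basisMeasuredBy_of_generators (controlledNot_mem_unitaryGroup (by decide))
    (L := Fin.append
      ![⟨xor3 measX measX measX, ⟨![0, 2, 3], by decide⟩⟩, ⟨xor2 measX measX, pairPlacement 2 1⟩]
      ![⟨xor2 measZ measZ, pairPlacement 2 0⟩, ⟨xor3 measZ measZ measZ, ⟨![1, 2, 3], by decide⟩⟩])
    (fun k => ?_) controlledNotGen_mul fun k => ?_
  · refine Fin.addCases (fun i => ?_) (fun i => ?_) k <;>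
      simp only [Fin.append_left, Fin.append_right] <;> fin_cases i <;> simp [universalSet]
  · have hmul (u : QubitOp) (l : Fin (2 + 2)) :
        onQubit l u * onQubit (Fin.natAdd 2 0) u * onQubit (Fin.natAdd 2 1) u =
          onQubit l u * embed (Fin.natAddEmb 2) (onQubit 0 u * onQubit 1 u) := by
      rw [embed_mul, embed_onQubit, embed_onQubit, mul_assoc]
      rfl
    have hsingle (u : QubitOp) (i : Fin 2) :
        onQubit (Fin.castAdd 2 i) u * onQubit (Fin.natAdd 2 i) u =
          onQubit (Fin.castAdd 2 i) u * embed (Fin.natAddEmb 2) (onQubit i u) := by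
      rw [embed_onQubit]
      rfl
    refine Fin.addCases (fun i => ?_) (fun i => ?_) k <;>
      simp only [pauliGen, controlledNotGen, Fin.append_left, Fin.append_right, embed_onQubit] <;>
      fin_cases i
    · exact (proj_xor3 _ _ _ _).trans (congrArg eigenProj (hmul _ _))
    · exact (proj_xor2 _ _ _).trans (congrArg eigenProj (hsingle _ 1))
    · exact (proj_xor2 _ _ _).trans (congrArg eigenProj (hsingle _ 0))
    · exact (proj_xor3 _ _ _ _).trans (congrArg eigenProj (hmul _ _))

end ControlledNot

theorem op_mem_cliffordHierarchy :
    (g : Gate) → g.op ∈ cliffordHierarchy g.arity g.nonBellTrials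
  | .H => op_H ▸ onQubit_hadamard_mem_cliffordHierarchy
  | .T => op_T ▸ onQubit_piEighth_mem_cliffordHierarchy
  | .CNOT => op_CNOT ▸ controlledNot_mem_cliffordHierarchy

theorem op_mem_unitaryGroup (g : Gate) : g.op ∈ unitaryGroup (Bits g.arity) ℂ :=
  cliffordHierarchy_subset_unitaryGroup _ (op_mem_cliffordHierarchy g)

theorem bellMeas_subset (n : ℕ) : bellMeas n ⊆ {p | p.1 ∈ universalSet} := by
  rintro _ ⟨i, rfl | rfl⟩ <;> simp [universalSet]

theorem basisMeasuredBy_op : (g : Gate) → BasisMeasuredBy {p | p.1 ∈ universalSet} g.op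
  | .H => op_H ▸ basisMeasuredBy_hadamard
  | .T => op_T ▸ basisMeasuredBy_piEighth
  | .CNOT => op_CNOT ▸ basisMeasuredBy_controlledNot

theorem basisMeasuredBy_conj_piEighth {P : QOp 1} (hP : P ∈ pauliGroup 1) :
    BasisMeasuredBy {p | p.1 ∈ universalSet}
      (onQubit 0 piEighth * P * (onQubit 0 piEighth)ᴴ) := by
  obtain ⟨R, hR, Q, hQ, h⟩ := exists_conj_piEighth hP
  rw [h]
  rcases hR with rfl | rfl
  · rw [map_one, one_mul]
    exact (basisMeasuredBy_bellMeas hQ).mono (bellMeas_subset 1)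
  · exact basisMeasuredBy_diagonalPauli.mul_pauli hQ

theorem basisMeasuredBy_trialGate (g : Gate) (errors : List (Fin g.arity → Fin 4)) :
    BasisMeasuredBy {p | p.1 ∈ universalSet} (trialGate g.op errors) := by
  by_cases h : g.nonBellTrials ≤ errors.length
  · exact (basisMeasuredBy_bellMeas
      (trialGate_mem_pauliGroup (op_mem_cliffordHierarchy g) h)).mono (bellMeas_subset _)
  match g, errors, h with
  | g, [], _ => exact basisMeasuredBy_op g
  | .T, [e], _ => exact op_T ▸ basisMeasuredBy_conj_piEighth (pauliString_mem_pauliGroup e)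
  | .H, _ :: _, h => simp [Gate.nonBellTrials] at h
  | .T, _ :: _ :: _, h => simp [Gate.nonBellTrials] at h
  | .CNOT, _ :: _, h => simp [Gate.nonBellTrials] at h

/-! ### States of composite registers -/

section CompositeStates

variable {m N : ℕ}

theorem castAdd_ne_natAdd (i : Fin N) (l : Fin m) : Fin.castAdd m i ≠ Fin.natAdd N l :=
  Fin.ne_of_val_ne (by simp; omega)

/-- The state `φ ⊗ β` of a register of `N` qubits followed by a register of `m` qubits. -/
def tensorState (φ : QState N) (β : QState m) : QState (N + m) := fun x =>
  φ (x ∘ Fin.castAdd m) * β (x ∘ Fin.natAdd N)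

theorem tensorState_smul (c : ℂ) (φ : QState N) (β : QState m) :
    tensorState φ (c • β) = c • tensorState φ β :=
  funext fun _ => mul_left_comm _ _ _

theorem embed_natAdd_mulVec_tensorState (B : QOp m) (φ : QState N) (β : QState m) :
    embed (Fin.natAddEmb N) B *ᵥ tensorState φ β = tensorState φ (B *ᵥ β) := by
  funext x
  rw [embed_mulVec, tensorState, Matrix.mulVec, dotProduct, Finset.mul_sum]
  refine Finset.sum_congr rfl fun s _ => ?_
  simp only [extend_natAdd, tensorState, Function.comp_def, Fin.append_left, Fin.append_right,
    Fin.natAddEmb_apply]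
  ring

theorem normSq_tensorState (φ : QState N) (β : QState m) :
    normSq (tensorState φ β) = normSq φ * normSq β := by
  rw [normSq, ← (Fin.appendEquiv N m).sum_comp, Fintype.sum_prod_type, normSq, normSq,
    Finset.sum_mul_sum]
  simp [tensorState, Function.comp_def, Fin.appendEquiv, mul_pow]

theorem normSq_smul (c : ℂ) (φ : QState N) : normSq (c • φ) = ‖c‖ ^ 2 * normSq φ := by
  simp only [normSq, Pi.smul_apply, norm_smul, mul_pow, Finset.mul_sum]

/-- The state after qubit `k` has been renamed to qubit `σ k`, for every `k`. -/
def permuteQubits (σ : Equiv.Perm (Fin N)) (φ : QState N) : QState N := fun x => φ (x ∘ σ)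

theorem normSq_permuteQubits (σ : Equiv.Perm (Fin N)) (φ : QState N) :
    normSq (permuteQubits σ φ) = normSq φ :=
  (σ.symm.arrowCongr (Equiv.refl (Fin 2))).sum_comp fun x => ‖φ x‖ ^ 2

theorem adjoinZero_tensorState (φ : QState N) :
    adjoinZero (tensorState φ (Pi.single (0 : Bits m) 1)) =
      tensorState φ (Pi.single (0 : Bits (m + 1)) 1) := by
  funext x
  have h : x ∘ Fin.natAdd N = (0 : Bits (m + 1)) ↔
      x (Fin.last (N + m)) = 0 ∧ (fun i => x (Fin.castSucc i)) ∘ Fin.natAdd N = (0 : Bits m) := by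
    simp only [funext_iff, Fin.forall_fin_succ']
    exact and_comm
  simp only [adjoinZero, tensorState, Pi.single_apply, h, ite_and, mul_ite, mul_zero]
  rfl

theorem tensorState_zero_qubits (φ : QState N) :
    tensorState φ (Pi.single (0 : Bits 0) 1) = φ := by
  funext x
  rw [tensorState, Subsingleton.elim (x ∘ Fin.natAdd N) 0, Pi.single_eq_same, mul_one]
  rfl

end CompositeStates

section ProductStates

variable {m n N : ℕ} {out : Fin n ↪ Fin N} {θ : QState n} {φ : QState N}

/-- The qubits `out` are in the state `θ`, in a product with the other qubits. The state of the
other qubits is encoded as a function on all bit strings that ignores the bits at `out`. -/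
def IsProductState (out : Fin n ↪ Fin N) (θ : QState n) (φ : QState N) : Prop :=
  ∃ χ : QState N, (∀ x y, (∀ k ∉ Set.range out, x k = y k) → χ x = χ y) ∧
    ∀ x, φ x = θ (x ∘ out) * χ x

theorem isProductState_refl (ψ : QState n) :
    IsProductState (Function.Embedding.refl _) ψ ψ :=
  ⟨1, fun _ _ _ => rfl, fun _ => (mul_one _).symm⟩

theorem IsProductState.smul (h : IsProductState out θ φ) (z : ℂ) :
    IsProductState out θ (z • φ) := by
  obtain ⟨χ, hχ, hφ⟩ := h
  refine ⟨z • χ, fun x y hxy => congrArg (z * ·) (hχ x y hxy), fun x => ?_⟩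
  rw [Pi.smul_apply, hφ, Pi.smul_apply, smul_eq_mul, smul_eq_mul, mul_left_comm]

theorem IsProductState.of_smul {z : ℂ} (h : IsProductState out (z • θ) φ) :
    IsProductState out θ φ := by
  obtain ⟨χ, hχ, hφ⟩ := h
  refine ⟨z • χ, fun x y hxy => congrArg (z * ·) (hχ x y hxy), fun x => ?_⟩
  rw [hφ, Pi.smul_apply, Pi.smul_apply, smul_eq_mul, smul_eq_mul, mul_left_comm, mul_assoc]

theorem IsProductState.embed (h : IsProductState out θ φ) (B : QOp n) :
    IsProductState out (B *ᵥ θ) (embed out B *ᵥ φ) := by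
  obtain ⟨χ, hχ, hφ⟩ := h
  refine ⟨χ, hχ, fun x => ?_⟩
  rw [embed_mulVec, Matrix.mulVec, dotProduct, Finset.sum_mul]
  refine Finset.sum_congr rfl fun s _ => ?_
  rw [hφ, Function.extend_comp out.injective, mul_assoc,
    hχ (Function.extend out s x) x fun k hk => Function.extend_apply' _ _ _ hk]

theorem IsProductState.tensorState (h : IsProductState out θ φ) (β : QState m) :
    IsProductState (out.trans (Fin.castAddEmb m)) θ (tensorState φ β) := by
  obtain ⟨χ, hχ, hφ⟩ := h
  refine ⟨MeasQC.tensorState χ β, fun x y hxy => congrArg₂ (· * ·) ?_ ?_, fun x => ?_⟩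
  · refine hχ _ _ fun k hk => hxy _ ?_
    rintro ⟨i, hi⟩
    exact hk ⟨i, Fin.castAdd_injective _ _ hi⟩
  · refine congrArg β (funext fun i => hxy _ ?_)
    rintro ⟨l, hl⟩
    exact absurd hl (castAdd_ne_natAdd _ _)
  · rw [MeasQC.tensorState, hφ, MeasQC.tensorState, mul_assoc]
    rfl

theorem IsProductState.permuteQubits (h : IsProductState out θ φ) (σ : Equiv.Perm (Fin N)) :
    IsProductState (out.trans σ.toEmbedding) θ (permuteQubits σ φ) := by
  obtain ⟨χ, hχ, hφ⟩ := h
  refine ⟨MeasQC.permuteQubits σ χ, fun x y hxy => hχ _ _ fun k hk => hxy _ ?_, fun x => hφ _⟩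
  rintro ⟨i, hi⟩
  exact hk ⟨i, σ.injective hi⟩

end ProductStates

/-! ### One trial of Nielsen's scheme -/

section Exchange

variable {ι α : Type*} {f g : ι → α}

/-- The map that exchanges `f i` with `g i`, for every `i`, and fixes everything else; meant for
injective `f` and `g` with disjoint ranges. -/
def exchange (f g : ι → α) : α → α :=
  Function.extend f g (Function.extend g f id)

theorem exchange_left (hf : f.Injective) (i : ι) : exchange f g (f i) = g i :=
  hf.extend_apply _ _ i

theorem exchange_right (hg : g.Injective) (hfg : ∀ i l, f i ≠ g l) (i : ι) :
    exchange f g (g i) = f i :=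
  (Function.extend_apply' _ _ _ fun ⟨l, hl⟩ => hfg l i hl).trans (hg.extend_apply _ _ i)

theorem exchange_of_forall_ne {x : α} (hxf : ∀ i, f i ≠ x) (hxg : ∀ i, g i ≠ x) :
    exchange f g x = x :=
  (Function.extend_apply' _ _ _ fun ⟨l, hl⟩ => hxf l hl).trans
    (Function.extend_apply' _ _ _ fun ⟨l, hl⟩ => hxg l hl)

theorem exchange_involutive (hf : f.Injective) (hg : g.Injective) (hfg : ∀ i l, f i ≠ g l) :
    (exchange f g).Involutive := by
  intro x
  by_cases hxf : ∃ i, f i = x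
  · obtain ⟨i, rfl⟩ := hxf
    rw [exchange_left hf, exchange_right hg hfg]
  by_cases hxg : ∃ i, g i = x
  · obtain ⟨i, rfl⟩ := hxg
    rw [exchange_right hg hfg, exchange_left hf]
  rw [exchange_of_forall_ne (not_exists.1 hxf) (not_exists.1 hxg),
    exchange_of_forall_ne (not_exists.1 hxf) (not_exists.1 hxg)]

end Exchange

section Teleportation

variable {a N : ℕ} (e : Fin a ↪ Fin N)

/-- The permutation of `N + 2a` qubits that exchanges the qubits `e` with the last `a` qubits. -/
def swapWithLast : Equiv.Perm (Fin (N + (a + a))) :=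
  (exchange_involutive (f := Fin.castAdd (a + a) ∘ e) (g := Fin.natAdd N ∘ Fin.natAdd a)
    ((Fin.castAdd_injective _ _).comp e.injective)
    ((Fin.natAdd_injective _ _).comp (Fin.natAdd_injective _ _))
    fun _ _ => castAdd_ne_natAdd _ _).toPerm

theorem swapWithLast_swapWithLast (k : Fin (N + (a + a))) :
    swapWithLast e (swapWithLast e k) = k :=
  Function.Involutive.toPerm_involutive _ k

theorem swapWithLast_castAdd_apply (i : Fin a) :
    swapWithLast e (Fin.castAdd (a + a) (e i)) = Fin.natAdd N (Fin.natAdd a i) :=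
  exchange_left ((Fin.castAdd_injective _ _).comp e.injective) i

theorem swapWithLast_natAdd_natAdd (i : Fin a) :
    swapWithLast e (Fin.natAdd N (Fin.natAdd a i)) = Fin.castAdd (a + a) (e i) := by
  rw [← swapWithLast_castAdd_apply, swapWithLast_swapWithLast]

theorem swapWithLast_castAdd_of_forall_ne {k : Fin N} (hk : ∀ i, e i ≠ k) :
    swapWithLast e (Fin.castAdd (a + a) k) = Fin.castAdd (a + a) k :=
  exchange_of_forall_ne (fun i hi => hk i (Fin.castAdd_injective _ _ hi))
    fun _ => (castAdd_ne_natAdd _ _).symm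

theorem swapWithLast_natAdd_castAdd (i : Fin a) :
    swapWithLast e (Fin.natAdd N (Fin.castAdd a i)) = Fin.natAdd N (Fin.castAdd a i) :=
  exchange_of_forall_ne (fun _ => castAdd_ne_natAdd _ _)
    fun _ h => castAdd_ne_natAdd _ _ (Fin.natAdd_injective _ _ h).symm

/-- The qubits of the Bell measurement that teleports the qubits `e`: the first half of the new
qubits, paired with the qubits `e`. -/
def bellPlacement : Fin (a + a) ↪ Fin (N + (a + a)) :=
  (Fin.natAddEmb N).trans (swapWithLast e).toEmbedding

theorem extend_bellPlacement (s : Bits (a + a)) (x : Bits (N + (a + a))) :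
    Function.extend (bellPlacement e) s x =
      Fin.append ((x ∘ swapWithLast e) ∘ Fin.castAdd (a + a)) s ∘ swapWithLast e := by
  refine extend_eq_of_comp_eq (bellPlacement e).injective (fun i => ?_) fun k => ?_
  · simp [bellPlacement, swapWithLast_swapWithLast]
  · obtain ⟨k, rfl⟩ := (swapWithLast e).surjective k
    refine Fin.addCases (fun i _ => ?_) (fun i hi => absurd rfl (hi i)) k
    simp [swapWithLast_swapWithLast]

theorem append_comp_swapWithLast_comp_castAdd (y : Bits N) (s : Bits (a + a)) :
    (Fin.append y s ∘ swapWithLast e) ∘ Fin.castAdd (a + a) =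
      Function.extend e (s ∘ Fin.natAdd a) y := by
  refine (extend_eq_of_comp_eq e.injective (fun i => ?_) fun k hk => ?_).symm
  · simp [swapWithLast_castAdd_apply]
  · simp [swapWithLast_castAdd_of_forall_ne e hk]

theorem append_comp_swapWithLast_comp_natAdd (y : Bits N) (s : Bits (a + a)) :
    (Fin.append y s ∘ swapWithLast e) ∘ Fin.natAdd N = Fin.append (s ∘ Fin.castAdd a) (y ∘ e) := by
  funext i
  refine Fin.addCases (fun i => ?_) (fun i => ?_) i
  · simp [swapWithLast_natAdd_castAdd]
  · simp only [Function.comp_apply, swapWithLast_natAdd_natAdd, Fin.append_left, Fin.append_right]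

theorem teleportation (B M : QOp a) (φ : QState N) :
    embed (bellPlacement e) (vecMulVec (choiState B) (star (choiState B))) *ᵥ
        tensorState φ (choiState M) =
      ((2 ^ a)⁻¹ : ℂ) • permuteQubits (swapWithLast e)
        (tensorState (embed e (M * Bᴴ) *ᵥ φ) (choiState B)) := by
  funext x
  set y : Bits N := (x ∘ swapWithLast e) ∘ Fin.castAdd (a + a) with hy
  have hb : x ∘ bellPlacement e = (x ∘ swapWithLast e) ∘ Fin.natAdd N := rfl
  have hsum : ((2 ^ a)⁻¹ : ℂ) * (embed e (M * Bᴴ) *ᵥ φ) y =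
      ∑ s, star (choiState B s) * tensorState φ (choiState M)
        (Function.extend (bellPlacement e) s x) := by
    rw [embed_mulVec, Finset.mul_sum, ← (Fin.appendEquiv a a).sum_comp,
      Fintype.sum_prod_type_right]
    refine Finset.sum_congr rfl fun s _ => ?_
    rw [Matrix.mul_apply, Finset.sum_mul, Finset.mul_sum]
    refine Finset.sum_congr rfl fun t _ => ?_
    rw [extend_bellPlacement, tensorState, ← hy, append_comp_swapWithLast_comp_castAdd,
      append_comp_swapWithLast_comp_natAdd, choiState_apply, choiState_apply,
      ← inv_sqrt_two_pow_mul_self]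
    simp only [Fin.appendEquiv, Equiv.coe_fn_mk, Function.comp_def, Fin.append_left,
      Fin.append_right, star_mul', RCLike.star_def, Complex.conj_ofReal, conjTranspose_apply]
    ring
  rw [embed_mulVec, Pi.smul_apply, permuteQubits, tensorState, hb]
  simp only [vecMulVec_apply, Pi.star_apply, mul_assoc]
  rw [← Finset.mul_sum, ← hsum, smul_eq_mul, ← hy, mul_left_comm, mul_comm (choiState B _)]

end Teleportation

section TrialState

variable {a n N : ℕ}

/-- The (unnormalized) state of the register after a trial for `U` on the qubits `e`, with outcome
`j` of the measurement in the basis `|U_j⟩` and outcome `k` of the Bell measurement. -/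
def trialState (e : Fin a ↪ Fin N) (U : QOp a) (j k : Fin a → Fin 4) (φ : QState N) :
    QState (N + (a + a)) :=
  (star (basisState U j 0) * (2 ^ a)⁻¹) • permuteQubits (swapWithLast e)
    (tensorState (embed e (U * (pauliString j * pauliString k)) *ᵥ φ) (basisState 1 k))

theorem bellProj_mulVec_basisProj_mulVec (e : Fin a ↪ Fin N) (U : QOp a) (j k : Fin a → Fin 4)
    (φ : QState N) :
    embed (bellPlacement e) (vecMulVec (basisState 1 k) (star (basisState 1 k))) *ᵥ
        (embed (Fin.natAddEmb N) (vecMulVec (basisState U j) (star (basisState U j))) *ᵥ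
          tensorState φ (Pi.single (0 : Bits (a + a)) 1)) =
      trialState e U j k φ := by
  have first : vecMulVec (basisState U j) (star (basisState U j)) *ᵥ
      (Pi.single 0 1 : QState (a + a)) = star (basisState U j 0) • basisState U j := by
    funext x
    simp [vecMulVec_apply, mul_comm]
  rw [embed_natAdd_mulVec_tensorState, first, tensorState_smul, Matrix.mulVec_smul,
    basisState_eq_choiState, basisState_eq_choiState, one_mul, teleportation, smul_smul,
    pauliString_conjTranspose, mul_assoc, ← one_mul (pauliString k), ← basisState_eq_choiState,
    ← basisState_eq_choiState, one_mul, trialState]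

theorem normSq_eprState : normSq (eprState n) = 1 := by
  have h : ∀ s t : Bits n,
      ‖eprState n (Fin.append s t)‖ ^ 2 = if t = s then ((2 : ℝ) ^ n)⁻¹ else 0 := by
    intro s t
    simp only [eprState, Fin.append_left, Fin.append_right, eq_comm (a := t)]
    split_ifs <;> simp
  rw [normSq, ← (Fin.appendEquiv n n).sum_comp, Fintype.sum_prod_type]
  simp [Fin.appendEquiv, h]

theorem normSq_basisState {U : QOp n} (hU : U ∈ unitaryGroup (Bits n) ℂ) (j : Fin n → Fin 4) :
    normSq (basisState U j) = 1 := by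
  have hUj : U * pauliString j ∈ unitaryGroup (Bits n) ℂ :=
    mul_mem hU (pauliGroup_le_unitaryGroup (pauliString_mem_pauliGroup j))
  rw [basisState, normSq_mulVec (embed_mem_unitaryGroup _ hUj), normSq_eprState]

theorem normSq_trialState (e : Fin a ↪ Fin N) {U : QOp a} (hU : U ∈ unitaryGroup (Bits a) ℂ)
    (j k : Fin a → Fin 4) (φ : QState N) :
    normSq (trialState e U j k φ) = ‖basisState U j 0‖ ^ 2 * (1 / 4) ^ a * normSq φ := by
  have hUjk : U * (pauliString j * pauliString k) ∈ unitaryGroup (Bits a) ℂ :=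
    mul_mem hU (pauliGroup_le_unitaryGroup
      (mul_mem (pauliString_mem_pauliGroup j) (pauliString_mem_pauliGroup k)))
  have h4 : ((1 : ℝ) / 4) ^ a = ((2 ^ a)⁻¹) ^ 2 := by
    rw [← inv_pow, pow_right_comm]
    norm_num
  rw [trialState, normSq_smul, normSq_permuteQubits, normSq_tensorState,
    normSq_mulVec (embed_mem_unitaryGroup e hUjk), normSq_basisState (one_mem _), mul_one, h4]
  simp only [norm_mul, norm_star, norm_inv, norm_pow, Complex.norm_two, mul_pow]

theorem sum_norm_sq_basisState {U : QOp n} (hU : U ∈ unitaryGroup (Bits n) ℂ)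
    (x : Bits (n + n)) : ∑ j, ‖basisState U j x‖ ^ 2 = 1 := by
  have h := congrFun (congrFun (sum_vecMulVec_basisState hU) x) x
  rw [Matrix.sum_apply, Matrix.one_apply_eq] at h
  simp only [vecMulVec_apply, Pi.star_apply, RCLike.star_def, Complex.mul_conj'] at h
  exact_mod_cast h

/-- The qubits that hold a register `out` after the trial `trialState (q.trans out)`: the qubits
`q` of it have been moved to the new qubits. -/
def registerAfterTrial (q : Fin a ↪ Fin n) (out : Fin n ↪ Fin N) : Fin n ↪ Fin (N + (a + a)) :=
  (out.trans (Fin.castAddEmb (a + a))).trans (swapWithLast (q.trans out)).toEmbedding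

theorem IsProductState.trialState {out : Fin n ↪ Fin N} {θ : QState n} {φ : QState N}
    (h : IsProductState out θ φ) (q : Fin a ↪ Fin n) (U : QOp a) (j k : Fin a → Fin 4) :
    IsProductState (registerAfterTrial q out)
      (MeasQC.embed q (U * (pauliString j * pauliString k)) *ᵥ θ)
      (trialState (q.trans out) U j k φ) := by
  have teleported := h.embed (MeasQC.embed q (U * (pauliString j * pauliString k)))
  rw [← embed_trans] at teleported
  exact ((teleported.tensorState _).permuteQubits _).smul _

end TrialState

/-! ### Protocols -/

section Protocols

variable {S : Set QMeas} {n N : ℕ}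

/-- Preparation of `k` new qubits, followed by `p`. -/
def prepareMany : (k : ℕ) → Protocol S n (N + k) → Protocol S n N
  | 0, p => p
  | k + 1, p => prepareMany k (.prepare p)

theorem steps_prepareMany (k : ℕ) (p : Protocol S n (N + k)) :
    (prepareMany k p).steps = p.steps + k := by
  induction k with
  | zero => rfl
  | succ k ih => rw [prepareMany, ih, Protocol.steps, add_right_comm, add_assoc]

theorem failureProb_prepareMany (k : ℕ) (p : Protocol S n (N + k)) (φ : QState N) :
    (prepareMany k p).failureProb φ = p.failureProb (tensorState φ (Pi.single 0 1)) := by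
  induction k with
  | zero => rw [tensorState_zero_qubits, prepareMany]
  | succ k ih => rw [prepareMany, ih, Protocol.failureProb, adjoinZero_tensorState]

theorem outputs_prepareMany (k : ℕ) (p : Protocol S n (N + k)) (θ : QState n) (φ : QState N) :
    (prepareMany k p).Outputs θ φ ↔ p.Outputs θ (tensorState φ (Pi.single 0 1)) := by
  induction k with
  | zero => rw [tensorState_zero_qubits, prepareMany]
  | succ k ih => rw [prepareMany, ih, Protocol.Outputs, adjoinZero_tensorState]

theorem exists_measureMany {k s : ℕ} (L : Fin k → PlacedMeas N) (hL : ∀ i, (L i).1 ∈ S)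
    (next : Bits k → Protocol S n N) (hnext : ∀ b, (next b).steps ≤ s) :
    ∃ p : Protocol S n N, p.steps ≤ k + s ∧
      (∀ φ, p.failureProb φ = ∑ b, (next b).failureProb
        ((List.ofFn fun i => (L i).proj (b i)).prod *ᵥ φ)) ∧
      ∀ θ φ, (∀ b, (next b).Outputs θ ((List.ofFn fun i => (L i).proj (b i)).prod *ᵥ φ)) →
        p.Outputs θ φ := by
  induction k generalizing s with
  | zero =>
    refine ⟨next 0, (hnext 0).trans (Nat.le_add_left _ _), fun φ => ?_, fun θ φ h => ?_⟩
    · rw [Fintype.sum_subsingleton _ (0 : Bits 0), List.ofFn_zero, List.prod_nil,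
        Matrix.one_mulVec]
    · simpa only [List.ofFn_zero, List.prod_nil, Matrix.one_mulVec] using h 0
  | succ k ih =>
    have prod_cons (b : Bits k) (c : Fin 2) (φ : QState N) :
        (List.ofFn fun i => (L i).proj ((Fin.cons c b : Bits (k + 1)) i)).prod *ᵥ φ =
          (L 0).proj c *ᵥ ((List.ofFn fun i => (L i.succ).proj (b i)).prod *ᵥ φ) := by
      simp only [List.ofFn_succ, List.prod_cons, ← Matrix.mulVec_mulVec, Fin.cons_zero,
        Fin.cons_succ]
    obtain ⟨p, steps_le, failureProb_eq, outputs⟩ := ih (fun i => L i.succ) (fun i => hL i.succ)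
      (fun b => .measure (L 0).1 (hL 0) (L 0).2 fun c => next (Fin.cons c b))
      (fun b => Nat.succ_le_succ (max_le (hnext _) (hnext _)))
    refine ⟨p, steps_le.trans_eq (Nat.add_right_comm k 1 s).symm, fun φ => ?_,
      fun θ φ h => outputs θ φ fun b c => prod_cons b c φ ▸ h (Fin.cons c b)⟩
    rw [failureProb_eq, ← (Fin.consEquiv fun _ => Fin 2).sum_comp, Fintype.sum_prod_type_right]
    refine Finset.sum_congr rfl fun b _ => Finset.sum_congr rfl fun c _ => ?_
    exact congrArg _ (prod_cons b c φ).symm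

theorem exists_measureBasis {a s : ℕ} {U : QOp a} (hU : BasisMeasuredBy {p | p.1 ∈ S} U)
    (e : Fin (a + a) ↪ Fin N) (next : (Fin a → Fin 4) → Protocol S n N)
    (hnext : ∀ j, (next j).steps ≤ s) :
    ∃ p : Protocol S n N, p.steps ≤ (a + a) + s ∧
      (∀ φ, p.failureProb φ = ∑ j, (next j).failureProb
        (embed e (vecMulVec (basisState U j) (star (basisState U j))) *ᵥ φ)) ∧
      ∀ θ φ, (∀ j, (next j).Outputs θ
        (embed e (vecMulVec (basisState U j) (star (basisState U j))) *ᵥ φ)) → p.Outputs θ φ := by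
  obtain ⟨L, hL, -, r, hr⟩ := hU
  have prod_proj (b : Bits (a + a)) :
      (List.ofFn fun i => PlacedMeas.proj ⟨(L i).1, (L i).2.trans e⟩ (b i)).prod =
        embed e (vecMulVec (basisState U (r b)) (star (basisState U (r b)))) := by
    rw [← hr, ← embedHom_apply, map_list_prod, List.map_ofFn]
    exact congrArg (fun f => (List.ofFn f).prod) (funext fun i => embed_trans _ _ _)
  obtain ⟨p, steps_le, failureProb_eq, outputs⟩ :=
    exists_measureMany (S := S) (fun i => ⟨(L i).1, (L i).2.trans e⟩) hL (fun b => next (r b))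
      fun b => hnext _
  refine ⟨p, steps_le, fun φ => ?_, fun θ φ h => outputs θ φ fun b => prod_proj b ▸ h _⟩
  simp only [failureProb_eq, ← r.sum_comp, prod_proj]

theorem exists_trial {a s : ℕ} {U : QOp a} (hBell : BasisMeasuredBy {p | p.1 ∈ S} (1 : QOp a))
    (hU : BasisMeasuredBy {p | p.1 ∈ S} U) (e : Fin a ↪ Fin N)
    (next : (Fin a → Fin 4) → (Fin a → Fin 4) → Protocol S n (N + (a + a)))
    (hnext : ∀ j k, (next j k).steps ≤ s) :
    ∃ p : Protocol S n N, p.steps ≤ 6 * a + s ∧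
      (∀ φ, p.failureProb φ = ∑ j, ∑ k, (next j k).failureProb (trialState e U j k φ)) ∧
      ∀ θ φ, (∀ j k, (next j k).Outputs θ (trialState e U j k φ)) → p.Outputs θ φ := by
  choose bell bell_steps bell_failureProb bell_outputs using fun j =>
    exists_measureBasis hBell (bellPlacement e) (next j) (hnext j)
  obtain ⟨p, p_steps, p_failureProb, p_outputs⟩ :=
    exists_measureBasis hU (Fin.natAddEmb N) bell bell_steps
  refine ⟨prepareMany (a + a) p, ?_, fun φ => ?_, fun θ φ h => ?_⟩
  · rw [steps_prepareMany]
    omega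
  · simp only [failureProb_prepareMany, p_failureProb, bell_failureProb,
      bellProj_mulVec_basisProj_mulVec]
  · rw [outputs_prepareMany]
    refine p_outputs _ _ fun j => bell_outputs j _ _ fun k => ?_
    rw [bellProj_mulVec_basisProj_mulVec]
    exact h j k

theorem IsProductState.outputs {out : Fin n ↪ Fin N} {θ : QState n} {φ : QState N}
    (h : IsProductState out θ φ) : (Protocol.output out : Protocol S n N).Outputs θ φ := by
  classical
  obtain ⟨χ, hχ, hφ⟩ := h
  refine ⟨fun r => χ fun k => if hk : k ∉ Set.range out then r ⟨k, hk⟩ else 0, fun x => ?_⟩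
  rw [hφ]
  refine congrArg _ (hχ _ _ fun k hk => ?_)
  rw [dif_pos hk]

theorem trialGate_append_singleton {a : ℕ} (U : QOp a) (errors : List (Fin a → Fin 4))
    (e : Fin a → Fin 4) :
    trialGate U (errors ++ [e]) = trialGate U errors * pauliString e * (trialGate U errors)ᴴ := by
  simp only [trialGate, List.foldl_append, List.foldl_cons, List.foldl_nil]

end Protocols

/-! ### Simulation of circuits -/

section Simulation

variable {S : Set QMeas} {a n s s' : ℕ} {δ δ' : ℝ} {V : QOp a} {W : QOp n}

/-- With at most `s` measurements from `S` and preparations, `W` can be applied to any part of any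
register, with failure probability at most `δ`. Unlike `Protocol.Simulates`, this notion can be
composed, since it allows for further qubits and for unnormalized states. -/
def SimulableWithin (S : Set QMeas) (s : ℕ) (δ : ℝ) (W : QOp n) : Prop :=
  ∀ (N : ℕ) (out : Fin n ↪ Fin N), ∃ p : Protocol S n N, p.steps ≤ s ∧
    ∀ θ φ, IsProductState out θ φ → p.Outputs (W *ᵥ θ) φ ∧ p.failureProb φ ≤ δ * normSq φ

theorem SimulableWithin.mono (h : SimulableWithin S s δ W) (hs : s ≤ s') :
    SimulableWithin S s' δ W := fun N out =>
  let ⟨p, hp, hpW⟩ := h N out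
  ⟨p, hp.trans hs, hpW⟩

theorem SimulableWithin.smul (h : SimulableWithin S s δ W) {z : ℂ} (hz : z ≠ 0) :
    SimulableWithin S s δ (z • W) := by
  intro N out
  obtain ⟨p, steps_le, hp⟩ := h N out
  refine ⟨p, steps_le, fun θ φ hθ => ?_⟩
  rw [smul_mulVec, ← mulVec_smul]
  refine hp (z • θ) φ (IsProductState.of_smul (z := z⁻¹) ?_)
  rwa [inv_smul_smul₀ hz]

theorem simulableWithin_one : SimulableWithin S 0 0 (1 : QOp n) := fun N out =>
  ⟨.output out, le_rfl, fun θ φ h => by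
    rw [Matrix.one_mulVec, zero_mul]
    exact ⟨h.outputs, le_rfl⟩⟩

theorem simulableWithin_failure (hδ : 1 ≤ δ) : SimulableWithin S s δ W := fun _ _ =>
  ⟨.failure, Nat.zero_le _, fun _ φ _ =>
    ⟨trivial, le_mul_of_one_le_left (normSq_nonneg φ) hδ⟩⟩

theorem sum_trial_failure_eq (hV : V ∈ unitaryGroup (Bits a) ℂ) (δ δ' : ℝ) :
    ∑ j, ∑ k, (if j = k then δ else δ') * (‖basisState V j 0‖ ^ 2 * (1 / 4) ^ a) =
      (1 / 4) ^ a * δ + (1 - (1 / 4) ^ a) * δ' := by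
  have sum_over_bell (j : Fin a → Fin 4) :
      ∑ k, (if j = k then δ else δ') = 4 ^ a * δ' + (δ - δ') := by
    have split (k : Fin a → Fin 4) :
        (if j = k then δ else δ') = δ' + if j = k then δ - δ' else 0 := by
      split_ifs <;> ring
    simp [split, Finset.sum_add_distrib]
  have quarter : (4 : ℝ) ^ a * (1 / 4) ^ a = 1 := by rw [← mul_pow]; norm_num
  simp only [← Finset.sum_mul, sum_over_bell, ← mul_assoc, ← Finset.mul_sum,
    sum_norm_sq_basisState hV, mul_one]
  linear_combination δ' * quarter

/-- A failed trial, with outcomes `j ≠ k` and `σ_j σ_k ∝ σ_l`, leaves `V σ_l` applied in place of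
`V`, which `V σ_l V†` corrects. -/
theorem SimulableWithin.exists_afterTrial (hV : V ∈ unitaryGroup (Bits a) ℂ) (q : Fin a ↪ Fin n)
    (success : SimulableWithin S s δ W)
    (retry : ∀ l, SimulableWithin S s δ' (W * embed q (V * pauliString l * Vᴴ)))
    {N : ℕ} (out : Fin n ↪ Fin N) (j k : Fin a → Fin 4) :
    ∃ p : Protocol S n (N + (a + a)), p.steps ≤ s ∧
      ∀ θ φ, IsProductState out θ φ →
        p.Outputs ((W * embed q V) *ᵥ θ) (trialState (q.trans out) V j k φ) ∧
          p.failureProb (trialState (q.trans out) V j k φ) ≤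
            (if j = k then δ else δ') * normSq (trialState (q.trans out) V j k φ) := by
  obtain rfl | hjk := eq_or_ne j k
  · obtain ⟨p, steps_le, hp⟩ := success _ (registerAfterTrial q out)
    refine ⟨p, steps_le, fun θ φ h => ?_⟩
    have teleported := h.trialState q V j j
    rw [pauliString_mul_self, mul_one] at teleported
    rw [if_pos rfl, ← Matrix.mulVec_mulVec]
    exact hp _ _ teleported
  · obtain ⟨c, -, hc⟩ := exists_pauliString_mul_pauliString j k
    obtain ⟨p, steps_le, hp⟩ := retry (fun i => j i ^^^ k i) _ (registerAfterTrial q out)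
    refine ⟨p, steps_le, fun θ φ h => ?_⟩
    have teleported := h.trialState q V j k
    rw [hc, Matrix.mul_smul, embed_smul, Matrix.smul_mulVec] at teleported
    have correction : V * pauliString (fun i => j i ^^^ k i) * Vᴴ *
        (V * pauliString fun i => j i ^^^ k i) = V := by
      rw [mul_assoc _ Vᴴ, ← mul_assoc Vᴴ, ← star_eq_conjTranspose, mem_unitaryGroup_iff'.1 hV,
        one_mul, mul_assoc, pauliString_mul_self, mul_one]
    have corrected := hp _ _ teleported.of_smul
    rw [if_neg hjk]
    rwa [Matrix.mulVec_mulVec, mul_assoc, ← embed_mul, correction] at corrected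

theorem SimulableWithin.trial (hBell : BasisMeasuredBy {p | p.1 ∈ S} (1 : QOp a))
    (hV : V ∈ unitaryGroup (Bits a) ℂ) (hVS : BasisMeasuredBy {p | p.1 ∈ S} V)
    (q : Fin a ↪ Fin n) (success : SimulableWithin S s δ W)
    (retry : ∀ l, SimulableWithin S s δ' (W * embed q (V * pauliString l * Vᴴ))) :
    SimulableWithin S (6 * a + s) ((1 / 4) ^ a * δ + (1 - (1 / 4) ^ a) * δ')
      (W * embed q V) := by
  intro N out
  choose next next_steps hnext using
    SimulableWithin.exists_afterTrial hV q success retry out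
  obtain ⟨p, steps_le, failureProb_eq, outputs⟩ :=
    exists_trial hBell hVS (q.trans out) next next_steps
  refine ⟨p, steps_le, fun θ φ h => ⟨outputs _ _ fun j k => (hnext j k θ φ h).1, ?_⟩⟩
  rw [failureProb_eq]
  calc ∑ j, ∑ k, (next j k).failureProb (trialState (q.trans out) V j k φ)
      ≤ ∑ j, ∑ k, (if j = k then δ else δ') *
          (‖basisState V j 0‖ ^ 2 * (1 / 4) ^ a * normSq φ) :=
        Finset.sum_le_sum fun j _ => Finset.sum_le_sum fun k _ =>
          normSq_trialState (q.trans out) hV j k φ ▸ (hnext j k θ φ h).2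
    _ = ((1 / 4) ^ a * δ + (1 - (1 / 4) ^ a) * δ') * normSq φ := by
      simp only [← sum_trial_failure_eq hV, Finset.sum_mul, mul_assoc]

theorem SimulableWithin.gate (hW : SimulableWithin universalSet s δ W) (hδ : 0 ≤ δ) (g : Gate)
    (q : Fin g.arity ↪ Fin n) (t : ℕ) (errors : List (Fin g.arity → Fin 4)) :
    SimulableWithin universalSet (6 * g.arity * t + s) ((1 - (1 / 4) ^ g.arity) ^ t + δ)
      (W * embed q (trialGate g.op errors)) := by
  induction t generalizing errors with
  | zero => exact simulableWithin_failure (by rw [pow_zero]; exact le_add_of_nonneg_right hδ)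
  | succ t ih =>
    have retry (l : Fin g.arity → Fin 4) :=
      trialGate_append_singleton g.op errors l ▸ ih (errors ++ [l])
    convert (hW.mono (Nat.le_add_left _ _)).trial
      ((basisMeasuredBy_bellMeas (one_mem _)).mono (bellMeas_subset _))
      (trialGate_mem_unitaryGroup (op_mem_unitaryGroup g) errors)
      (basisMeasuredBy_trialGate g errors) q retry using 1
    · ring
    · ring

theorem simulableWithin_circuitOp (c : List (PlacedGate n)) (t : ℕ) :
    SimulableWithin universalSet (c.map fun g => 6 * g.1.arity * t).sum
      (c.map fun g => (1 - (1 / 4 : ℝ) ^ g.1.arity) ^ t).sum (circuitOp c) := by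
  induction c with
  | nil => exact simulableWithin_one
  | cons g c ih =>
    refine ih.gate (List.sum_nonneg fun x hx => ?_) g.1 g.2 t []
    obtain ⟨g, -, rfl⟩ := List.mem_map.mp hx
    exact pow_nonneg (sub_nonneg.mpr (pow_le_one₀ (by norm_num) (by norm_num))) t

theorem SimulableWithin.exists_protocol (h : SimulableWithin S s δ W) :
    ∃ p : Protocol S n n, p.steps ≤ s ∧ p.Simulates W δ := by
  obtain ⟨p, steps_le, hp⟩ := h n (Function.Embedding.refl _)
  refine ⟨p, steps_le, fun ψ hψ => ?_⟩
  simpa only [hψ, mul_one] using hp ψ ψ (isProductState_refl ψ)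

end Simulation

/-! ### One-parameter groups in closed monoids -/

section OneParameterGroup

open Filter Topology

open NormedSpace (exp)

theorem norm_pow_sub_pow_le {R : Type*} [NormedRing R] [NormOneClass R] {x y : R}
    (hx : ‖x‖ ≤ 1) (hy : ‖y‖ ≤ 1) (m : ℕ) : ‖x ^ m - y ^ m‖ ≤ m * ‖x - y‖ := by
  induction m with
  | zero => simp
  | succ m ih =>
    calc ‖x ^ (m + 1) - y ^ (m + 1)‖ = ‖(x ^ m - y ^ m) * x + y ^ m * (x - y)‖ := by
          rw [pow_succ, pow_succ]
          noncomm_ring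
      _ ≤ ‖(x ^ m - y ^ m) * x‖ + ‖y ^ m * (x - y)‖ := norm_add_le _ _
      _ ≤ ‖x ^ m - y ^ m‖ + ‖x - y‖ := add_le_add
          ((norm_mul_le _ _).trans (mul_le_of_le_one_right (norm_nonneg _) hx))
          ((norm_mul_le _ _).trans (mul_le_of_le_one_left (norm_nonneg _)
            ((norm_pow_le _ _).trans (pow_le_one₀ (norm_nonneg _) hy))))
      _ ≤ (m + 1 : ℕ) * ‖x - y‖ := by
          push_cast
          linarith

variable {A : Type*} [CStarAlgebra A] {a b u : A}

/-- The element `exp(i t a)` of the one-parameter group generated by `a`, which is unitary if `a` is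
selfadjoint. -/
def expI (t : ℝ) (a : A) : A := exp (t • (Complex.I • a))

theorem expI_zero (a : A) : expI 0 a = 1 := by
  rw [expI, zero_smul, NormedSpace.exp_zero]

theorem expI_add (s t : ℝ) (a : A) : expI (s + t) a = expI s a * expI t a := by
  let +nondep : NormedAlgebra ℚ A := .restrictScalars ℚ ℂ A
  rw [expI, add_smul, NormedSpace.exp_add_of_commute]
  · rfl
  · exact ((Commute.refl _).smul_left s).smul_right t

theorem expI_smul (t r : ℝ) (a : A) : expI t (r • a) = expI (t * r) a := by
  rw [expI, expI, smul_comm Complex.I r a, smul_smul]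

theorem expI_natCast_mul (m : ℕ) (t : ℝ) (a : A) : expI (m * t) a = expI t a ^ m := by
  induction m with
  | zero => rw [Nat.cast_zero, zero_mul, expI_zero, pow_zero]
  | succ m ih => rw [Nat.cast_succ, add_mul, one_mul, expI_add, ih, pow_succ]

theorem expI_mem_unitary (ha : IsSelfAdjoint a) (t : ℝ) : expI t a ∈ unitary A := by
  let +nondep : NormedAlgebra ℚ A := .restrictScalars ℚ ℂ A
  refine NormedSpace.exp_mem_unitary_of_mem_skewAdjoint ?_
  rw [smul_comm]
  exact ((IsSelfAdjoint.all t).smul ha).smul_mem_skewAdjoint Complex.conj_I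

theorem norm_expI_le_one (ha : IsSelfAdjoint a) (t : ℝ) : ‖expI t a‖ ≤ 1 := by
  nontriviality A
  exact (CStarRing.norm_of_mem_unitary (expI_mem_unitary ha t)).le

theorem continuous_expI (a : A) : Continuous fun t => expI t a := by
  let +nondep : NormedAlgebra ℚ A := .restrictScalars ℚ ℂ A
  exact NormedSpace.exp_continuous.comp (continuous_id.smul continuous_const)

theorem hasDerivAt_expI_zero (a : A) : HasDerivAt (fun t => expI t a) (Complex.I • a) 0 := by
  have deriv := hasDerivAt_exp_smul_const (𝕂 := ℝ) (Complex.I • a) (0 : ℝ)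
  rwa [zero_smul, NormedSpace.exp_zero, one_mul] at deriv

/-- The Lie product formula. -/
theorem tendsto_expI_mul_expI_pow (ha : IsSelfAdjoint a) (hb : IsSelfAdjoint b) :
    Tendsto (fun m : ℕ => (expI (1 / ((m : ℝ) + 1)) a * expI (1 / ((m : ℝ) + 1)) b) ^ (m + 1))
      atTop (𝓝 (expI 1 (a + b))) := by
  nontriviality A
  have deriv : HasDerivAt (fun t => expI t a * expI t b - expI t (a + b)) 0 0 := by
    have h := ((hasDerivAt_expI_zero a).mul (hasDerivAt_expI_zero b)).sub
      (hasDerivAt_expI_zero (a + b))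
    rwa [expI_zero, expI_zero, one_mul, mul_one, smul_add, sub_self] at h
  have step : Tendsto (fun m : ℕ => 1 / ((m : ℝ) + 1)) atTop (𝓝[≠] 0) :=
    tendsto_nhdsWithin_of_tendsto_nhds_of_eventually_within _
      tendsto_one_div_add_atTop_nhds_zero_nat
      (Eventually.of_forall fun m => (Nat.one_div_pos_of_nat (α := ℝ) (n := m)).ne')
  have slope := ((hasDerivAt_iff_tendsto_slope_zero.mp deriv).comp step).norm
  rw [norm_zero] at slope
  rw [tendsto_iff_norm_sub_tendsto_zero]
  refine squeeze_zero (fun _ => norm_nonneg _) (fun m => ?_) slope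
  have split : expI 1 (a + b) = expI (1 / ((m : ℝ) + 1)) (a + b) ^ (m + 1) := by
    rw [← expI_natCast_mul, Nat.cast_succ, mul_one_div_cancel (Nat.cast_add_one_ne_zero m)]
  have norm_le : ‖expI (1 / ((m : ℝ) + 1)) a * expI (1 / ((m : ℝ) + 1)) b‖ ≤ 1 :=
    (norm_mul_le _ _).trans
      (mul_le_one₀ (norm_expI_le_one ha _) (norm_nonneg _) (norm_expI_le_one hb _))
  rw [split]
  refine (norm_pow_sub_pow_le norm_le (norm_expI_le_one (ha.add hb) _) (m + 1)).trans_eq ?_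
  simp only [Function.comp_apply, zero_add, expI_zero, one_mul, sub_self, sub_zero, norm_smul,
    one_div, inv_inv, Nat.cast_succ]
  rw [Real.norm_of_nonneg (by positivity)]

/-- The selfadjoint elements whose one-parameter groups lie in the closed monoid `G`. -/
def generators (G : Submonoid A) (hG : IsClosed (G : Set A)) : Submodule ℝ A where
  carrier := {a | IsSelfAdjoint a ∧ ∀ t, expI t a ∈ G}
  zero_mem' := ⟨IsSelfAdjoint.zero A, fun t => by
    rw [← zero_smul ℝ (0 : A), expI_smul, mul_zero, expI_zero]
    exact G.one_mem⟩
  add_mem' := by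
    rintro a b ⟨ha, expI_a⟩ ⟨hb, expI_b⟩
    refine ⟨ha.add hb, fun t => ?_⟩
    rw [← one_mul t, ← expI_smul, smul_add]
    refine hG.mem_of_tendsto (tendsto_expI_mul_expI_pow ((IsSelfAdjoint.all t).smul ha)
      ((IsSelfAdjoint.all t).smul hb)) (Eventually.of_forall fun m => ?_)
    rw [expI_smul, expI_smul]
    exact G.pow_mem (G.mul_mem (expI_a _) (expI_b _)) _
  smul_mem' := by
    rintro r a ⟨ha, expI_a⟩
    refine ⟨(IsSelfAdjoint.all r).smul ha, fun t => ?_⟩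
    rw [expI_smul]
    exact expI_a _

theorem expI_conjugate (hu : u ∈ unitary A) (t : ℝ) (a : A) :
    expI t (u * a * star u) = u * expI t a * star u := by
  let +nondep : NormedAlgebra ℚ A := .restrictScalars ℚ ℂ A
  have h := NormedSpace.exp_units_conj (Unitary.toUnits ⟨u, hu⟩) (t • (Complex.I • a))
  rwa [mul_smul_comm, mul_smul_comm, smul_mul_assoc, smul_mul_assoc] at h

variable {G : Submonoid A} {hG : IsClosed (G : Set A)}

theorem conjugate_mem_generators (hu : u ∈ unitary A) (huG : u ∈ G) (hstar : star u ∈ G)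
    (ha : a ∈ generators G hG) : u * a * star u ∈ generators G hG := by
  refine ⟨ha.1.conjugate u, fun t => ?_⟩
  rw [expI_conjugate hu]
  exact G.mul_mem (G.mul_mem huG (ha.2 t)) hstar

/-- The multiples of `α` are dense modulo the period `β`. -/
theorem mem_generators_of_irrational (ha : IsSelfAdjoint a) {α β : ℝ} (hα : expI α a ∈ G)
    (hneg : expI (-α) a ∈ G) (hβ : expI β a = 1) (h : Irrational (α / β)) :
    a ∈ generators G hG := by
  have hnegβ : expI (-β) a = 1 := by
    simpa only [neg_add_cancel, expI_zero, hβ, mul_one] using (expI_add (-β) β a).symm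
  have mem_of_mem_closure : ∀ t ∈ AddSubgroup.closure {α, β}, expI t a ∈ G ∧ expI (-t) a ∈ G := by
    intro t ht
    induction ht using AddSubgroup.closure_induction with
    | mem x hx =>
      rcases hx with rfl | rfl
      · exact ⟨hα, hneg⟩
      · rw [hβ, hnegβ]
        exact ⟨G.one_mem, G.one_mem⟩
    | zero =>
      rw [neg_zero, expI_zero]
      exact ⟨G.one_mem, G.one_mem⟩
    | add x y _ _ hx hy =>
      rw [neg_add, expI_add, expI_add]
      exact ⟨G.mul_mem hx.1 hy.1, G.mul_mem hx.2 hy.2⟩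
    | neg x _ hx =>
      rw [neg_neg]
      exact hx.symm
  exact ⟨ha, fun t => (hG.preimage (continuous_expI a)).closure_subset_iff.mpr
    (fun s hs => (mem_of_mem_closure s hs).1) (dense_addSubgroupClosure_pair_iff.mpr h t)⟩

theorem expI_of_mul_self (ha : IsSelfAdjoint a) (h : a * a = 1) (t : ℝ) :
    expI t a = (Real.cos t : ℂ) • (1 : A) + (Complex.I * Real.sin t) • a := by
  nontriviality A
  have normal : IsStarNormal a := ha.isStarNormal
  have linear : cfc (fun z : ℂ => (Real.cos t : ℂ) + (Complex.I * Real.sin t) * z) a =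
      (Real.cos t : ℂ) • (1 : A) + (Complex.I * Real.sin t) • a := by
    rw [cfc_const_add _ _ a, cfc_const_mul_id _ a, Algebra.algebraMap_eq_smul_one]
  rw [expI, ← Complex.coe_smul t, smul_smul, ← CFC.exp_eq_normedSpace_exp (𝕜 := ℂ),
    ← cfc_comp_smul _ _ a NormedSpace.exp_continuous.continuousOn, ← linear]
  refine cfc_congr fun z hz => ?_
  have z_sq : z ^ 2 = 1 := by
    have h_sq := spectrum.pow_mem_pow a 2 hz
    rwa [pow_two a, h, spectrum.one_eq, Set.mem_singleton_iff] at h_sq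
  simp only [smul_eq_mul, ← Complex.exp_eq_exp_ℂ]
  rcases sq_eq_one_iff.mp z_sq with rfl | rfl
  · rw [mul_one, Complex.exp_mul_I, Complex.ofReal_cos, Complex.ofReal_sin]
    ring
  · rw [mul_neg_one, ← neg_mul, Complex.exp_mul_I, Complex.cos_neg, Complex.sin_neg,
      Complex.ofReal_cos, Complex.ofReal_sin]
    ring

theorem expI_one_cfc_arg (hu : u ∈ unitary A) (harg : ContinuousOn Complex.arg (spectrum ℂ u)) :
    expI 1 (cfc (fun z => (z.arg : ℂ)) u) = u := by
  have normal : IsStarNormal u := isStarNormal_of_mem_unitary hu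
  rw [expI, one_smul, ← CFC.exp_eq_normedSpace_exp (𝕜 := ℂ), ← cfc_comp_smul .., ← cfc_comp' ..]
  conv_rhs => rw [← cfc_id' ℂ u]
  refine cfc_congr fun z hz => ?_
  have norm_z : ‖z‖ = 1 := spectrum.norm_eq_one_of_unitary hu hz
  have log_z : Complex.I * z.arg = Complex.log z :=
    Complex.ext (by simp [Complex.log_re, norm_z]) (by simp [Complex.log_im])
  have z_ne_zero : z ≠ 0 := norm_ne_zero_iff.mp (norm_z ▸ one_ne_zero)
  simpa [← Complex.exp_eq_exp_ℂ, log_z] using Complex.exp_log z_ne_zero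

end OneParameterGroup

/-! ### Operators that are approximated by circuits -/

section CircuitMonoid

open scoped Matrix.Norms.L2Operator

variable {n : ℕ}

theorem circuitOp_append (c d : List (PlacedGate n)) :
    circuitOp (c ++ d) = circuitOp d * circuitOp c := by
  induction c with
  | nil => rw [List.nil_append, circuitOp, mul_one]
  | cons g c ih => rw [List.cons_append, circuitOp, ih, circuitOp, mul_assoc]

/-- The operators of circuits on `n` qubits, up to phases. -/
def circuitMonoid (n : ℕ) : Submonoid (QOp n) where
  carrier := {A | ∃ (z : ℂ) (c : List (PlacedGate n)), ‖z‖ = 1 ∧ A = z • circuitOp c}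
  one_mem' := ⟨1, [], norm_one, by rw [circuitOp, one_smul]⟩
  mul_mem' := by
    rintro A B ⟨z, c, hz, rfl⟩ ⟨w, d, hw, rfl⟩
    exact ⟨z * w, d ++ c, by rw [norm_mul, hz, hw, one_mul],
      by rw [circuitOp_append, smul_mul_smul_comm]⟩

theorem smul_mem_circuitMonoid {A : QOp n} (hA : A ∈ circuitMonoid n) {z : ℂ} (hz : ‖z‖ = 1) :
    z • A ∈ circuitMonoid n := by
  obtain ⟨w, c, hw, rfl⟩ := hA
  exact ⟨z * w, c, by rw [norm_mul, hz, hw, one_mul], smul_smul z w _⟩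

theorem embed_op_mem_circuitMonoid (g : Gate) (q : Fin g.arity ↪ Fin n) :
    embed q g.op ∈ circuitMonoid n :=
  ⟨1, [⟨g, q⟩], norm_one, by rw [circuitOp, circuitOp, one_mul, one_smul]⟩

theorem onQubit_hadamard_mem_circuitMonoid (k : Fin n) :
    onQubit k hadamard ∈ circuitMonoid n := by
  let q : Fin 1 ↪ Fin n := ⟨fun _ => k, Function.injective_of_subsingleton _⟩
  have h : embed q (onQubit 0 hadamard) ∈ circuitMonoid n := by
    rw [← op_H]
    exact embed_op_mem_circuitMonoid .H q
  rwa [embed_onQubit] at h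

theorem onQubit_piEighth_mem_circuitMonoid (k : Fin n) :
    onQubit k piEighth ∈ circuitMonoid n := by
  let q : Fin 1 ↪ Fin n := ⟨fun _ => k, Function.injective_of_subsingleton _⟩
  have h : embed q (onQubit 0 piEighth) ∈ circuitMonoid n := by
    rw [← op_T]
    exact embed_op_mem_circuitMonoid .T q
  rwa [embed_onQubit] at h

theorem embed_controlledNot {N : ℕ} (e : Fin n ↪ Fin N) (i j : Fin n) :
    embed e (controlledNot i j) = controlledNot (e i) (e j) := by
  rw [← embedHom_apply]
  simp only [controlledNot, controlledReflection, map_add, map_sub, map_mul, map_smul, map_one,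
    embedHom_apply, embed_onQubit]

theorem controlledNot_mem_circuitMonoid {a b : Fin n} (hab : a ≠ b) :
    controlledNot a b ∈ circuitMonoid n := by
  let q : Fin 2 ↪ Fin n := ⟨![a, b], by
    intro x y h
    fin_cases x <;> fin_cases y <;> simp_all⟩
  have h : embed q (controlledNot 0 1) ∈ circuitMonoid n := by
    rw [← op_CNOT]
    exact embed_op_mem_circuitMonoid .CNOT q
  rwa [embed_controlledNot] at h

theorem piEighth_eq_expI : piEighth = expI (-(Real.pi / 8)) (pauli 3) := by
  have angle : Complex.I * Real.pi / 8 = ((Real.pi / 8 : ℝ) : ℂ) * Complex.I := by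
    push_cast
    ring
  rw [expI_of_mul_self (pauli_conjTranspose 3) (pauli_mul_self 3), piEighth, angle, ← neg_mul,
    Complex.exp_mul_I, Complex.exp_mul_I, Real.cos_neg, Real.sin_neg, Complex.cos_neg,
    Complex.sin_neg, ← Complex.ofReal_cos, ← Complex.ofReal_sin]
  ext a b
  fin_cases a <;> fin_cases b <;> simp [pauli] <;> ring

theorem piEighth_pow (m : ℕ) : piEighth ^ m = expI (-(m * (Real.pi / 8))) (pauli 3) := by
  rw [piEighth_eq_expI, ← expI_natCast_mul, mul_neg]

theorem piEighth_pow_two :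
    piEighth ^ 2 = ((√2 / 2 : ℝ) : ℂ) • (1 - Complex.I • pauli 3) := by
  rw [piEighth_pow, expI_of_mul_self (pauli_conjTranspose 3) (pauli_mul_self 3),
    show -(((2 : ℕ) : ℝ) * (Real.pi / 8)) = -(Real.pi / 4) by push_cast; ring, Real.cos_neg,
    Real.sin_neg, Real.cos_pi_div_four, Real.sin_pi_div_four]
  push_cast
  module

theorem piEighth_pow_four : piEighth ^ 4 = -Complex.I • pauli 3 := by
  rw [piEighth_pow, expI_of_mul_self (pauli_conjTranspose 3) (pauli_mul_self 3),
    show -(((4 : ℕ) : ℝ) * (Real.pi / 8)) = -(Real.pi / 2) by push_cast; ring, Real.cos_neg,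
    Real.sin_neg, Real.cos_pi_div_two, Real.sin_pi_div_two]
  push_cast
  module

theorem piEighth_pow_sixteen : piEighth ^ 16 = 1 := by
  rw [show 16 = 4 * 4 from rfl, pow_mul, piEighth_pow_four, smul_pow,
    Even.neg_pow (by decide), Complex.I_pow_four, one_smul, pow_succ, pow_succ, pow_two,
    pauli_mul_self, one_mul, pauli_mul_self]

theorem star_piEighth : star piEighth = piEighth ^ 15 := by
  refine (left_inv_eq_right_inv (a := piEighth) ?_
    (mem_unitaryGroup_iff.mp piEighth_mem_unitaryGroup)).symm
  rw [← pow_succ, piEighth_pow_sixteen]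

theorem exists_star_op_eq_pow : (g : Gate) → ∃ m : ℕ, star g.op = g.op ^ m
  | .H => by
    refine ⟨1, ?_⟩
    rw [pow_one, op_H]
    exact onQubit_isHermitian 0 isBalancedReflection_hadamard.1
  | .T => by
    refine ⟨15, ?_⟩
    rw [op_T]
    exact (map_star _ _).symm.trans ((congrArg _ star_piEighth).trans (map_pow _ _ _))
  | .CNOT => by
    refine ⟨1, ?_⟩
    rw [pow_one, op_CNOT]
    exact controlledNot_conjTranspose (by decide)

theorem star_mem_circuitMonoid {A : QOp n} (hA : A ∈ circuitMonoid n) :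
    star A ∈ circuitMonoid n := by
  obtain ⟨z, c, hz, rfl⟩ := hA
  rw [star_smul]
  refine smul_mem_circuitMonoid ?_ (by rw [norm_star, hz])
  induction c with
  | nil =>
    rw [circuitOp, star_one]
    exact one_mem _
  | cons g c ih =>
    obtain ⟨m, hm⟩ := exists_star_op_eq_pow g.1
    rw [circuitOp, star_mul, ← embedHom_apply, ← map_star, hm, map_pow]
    exact mul_mem (pow_mem (embed_op_mem_circuitMonoid _ _) m) ih

theorem circuitOp_mem_unitaryGroup :
    (c : List (PlacedGate n)) → circuitOp c ∈ unitaryGroup (Bits n) ℂ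
  | [] => one_mem _
  | g :: c => mul_mem (circuitOp_mem_unitaryGroup c)
      (embed_mem_unitaryGroup g.2 (op_mem_unitaryGroup g.1))

theorem circuitMonoid_le_unitaryGroup (n : ℕ) : circuitMonoid n ≤ unitaryGroup (Bits n) ℂ := by
  rintro _ ⟨z, c, hz, rfl⟩
  rw [mem_unitaryGroup_iff, star_smul, smul_mul_smul_comm, RCLike.star_def, Complex.mul_conj', hz,
    mem_unitaryGroup_iff.mp (circuitOp_mem_unitaryGroup c), Complex.ofReal_one, one_pow, one_smul]

/-- The operators that are approximated by circuits, up to phases. -/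
def circuitClosure (n : ℕ) : Submonoid (QOp n) := (circuitMonoid n).topologicalClosure

theorem circuitMonoid_le_circuitClosure (n : ℕ) : circuitMonoid n ≤ circuitClosure n :=
  (circuitMonoid n).le_topologicalClosure

/-- The Hermitian operators whose one-parameter groups are approximated by circuits. -/
def circuitGenerators (n : ℕ) : Submodule ℝ (QOp n) :=
  generators (circuitClosure n) (circuitMonoid n).isClosed_topologicalClosure

theorem mem_circuitGenerators_of_mul_eq {A V B : QOp n} (hV : V ∈ circuitMonoid n)
    (hA : A ∈ circuitGenerators n) (h : V * A = B * V) : B ∈ circuitGenerators n := by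
  have unitary_V := circuitMonoid_le_unitaryGroup n hV
  have conj := conjugate_mem_generators unitary_V (circuitMonoid_le_circuitClosure n hV)
    (circuitMonoid_le_circuitClosure n (star_mem_circuitMonoid hV)) hA
  rwa [h, mul_assoc, mem_unitaryGroup_iff.mp unitary_V, mul_one] at conj

theorem one_mem_circuitGenerators (n : ℕ) : (1 : QOp n) ∈ circuitGenerators n := by
  refine ⟨IsSelfAdjoint.one _, fun t => circuitMonoid_le_circuitClosure n ?_⟩
  rw [expI_of_mul_self (IsSelfAdjoint.one _) (mul_one 1), ← add_smul]
  refine smul_mem_circuitMonoid (one_mem _) ?_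
  rw [mul_comm, Complex.ofReal_cos, Complex.ofReal_sin, ← Complex.exp_mul_I,
    Complex.norm_exp_ofReal_mul_I]

end CircuitMonoid

/-! ### A rotation of a qubit by an irrational angle -/

section Rotation

open Real

open scoped Matrix.Norms.L2Operator

variable {n : ℕ}

/-- The angle of the rotation `T H T H = exp (-i rotationAngle rotationAxis)`. -/
def rotationAngle : ℝ := arccos (cos (π / 8) ^ 2)

theorem cos_rotationAngle : cos rotationAngle = cos (π / 8) ^ 2 :=
  cos_arccos (by linarith [sq_nonneg (cos (π / 8))]) (cos_sq_le_one _)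

theorem two_mul_cos_rotationAngle : 2 * cos rotationAngle = 1 + √2 / 2 := by
  rw [cos_rotationAngle, cos_sq, show 2 * (π / 8) = π / 4 by ring, cos_pi_div_four]
  ring

theorem sin_rotationAngle_sq :
    sin rotationAngle ^ 2 = sin (π / 8) ^ 2 * (1 + cos (π / 8) ^ 2) := by
  rw [sin_sq, cos_rotationAngle, sin_sq]
  ring

theorem sin_pi_div_eight_ne_zero : sin (π / 8) ≠ 0 :=
  (sin_pos_of_pos_of_lt_pi (by positivity) (by linarith [pi_pos])).ne'

theorem sin_rotationAngle_ne_zero : sin rotationAngle ≠ 0 := by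
  refine (pow_ne_zero_iff two_ne_zero).mp ?_
  rw [sin_rotationAngle_sq]
  exact mul_ne_zero (pow_ne_zero 2 sin_pi_div_eight_ne_zero) (by positivity)

/-- At a rational multiple of `π`, twice the cosine would be an algebraic integer. -/
theorem irrational_rotationAngle : Irrational (rotationAngle / (2 * π)) := by
  rintro ⟨r, hr⟩
  have angle : rotationAngle = (2 * r : ℚ) * π := by
    push_cast
    rw [hr]
    field_simp
  have integral : IsIntegral ℤ (1 + √2 / 2) := by
    rw [← two_mul_cos_rotationAngle, angle]
    exact isIntegral_two_mul_cos_rat_mul_pi _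
  have half : (1 + √2 / 2 - 1) ^ 2 = ((1 / 2 : ℚ) : ℝ) := by
    rw [add_sub_cancel_left, div_pow, sq_sqrt zero_le_two]
    norm_num
  have half_integral := (integral.sub isIntegral_one).pow 2
  rw [half, IsIntegral.ratCast_iff, IsIntegrallyClosed.isIntegral_iff] at half_integral
  obtain ⟨m, hm⟩ := half_integral
  rw [eq_intCast, eq_div_iff two_ne_zero] at hm
  have odd : m * 2 = 1 := by exact_mod_cast hm
  omega

/-- The axis of the rotation `T H T H = exp (-i rotationAngle rotationAxis)`. -/
def rotationAxis : QubitOp := (sin (π / 8) / sin rotationAngle) •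
  (cos (π / 8) • pauli 1 + sin (π / 8) • pauli 2 + cos (π / 8) • pauli 3)

theorem pauli_combination_mul_self (a b c : ℝ) :
    (a • pauli 1 + b • pauli 2 + c • pauli 3) * (a • pauli 1 + b • pauli 2 + c • pauli 3) =
      (a ^ 2 + b ^ 2 + c ^ 2) • 1 := by
  have hXY := pauli_anticommute (a := 1) (b := 2) (by decide) (by decide) (by decide)
  have hXZ := pauli_anticommute (a := 1) (b := 3) (by decide) (by decide) (by decide)
  have hYZ := pauli_anticommute (a := 2) (b := 3) (by decide) (by decide) (by decide)
  simp only [add_mul, mul_add, smul_mul_smul_comm, pauli_mul_self, hXY, hXZ, hYZ]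
  module

theorem isSelfAdjoint_rotationAxis : IsSelfAdjoint rotationAxis := by
  have h (r : ℝ) (a : Fin 4) : IsSelfAdjoint (r • pauli a) :=
    (IsSelfAdjoint.all r).smul (pauli_conjTranspose a)
  exact (IsSelfAdjoint.all _).smul (((h _ 1).add (h _ 2)).add (h _ 3))

theorem rotationAxis_mul_self : rotationAxis * rotationAxis = 1 := by
  have norm_sq : sin (π / 8) / sin rotationAngle * (sin (π / 8) / sin rotationAngle) *
      (cos (π / 8) ^ 2 + sin (π / 8) ^ 2 + cos (π / 8) ^ 2) = 1 := by
    rw [cos_sq_add_sin_sq, div_mul_div_comm, ← pow_two, ← pow_two, div_mul_eq_mul_div,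
      ← sin_rotationAngle_sq]
    exact div_self (pow_ne_zero 2 sin_rotationAngle_ne_zero)
  rw [rotationAxis, smul_mul_smul_comm, pauli_combination_mul_self, smul_smul, norm_sq, one_smul]

theorem hadamard_mul_piEighth_mul_hadamard :
    hadamard * piEighth * hadamard = expI (-(π / 8)) (pauli 1) := by
  have star_hadamard : star hadamard = hadamard := isBalancedReflection_hadamard.isHermitian
  have conj : hadamard * pauli 3 * star hadamard = pauli 1 := by
    rw [← pauli_one_mul_hadamard, mul_assoc, mem_unitaryGroup_iff.mp hadamard_mem_unitaryGroup,
      mul_one]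
  rw [piEighth_eq_expI, ← conj, expI_conjugate hadamard_mem_unitaryGroup, star_hadamard]

theorem expI_neg_pauli_three_mul_expI_neg_pauli_one (t : ℝ) :
    expI (-t) (pauli 3) * expI (-t) (pauli 1) = ((cos t ^ 2 : ℝ) : ℂ) • (1 : QubitOp) -
      (Complex.I * sin t) • (cos t • pauli 1 + sin t • pauli 2 + cos t • pauli 3) := by
  rw [expI_of_mul_self (pauli_conjTranspose 3) (pauli_mul_self 3),
    expI_of_mul_self (pauli_conjTranspose 1) (pauli_mul_self 1), pauli_two_eq,
    pauli_anticommute (a := 1) (b := 3) (by decide) (by decide) (by decide), cos_neg, sin_neg]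
  simp only [← Complex.coe_smul, add_mul, mul_add, smul_mul_smul_comm, one_mul, mul_one]
  push_cast
  match_scalars <;> ring

theorem piEighth_mul_hadamard_mul_piEighth_mul_hadamard :
    piEighth * (hadamard * piEighth * hadamard) = expI (-rotationAngle) rotationAxis := by
  rw [hadamard_mul_piEighth_mul_hadamard, piEighth_eq_expI,
    expI_neg_pauli_three_mul_expI_neg_pauli_one,
    expI_of_mul_self isSelfAdjoint_rotationAxis rotationAxis_mul_self, rotationAxis, cos_neg,
    sin_neg, cos_rotationAngle, ← Complex.coe_smul (sin (π / 8) / _), smul_smul, mul_assoc,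
    ← Complex.ofReal_mul, neg_mul, mul_div_cancel₀ _ sin_rotationAngle_ne_zero,
    Complex.ofReal_neg, mul_neg, neg_smul, sub_eq_add_neg]

theorem onQubit_real_smul (k : Fin n) (r : ℝ) (u : QubitOp) :
    onQubit k (r • u) = r • onQubit k u := by
  rw [← Complex.coe_smul, map_smul, Complex.coe_smul]

theorem onQubit_rotationAxis_mem_circuitGenerators (k : Fin n) :
    onQubit k rotationAxis ∈ circuitGenerators n := by
  have selfAdjoint : IsSelfAdjoint (onQubit k rotationAxis) :=
    isSelfAdjoint_rotationAxis.map (onQubit k)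
  have mul_self : onQubit k rotationAxis * onQubit k rotationAxis = 1 := by
    rw [← map_mul, rotationAxis_mul_self, map_one]
  have neg_angle : expI (-rotationAngle) (onQubit k rotationAxis) ∈ circuitMonoid n := by
    have h : onQubit k (piEighth * (hadamard * piEighth * hadamard)) ∈ circuitMonoid n := by
      simp only [map_mul]
      exact mul_mem (onQubit_piEighth_mem_circuitMonoid k)
        (mul_mem (mul_mem (onQubit_hadamard_mem_circuitMonoid k)
          (onQubit_piEighth_mem_circuitMonoid k)) (onQubit_hadamard_mem_circuitMonoid k))
    rwa [piEighth_mul_hadamard_mul_piEighth_mul_hadamard,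
      expI_of_mul_self isSelfAdjoint_rotationAxis rotationAxis_mul_self, map_add, map_smul,
      map_smul, map_one, ← expI_of_mul_self selfAdjoint mul_self] at h
  have pos_angle : expI rotationAngle (onQubit k rotationAxis) ∈ circuitMonoid n := by
    have inv : expI rotationAngle (onQubit k rotationAxis) *
        expI (-rotationAngle) (onQubit k rotationAxis) = 1 := by
      rw [← expI_add, add_neg_cancel, expI_zero]
    rw [left_inv_eq_right_inv inv (mem_unitaryGroup_iff.mp (expI_mem_unitary selfAdjoint _))]
    exact star_mem_circuitMonoid neg_angle
  refine mem_generators_of_irrational selfAdjoint (circuitMonoid_le_circuitClosure n pos_angle)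
    (circuitMonoid_le_circuitClosure n neg_angle) (β := 2 * π) ?_ irrational_rotationAngle
  rw [expI_of_mul_self selfAdjoint mul_self, cos_two_pi, sin_two_pi, Complex.ofReal_one,
    Complex.ofReal_zero, mul_zero, zero_smul, one_smul, add_zero]

end Rotation

/-! ### Universality -/

section Universality

open scoped Matrix.Norms.L2Operator

variable {n : ℕ}

theorem pauli_combination_add_pauli_three_conj (a b c : ℝ) :
    (a • pauli 1 + b • pauli 2 + c • pauli 3) +
      pauli 3 * (a • pauli 1 + b • pauli 2 + c • pauli 3) * pauli 3 = (c + c) • pauli 3 := by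
  have hX := pauli_anticommute (a := 3) (b := 1) (by decide) (by decide) (by decide)
  have hY := pauli_anticommute (a := 3) (b := 2) (by decide) (by decide) (by decide)
  simp only [add_mul, mul_add, mul_smul_comm, smul_mul_assoc, hX, hY, neg_mul, mul_assoc,
    pauli_mul_self, mul_one, one_mul]
  module

theorem onQubit_pauli_three_mem_circuitMonoid (k : Fin n) :
    onQubit k (pauli 3) ∈ circuitMonoid n := by
  have h : Complex.I • onQubit k (piEighth ^ 4) ∈ circuitMonoid n := by
    rw [map_pow]
    exact smul_mem_circuitMonoid (pow_mem (onQubit_piEighth_mem_circuitMonoid k) 4)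
      Complex.norm_I
  rwa [piEighth_pow_four, map_smul, smul_smul, mul_neg, Complex.I_mul_I, neg_neg, one_smul] at h

theorem onQubit_piEighth_pow_two_mem_circuitMonoid (k : Fin n) :
    onQubit k (piEighth ^ 2) ∈ circuitMonoid n := by
  rw [map_pow]
  exact pow_mem (onQubit_piEighth_mem_circuitMonoid k) 2

theorem onQubit_pauli_three_mem_circuitGenerators (k : Fin n) :
    onQubit k (pauli 3) ∈ circuitGenerators n := by
  have axis := onQubit_rotationAxis_mem_circuitGenerators k
  have reflected : onQubit k (pauli 3 * rotationAxis * pauli 3) ∈ circuitGenerators n := by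
    refine mem_circuitGenerators_of_mul_eq (onQubit_pauli_three_mem_circuitMonoid k) axis ?_
    rw [← map_mul, ← map_mul, mul_assoc, pauli_mul_self, mul_one]
  have sum_mem := add_mem axis reflected
  rw [← map_add, rotationAxis, mul_smul_comm, smul_mul_assoc, ← smul_add,
    pauli_combination_add_pauli_three_conj, smul_smul, onQubit_real_smul] at sum_mem
  refine ((circuitGenerators n).smul_mem_iff ?_).mp sum_mem
  have cos_pos : 0 < Real.cos (Real.pi / 8) :=
    Real.cos_pos_of_mem_Ioo ⟨by linarith [Real.pi_pos], by linarith [Real.pi_pos]⟩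
  exact mul_ne_zero (div_ne_zero sin_pi_div_eight_ne_zero sin_rotationAngle_ne_zero)
    (add_pos cos_pos cos_pos).ne'

theorem piEighth_pow_two_mul_pauli_one : piEighth ^ 2 * pauli 1 = pauli 2 * piEighth ^ 2 := by
  rw [piEighth_pow_two, pauli_two_eq]
  simp only [smul_mul_assoc, mul_smul_comm, sub_mul, mul_sub, one_mul, mul_one, smul_smul,
    mul_assoc, pauli_mul_self,
    pauli_anticommute (a := 3) (b := 1) (by decide) (by decide) (by decide), Complex.I_mul_I]
  module

theorem piEighth_pow_two_mul_pauli_two :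
    piEighth ^ 2 * pauli 2 = -(pauli 1 * piEighth ^ 2) := by
  rw [piEighth_pow_two, pauli_two_eq]
  simp only [smul_mul_assoc, mul_smul_comm, sub_mul, mul_sub, one_mul, mul_one, smul_smul,
    ← mul_assoc, pauli_anticommute (a := 3) (b := 1) (by decide) (by decide) (by decide), neg_mul]
  simp only [mul_assoc, pauli_mul_self, mul_one]
  match_scalars
  · ring
  · linear_combination (√2 / 2 : ℂ) * Complex.I_mul_I

theorem pauliString_update (j : Fin n → Fin 4) (k : Fin n) (a : Fin 4) :
    pauliString (Function.update j k a) =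
      tensor (Function.update (fun i => pauli (j i)) k (pauli a)) :=
  congrArg tensor (funext (Function.apply_update (fun _ => pauli) j k a))

theorem onQubit_mul_pauliString {k : Fin n} {u : QubitOp} {j : Fin n → Fin 4} {a : Fin 4} {c : ℂ}
    (h : u * pauli (j k) = c • (pauli a * u)) :
    onQubit k u * pauliString j = (c • pauliString (Function.update j k a)) * onQubit k u := by
  rw [pauliString_update, smul_mul_assoc]
  exact onQubit_mul_tensor (A := fun i => pauli (j i)) h

theorem pauliString_update_mem_circuitGenerators {k : Fin n} {u : QubitOp} {j : Fin n → Fin 4}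
    {a : Fin 4} (hu : onQubit k u ∈ circuitMonoid n)
    (h : u * pauli (j k) = pauli a * u ∨ u * pauli (j k) = -(pauli a * u))
    (hj : pauliString j ∈ circuitGenerators n) :
    pauliString (Function.update j k a) ∈ circuitGenerators n := by
  rcases h with h | h
  · have conj := mem_circuitGenerators_of_mul_eq hu hj
      (onQubit_mul_pauliString (c := 1) (by rw [h, one_smul]))
    rwa [one_smul] at conj
  · have conj := mem_circuitGenerators_of_mul_eq hu hj
      (onQubit_mul_pauliString (c := -1) (by rw [h, neg_one_smul]))
    rwa [neg_one_smul, neg_mem_iff] at conj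

theorem pauliString_update_three_mem_circuitGenerators {k : Fin n} {j : Fin n → Fin 4}
    (hk : j k ≠ 0) (hj : pauliString j ∈ circuitGenerators n) :
    pauliString (Function.update j k 3) ∈ circuitGenerators n := by
  have of_one {l : Fin n → Fin 4} (hl : l k = 1) (h : pauliString l ∈ circuitGenerators n) :
      pauliString (Function.update l k 3) ∈ circuitGenerators n :=
    pauliString_update_mem_circuitGenerators (onQubit_hadamard_mem_circuitMonoid k)
      (Or.inl (by rw [hl, pauli_three_mul_hadamard])) h
  match hjk : j k with
  | 0 => exact absurd hjk hk
  | 1 => exact of_one hjk hj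
  | 2 =>
    have one_mem := pauliString_update_mem_circuitGenerators (a := 1)
      (onQubit_piEighth_pow_two_mem_circuitMonoid k)
      (Or.inr (by rw [hjk, piEighth_pow_two_mul_pauli_two])) hj
    have three_mem := of_one (Function.update_self ..) one_mem
    rwa [Function.update_idem] at three_mem
  | 3 => rwa [← hjk, Function.update_eq_self]

theorem pauliString_update_ne_zero_mem_circuitGenerators {k : Fin n} {j : Fin n → Fin 4}
    (hk : j k ≠ 0) {a : Fin 4} (ha : a ≠ 0) (hj : pauliString j ∈ circuitGenerators n) :
    pauliString (Function.update j k a) ∈ circuitGenerators n := by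
  have three_mem := pauliString_update_three_mem_circuitGenerators hk hj
  have one_mem := pauliString_update_mem_circuitGenerators (a := 1)
    (onQubit_hadamard_mem_circuitMonoid k)
    (Or.inl (by rw [Function.update_self, pauli_one_mul_hadamard])) three_mem
  have two_mem := pauliString_update_mem_circuitGenerators (a := 2)
    (onQubit_piEighth_pow_two_mem_circuitMonoid k)
    (Or.inl (by rw [Function.update_self, piEighth_pow_two_mul_pauli_one])) one_mem
  simp only [Function.update_idem] at one_mem two_mem
  match a with
  | 0 => exact absurd rfl ha
  | 1 => exact one_mem
  | 2 => exact two_mem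
  | 3 => exact three_mem

theorem pauliString_update_of_eq_zero {a : Fin n} {j : Fin n → Fin 4} (ha : j a = 0) (c : Fin 4) :
    pauliString (Function.update j a c) = onQubit a (pauli c) * pauliString j := by
  have h : pauli c * pauli (j a) = (1 : ℂ) • (pauli c * 1) := by
    rw [ha, pauli_zero, one_smul]
  rw [pauliString_update, pauliString, onQubit_mul_tensor (A := fun i => pauli (j i)) h, one_smul,
    map_one, mul_one]

theorem pauliString_update_three_of_eq_zero_mem_circuitGenerators {a b : Fin n} (hab : a ≠ b)
    {j : Fin n → Fin 4} (ha : j a = 0) (hb : j b = 3) (hj : pauliString j ∈ circuitGenerators n) :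
    pauliString (Function.update j a 3) ∈ circuitGenerators n := by
  have commute : onQubit a (pauli 3) * pauliString j = pauliString j * onQubit a (pauli 3) := by
    have h := onQubit_mul_tensor_of_mul_eq (A := fun i => pauli (j i)) (i := a) (c := 1)
      (u := pauli 3) (v := pauli 3) (by rw [ha, pauli_zero, mul_one, one_mul, one_smul])
    rwa [one_smul] at h
  have anticommute : onQubit b (pauli 1) * pauliString j =
      -(pauliString j * onQubit b (pauli 1)) := by
    have h := onQubit_mul_tensor_of_mul_eq (A := fun i => pauli (j i)) (i := b) (c := -1)
      (u := pauli 1) (v := pauli 1)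
      (by rw [hb, neg_one_smul, pauli_anticommute (by decide) (by decide) (by decide)])
    rwa [neg_one_smul] at h
  refine mem_circuitGenerators_of_mul_eq (controlledNot_mem_circuitMonoid hab) hj ?_
  rw [pauliString_update_of_eq_zero ha, commute]
  exact controlledReflection_mul_of_anticommute_target (onQubit_pauli_mul_self a 3)
    (onQubit_commute hab _ _) anticommute commute

/-- The Pauli string grows from `σ₃` on the qubit `b`, which is the target of a controlled NOT for
every further qubit. -/
theorem pauliString_update_piecewise_mem_circuitGenerators (j : Fin n → Fin 4) {b : Fin n}
    {s : Finset (Fin n)} (hb : b ∉ s) :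
    pauliString (Function.update (s.piecewise j 0) b 3) ∈ circuitGenerators n := by
  induction s using Finset.induction_on with
  | empty =>
    rw [Finset.piecewise_empty]
    exact onQubit_pauli b 3 ▸ onQubit_pauli_three_mem_circuitGenerators b
  | insert a s ha ih =>
    obtain ⟨hba, hbs⟩ := not_or.mp (Finset.mem_insert.not.mp hb)
    rw [Finset.piecewise_insert, Function.update_comm (Ne.symm hba)]
    have at_a : Function.update (s.piecewise j 0) b 3 a = 0 := by
      rw [Function.update_of_ne (Ne.symm hba), Finset.piecewise_eq_of_notMem _ _ _ ha,
        Pi.zero_apply]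
    obtain hja | hja := eq_or_ne (j a) 0
    · rw [hja, ← at_a, Function.update_eq_self]
      exact ih hbs
    · have three_mem := pauliString_update_three_of_eq_zero_mem_circuitGenerators (Ne.symm hba) at_a
        (Function.update_self ..) (ih hbs)
      have update_mem := pauliString_update_ne_zero_mem_circuitGenerators (k := a)
        (by rw [Function.update_self]; decide) hja three_mem
      rwa [Function.update_idem] at update_mem

theorem pauliString_mem_circuitGenerators (j : Fin n → Fin 4) :
    pauliString j ∈ circuitGenerators n := by
  obtain rfl | hj := eq_or_ne j 0
  · rw [pauliString_zero]
    exact one_mem_circuitGenerators n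
  · obtain ⟨b, hb⟩ := Function.ne_iff.mp hj
    have three_mem :=
      pauliString_update_piecewise_mem_circuitGenerators j (Finset.notMem_erase b Finset.univ)
    have j_mem := pauliString_update_ne_zero_mem_circuitGenerators (k := b) (a := j b)
      (by rw [Function.update_self]; decide) hb three_mem
    rwa [Function.update_idem, ← Finset.piecewise_insert, Finset.insert_erase (Finset.mem_univ b),
      Finset.piecewise_univ] at j_mem

theorem exists_eq_sum_pauliString (A : QOp n) :
    ∃ c : (Fin n → Fin 4) → ℂ, A = ∑ j, c j • pauliString j := by
  refine ⟨fun j => (2 ^ n)⁻¹ * ∑ p : Bits n × Bits n, A p.1 p.2 * star (pauliString j p.1 p.2), ?_⟩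
  ext a b
  symm
  simp only [Matrix.sum_apply, Matrix.smul_apply, smul_eq_mul]
  calc ∑ j, (2 ^ n)⁻¹ * (∑ p : Bits n × Bits n, A p.1 p.2 * star (pauliString j p.1 p.2)) *
        pauliString j a b
      = (2 ^ n)⁻¹ * ∑ p : Bits n × Bits n, A p.1 p.2 *
          ∑ j, pauliString j a b * star (pauliString j p.1 p.2) := by
        simp only [Finset.mul_sum, Finset.sum_mul]
        rw [Finset.sum_comm]
        exact Finset.sum_congr rfl fun p _ => Finset.sum_congr rfl fun j _ => by ring
    _ = (2 ^ n)⁻¹ * ∑ p : Bits n × Bits n, if (a, b) = p then 2 ^ n * A p.1 p.2 else 0 := by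
        simp only [sum_pauliString_mul_star, mul_ite, mul_zero, Prod.ext_iff, mul_comm]
    _ = A a b := by
        rw [Fintype.sum_ite_eq, inv_mul_cancel_left₀ (pow_ne_zero n two_ne_zero)]

theorem mem_circuitGenerators_of_isSelfAdjoint {A : QOp n} (hA : IsSelfAdjoint A) :
    A ∈ circuitGenerators n := by
  obtain ⟨c, hc⟩ := exists_eq_sum_pauliString A
  have real_part (j : Fin n → Fin 4) :
      (realPart (c j • pauliString j) : QOp n) = (c j).re • pauliString j := by
    have hj : IsSelfAdjoint (pauliString j) := pauliString_conjTranspose j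
    rw [realPart_smul, hj.imaginaryPart, smul_zero, sub_zero, selfAdjoint.val_smul,
      hj.coe_realPart]
  rw [← hA.coe_realPart, hc, map_sum, AddSubgroup.val_finsetSum]
  refine Submodule.sum_mem _ fun j _ => ?_
  rw [real_part]
  exact Submodule.smul_mem _ _ (pauliString_mem_circuitGenerators j)

theorem unitaryGroup_le_circuitClosure (n : ℕ) : unitaryGroup (Bits n) ℂ ≤ circuitClosure n := by
  intro U hU
  rw [← expI_one_cfc_arg hU ((Matrix.finite_spectrum U).continuousOn _)]
  exact (mem_circuitGenerators_of_isSelfAdjoint (IsSelfAdjoint.cfc_arg U)).2 1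

theorem exists_circuitOp_near {U : QOp n} (hU : U ∈ unitaryGroup (Bits n) ℂ) {ε : ℝ}
    (hε : 0 < ε) : ∃ (z : ℂ) (c : List (PlacedGate n)),
      ‖z‖ = 1 ∧ ‖toEuclideanCLM (𝕜 := ℂ) (z • circuitOp c - U)‖ ≤ ε := by
  obtain ⟨_, ⟨z, c, hz, rfl⟩, dist_lt⟩ :=
    Metric.mem_closure_iff.mp (unitaryGroup_le_circuitClosure n hU) ε hε
  rw [dist_comm, dist_eq_norm] at dist_lt
  exact ⟨z, c, hz, dist_lt.le⟩

end Universality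

theorem tendsto_sum_map_pow {α : Type*} (l : List α) {r : α → ℝ} (hr₀ : ∀ a, 0 ≤ r a)
    (hr₁ : ∀ a, r a < 1) :
    Filter.Tendsto (fun t : ℕ => (l.map fun a => r a ^ t).sum) Filter.atTop (nhds 0) := by
  have limit := tendsto_list_sum (f := fun a (t : ℕ) => r a ^ t) (a := fun _ => (0 : ℝ)) l
    fun a _ => tendsto_pow_atTop_nhds_zero_of_lt_one (hr₀ a) (hr₁ a)
  simpa only [List.map_const', List.sum_replicate, smul_zero] using limit

theorem isUniversal_universalSet : IsUniversal universalSet := by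
  intro n U hU ε hε
  obtain ⟨z, c, hz, near⟩ := exists_circuitOp_near hU hε
  have failure_tendsto := tendsto_sum_map_pow c
    (r := fun g => 1 - (1 / 4 : ℝ) ^ g.1.arity)
    (fun g => sub_nonneg.mpr (pow_le_one₀ (by norm_num) (by norm_num)))
    (fun g => sub_lt_self 1 (by positivity))
  obtain ⟨t, failure_lt⟩ := (failure_tendsto.eventually_lt_const hε).exists
  have z_ne_zero : z ≠ 0 := norm_ne_zero_iff.mp (hz ▸ one_ne_zero)
  obtain ⟨p, -, hp⟩ := ((simulableWithin_circuitOp c t).smul z_ne_zero).exists_protocol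
  exact ⟨z • circuitOp c, circuitMonoid_le_unitaryGroup n ⟨z, c, hz, rfl⟩, near, p,
    fun ψ hψ => ⟨(hp ψ hψ).1, (hp ψ hψ).2.trans failure_lt.le⟩⟩

end MeasQC

end

theorem mainTheorem3 :
    -- a finite set of binary measurements that are parities of measurements from {X, Y, Z, W}
    MeasQC.universalSet.Finite ∧
    (∀ M ∈ MeasQC.universalSet,
      MeasQC.IsSeparateOver MeasQC.singleQubitMeas MeasQC.parity M.2) ∧
    -- all of them on two qubits, except two on three qubits
    (∀ M ∈ MeasQC.universalSet, M.1 = 2 ∨ M.1 = 3) ∧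
    {M ∈ MeasQC.universalSet | M.1 = 3}.ncard = 2 ∧
    -- every measurement that Nielsen's scheme calls for when it simulates H, T or C-NOT is
    -- composed of measurements of the set, and only of Bell measurements after one failed trial
    -- (H, C-NOT) or two failed trials (T)
    MeasQC.BasisMeasuredBy (MeasQC.bellMeas 1) (1 : MeasQC.QOp 1) ∧
    (∀ (g : MeasQC.Gate) (errors : List (Fin g.arity → Fin 4)),
      MeasQC.BasisMeasuredBy {p | p.1 ∈ MeasQC.universalSet} (MeasQC.trialGate g.op errors) ∧
      (g.nonBellTrials ≤ errors.length →
        (∃ (j : Fin g.arity → Fin 4) (c : ℂ), ‖c‖ = 1 ∧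
          MeasQC.trialGate g.op errors = c • MeasQC.pauliString j) ∧
        MeasQC.BasisMeasuredBy (MeasQC.bellMeas g.arity) (MeasQC.trialGate g.op errors))) ∧
    -- circuits over {H, T, C-NOT} are simulated exactly; with t trials for each gate, an
    -- a-qubit gate costs 6at operations and fails with probability (1 - 4^(-a))^t
    (∀ (n : ℕ) (c : List (MeasQC.PlacedGate n)) (t : ℕ),
      ∃ p : MeasQC.Protocol MeasQC.universalSet n n,
        p.steps ≤ (c.map fun g => 6 * g.1.arity * t).sum ∧
        p.Simulates (MeasQC.circuitOp c)
          (c.map fun g => (1 - (1 / 4 : ℝ) ^ g.1.arity) ^ t).sum) ∧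
    -- arbitrary unitary operators on any number of qubits are simulated to any accuracy
    MeasQC.IsUniversal MeasQC.universalSet := by
  refine ⟨MeasQC.finite_universalSet, fun M hM => MeasQC.isSeparateOver_of_mem_universalSet hM,
    fun M hM => MeasQC.card_qubits_of_mem_universalSet hM, MeasQC.ncard_three_qubits_universalSet,
    MeasQC.basisMeasuredBy_bellMeas (one_mem _),
    fun g errors => ⟨MeasQC.basisMeasuredBy_trialGate g errors, fun h => ?_⟩,
    fun n c t => (MeasQC.simulableWithin_circuitOp c t).exists_protocol,
    MeasQC.isUniversal_universalSet⟩
  have pauli_mem := MeasQC.trialGate_mem_pauliGroup (MeasQC.op_mem_cliffordHierarchy g) h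
  exact ⟨pauli_mem, MeasQC.basisMeasuredBy_bellMeas pauli_mem⟩
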